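/- **Setting.** Let $X=L^2(0,1)$ with norm $|\cdot|_2$ and inner product $(\cdot,\cdot)$, and let $H_0^1=H_0^1(0,1)$. Set $\eta_k(r)=\sqrt2\sin(\pi k r)$, $k\in\mathbb N=\{1,2,\dots\}$, $E_N=\mathrm{span}\{\eta_1,\dots,\eta_N\}\cong\mathbb R^N$, and let $P_N$ be the orthogonal projection of $X$ onto $E_N$. Let $A:X\to X$ be a nonnegative symmetric operator of trace class, $A_{ij}=(\eta_i,A\eta_j)$, $A_N=P_NAP_N$, and $a_0=\sup_{x\in H_0^1\setminus\{0\}}(x,Ax)/|x'|_2^2$. Let $F:H_0^1\to X$ be a map, $F^{(k)}=(F,\eta_k)$. For a cylinder function $u=g\circ P_N$, $g\in C^2(E_N)$, put $$Lu(x)=\tfrac12\sum_{i,j}A_{ij}\,\partial^2_{ij}u(x)+\sum_k\big((x,\eta_k'')+F^{(k)}(x)\big)\,\partial_ku(x),\qquad x\in H_0^1,$$ where $\partial_k$ is the derivative in direction $\eta_k$. **Weights.** Let $V_\kappa(x)=e^{\kappa|x|_2^2}$. Let $V_{2,\kappa}=V_\kappa$ on $X$ and $\Theta_{2,\kappa}(x)=V_\kappa(x)(1+|x'|_2^2)$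 on $H_0^1$; for $p>2$ let $$V_{p,\kappa}(x)=V_\kappa(x)(1+|x|_p^p)\ \ (x\in X),\qquad \Theta_{p,\kappa}(x)=V_{p,\kappa}(x)(1+|x'|_2^2)+V_\kappa(x)\,\big|(|x|^{p/2})'\big|_2^2\ \ (x\in H_0^1),$$ and $\Theta_{p,\kappa}=\infty$ on $X\setminus H_0^1$. Then $\{V_{p,\kappa}<\infty\}=X_p:=L^p(0,1)$ and $\{\Theta_{p,\kappa}<\infty\}=H_0^1$. For a weight $W:X\to(0,\infty]$, the space $WC_W$ consists of all $f:\{W<\infty\}\to\mathbb R$ that are weakly continuous on each $\{W\le R\}$ and satisfy $\lim_{R\to\infty}\sup_{\{W\ge R\}}|f|/W=0$; let $\|f\|_W=\sup_{\{W<\infty\}}|f|/W$ (for any $f$, with values in $[0,\infty]$). Write $WC_{p,\kappa}$, $\|\cdot\|_{p,\kappa}$ for $W=V_{p,\kappa}$ and $W_1C_{p,\kappa}$, $\|\cdot\|_{1,p,\kappa}$ for $W=\Theta_{p,\kappa}$. For $\kappa\ge0$ let $\mathcal D_\kappa$ be the set of all $u=g\circ P_N$, $N\in\mathbb N$, $g\in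 C^2(E_N)$, with $$\|u\|_{2,\kappa}+\big\||Du|_2\big\|_{2,\kappa}+\|\mathrm{Tr}(AD^2u)\|_{2,\kappa}<\infty.$$ **Assumptions.** There are bounded locally Lipschitz vector fields $F_N:E_N\to E_N$, $N\in\mathbb N$, such that, with $$L_Nv(x)=\tfrac12\mathrm{Tr}(A_ND^2v)(x)+(x''+F_N(x),Dv(x)),\qquad x\in E_N,$$ the following hold. * (F2a) There are $\kappa_0\in(0,\frac1{4a_0}]$ (any $\kappa_0\in(0,\infty)$ being allowed if $a_0=0$) and $Q_{\rm reg}\subset[2,\infty)$ with $2\in Q_{\rm reg}$, and for all $\kappa\in(0,\kappa_0)$, $q\in Q_{\rm reg}$ there are $m_{q,\kappa}>0$ and $\lambda_{q,\kappa}\in\mathbb R$ such that, for all $N\in\mathbb N$, $$L_N(V_{q,\kappa}|_{E_N})\le\lambda_{q,\kappa}V_{q,\kappa}-m_{q,\kappa}\Theta_{q,\kappa}\quad\text{on }E_N.$$ * (F2c) $\lim_{N\to\infty}|P_NF(x)-F_N(P_Nx)|_2=0$ for all $x\in H_0^1$. **Proposition 6.1.** Let $\kappa_0$, $Q_{\rm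 reg}$, $\lambda_{q,\kappa}$, $m_{q,\kappa}$ be as in (F2a). Let $q\in Q_{\rm reg}$, $\kappa\in(0,\kappa_0)$ and $\kappa_1\in[0,\kappa)$ be such that $V_{\kappa_1}F^{(k)}\in W_1C_{q,\kappa}$ for all $k\in\mathbb N$. Then for all $u\in\mathcal D_{\kappa_1}$ and all $\lambda\ge\lambda_{q,\kappa}$ one has $u|_{X_q}\in WC_{q,\kappa}$, $\lambda u-Lu\in W_1C_{q,\kappa}$ and $$\|u\|_{q,\kappa}\le\frac1{m_{q,\kappa}}\,\|\lambda u-Lu\|_{1,q,\kappa}.$$ -/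

import Mathlib

open Set Filter Topology MeasureTheory
open scoped ENNReal NNReal ContDiff

noncomputable section

namespace Kolmogorov

/-- Lebesgue measure on the interval `(0,1)`. -/
abbrev unitVol : Measure ℝ := volume.restrict (Ioo (0 : ℝ) 1)

/-- The state space `X = L²(0,1)`. -/
abbrev X : Type := Lp ℝ 2 unitVol

/-! ### Sobolev space with Dirichlet boundary conditions -/

/-- `g` is a weak (distributional) derivative of `f` on `(0,1)`. -/
def HasWeakDeriv (f g : ℝ → ℝ) : Prop :=
  LocallyIntegrableOn f (Ioo 0 1) ∧ LocallyIntegrableOn g (Ioo 0 1) ∧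
    ∀ φ : ℝ → ℝ, ContDiff ℝ ∞ φ → HasCompactSupport φ → tsupport φ ⊆ Ioo 0 1 →
      ∫ r in Ioo (0 : ℝ) 1, f r * deriv φ r = -∫ r in Ioo (0 : ℝ) 1, g r * φ r

/-- `|f'|₂ ∈ [0,∞]`, where `f'` is the weak derivative of `f` on `(0,1)`; the value is `∞` if `f`
has no weak derivative. The weak derivative is unique up to null sets, so the infimum is over
equal numbers. -/
def derivNorm (f : ℝ → ℝ) : ℝ≥0∞ :=
  ⨅ (g : ℝ → ℝ) (_ : HasWeakDeriv f g), eLpNorm g 2 unitVol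

/-- `H₀¹(0,1)` as a subset of `X`: the weak derivative exists and is square integrable, and the
continuous representative vanishes at `0` and `1`. -/
def H01 : Set X :=
  {x | (∃ g : ℝ → ℝ, MemLp g 2 unitVol ∧ HasWeakDeriv x g) ∧
    ∃ c : ℝ → ℝ, ContinuousOn c (Icc 0 1) ∧ c 0 = 0 ∧ c 1 = 0 ∧ x =ᵐ[unitVol] c}

/-! ### The eigenbasis of the Dirichlet Laplacian and finite-dimensional projections -/

/-- The function `η_{k+1}(r) = √2 sin(π (k+1) r)`. The indices of the eigenbasis are shifted
by one, so that they run through `k = 0, 1, 2, …`. -/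
def etaFun (k : ℕ) (r : ℝ) : ℝ := √2 * Real.sin (Real.pi * (k + 1) * r)

lemma memLp_etaFun (k : ℕ) : MemLp (etaFun k) 2 unitVol := by
  refine MemLp.of_bound ?_ (√2) (Eventually.of_forall fun r => ?_)
  · exact Continuous.aestronglyMeasurable (by unfold etaFun; fun_prop)
  · rw [etaFun, norm_mul, Real.norm_of_nonneg (Real.sqrt_nonneg _)]
    exact mul_le_of_le_one_right (Real.sqrt_nonneg _) (Real.abs_sin_le_one _)

/-- `η_{k+1}` as an element of `X`. -/
def eta (k : ℕ) : X := (memLp_etaFun k).toLp (etaFun k)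

/-- `η_{k+1}'' = -(π (k+1))² η_{k+1}`. -/
lemma deriv_deriv_etaFun (k : ℕ) (r : ℝ) :
    deriv (deriv (etaFun k)) r = -(Real.pi * (k + 1)) ^ 2 * etaFun k r := by
  have h1 : deriv (etaFun k) =
      fun r => √2 * (Real.cos (Real.pi * (k + 1) * r) * (Real.pi * (k + 1))) := by
    funext s
    have h := ((hasDerivAt_id s).const_mul (Real.pi * (k + 1))).sin.const_mul √2
    refine h.deriv.trans ?_
    simp only [id, mul_one]
  rw [h1]
  have h := (((hasDerivAt_id r).const_mul (Real.pi * (k + 1))).cos.mul_const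
    (Real.pi * (k + 1))).const_mul √2
  refine (h.deriv).trans ?_
  simp only [etaFun, id]
  ring

/-- `(Δx, η_{k+1}) := (x, η_{k+1}'') = -(π (k+1))² (x, η_{k+1})`. -/
def lapCoeff (x : X) (k : ℕ) : ℝ := -(Real.pi * (k + 1)) ^ 2 * inner ℝ x (eta k)

/-- `E_N = span {η_1, …, η_N}`, identified with `ℝ^N` (Euclidean norm) through the orthonormal
basis `η_1, …, η_N`. -/
abbrev E (N : ℕ) : Type := EuclideanSpace ℝ (Fin N)

/-- The inclusion `E_N ⊂ X`. -/
def incl (N : ℕ) (ξ : E N) : X := ∑ i : Fin N, ξ i • eta i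

/-- The orthogonal projection `P_N : X → E_N`, in coordinates. -/
def proj (N : ℕ) (x : X) : E N := WithLp.toLp 2 fun i : Fin N => inner ℝ x (eta i)

/-! ### Weights and weighted spaces of weakly continuous functions -/

/-- `V_κ(x) = exp (κ |x|₂²)`. -/
def expW (κ : ℝ) (x : X) : ℝ := Real.exp (κ * ‖x‖ ^ 2)

/-- `|x|_p^p ∈ [0,∞]`. -/
def lpPow (p : ℝ) (x : X) : ℝ≥0∞ := ∫⁻ r in Ioo (0 : ℝ) 1, ‖x r‖ₑ ^ p

/-- `X_p = L^p(0,1)` for `p ≥ 2`, as a subset of `X`. -/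
def Xp (p : ℝ) : Set X := {x | lpPow p x < ⊤}

/-- The Lyapunov function: `V_{2,κ} = V_κ`, and `V_{p,κ}(x) = V_κ(x) (1 + |x|_p^p)` for `p > 2`. -/
def V (p κ : ℝ) (x : X) : ℝ≥0∞ :=
  if p = 2 then ENNReal.ofReal (expW κ x) else ENNReal.ofReal (expW κ x) * (1 + lpPow p x)

open Classical in
/-- The coercivity weight, for `x ∈ H₀¹`: `Θ_{2,κ}(x) = V_κ(x) (1 + |x'|₂²)`, and
`Θ_{p,κ}(x) = V_{p,κ}(x) (1 + |x'|₂²) + V_κ(x) |(|x|^{p/2})'|₂²` for `p > 2`.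
It is `∞` outside `H₀¹`. -/
def Θ (p κ : ℝ) (x : X) : ℝ≥0∞ :=
  if x ∈ H01 then
    V p κ x * (1 + derivNorm x ^ 2) +
      if p = 2 then 0
      else ENNReal.ofReal (expW κ x) * derivNorm (fun r => |x r| ^ (p / 2)) ^ 2
  else ⊤

/-- The topology induced on a subset of `X` by the weak topology of `X`. -/
abbrev weakTop (D : Set X) : TopologicalSpace D :=
  TopologicalSpace.induced (fun x : D => toWeakSpace ℝ X x) inferInstance

/-- The weighted norm `‖f‖_W = sup_{W < ∞} |f| / W ∈ [0,∞]` of a function `f` on `D = {W < ∞}`. -/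
def wnorm {D : Set X} (W : X → ℝ≥0∞) (f : D → ℝ) : ℝ≥0∞ := ⨆ x : D, ‖f x‖ₑ / W x

/-- Membership in `WC_W` of a function `f` on `D = {W < ∞}`: it is weakly continuous on each
`{W ≤ R}`, and `sup_{W ≥ R} |f| / W → 0` as `R → ∞`. Below, `(D, W)` is `(X_p, V_{p,κ})` for
`WC_{p,κ}` and `(H₀¹, Θ_{p,κ})` for `W₁C_{p,κ}`. -/
def MemWC {D : Set X} (W : X → ℝ≥0∞) (f : D → ℝ) : Prop :=
  (∀ R : ℝ≥0, @ContinuousOn D ℝ (weakTop D) inferInstance f {x : D | W x ≤ R}) ∧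
    Tendsto (fun R : ℝ≥0 => ⨆ (x : D) (_ : (R : ℝ≥0∞) ≤ W x), ‖f x‖ₑ / W x) atTop (𝓝 0)

/-! ### The diffusion operator, the Kolmogorov operators and the test functions -/

/-- `A` is a nonnegative symmetric operator of trace class (for a nonnegative symmetric operator
this means that the diagonal series with respect to the orthonormal basis `(η_k)` converges). -/
def IsCovariance (A : X →L[ℝ] X) : Prop :=
  A.IsPositive ∧ Summable fun k : ℕ => inner ℝ (eta k) (A (eta k))

/-- `a₀ = sup_{x ∈ H₀¹ \ {0}} (x, A x) / |x'|₂²`. -/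
def a0 (A : X →L[ℝ] X) : ℝ≥0∞ :=
  ⨆ (x : X) (_ : x ∈ H01 ∧ x ≠ 0), ENNReal.ofReal (inner ℝ x (A x)) / derivNorm x ^ 2

/-- The directional derivative `∂_h u = (Du, h)`. -/
def pd {B : Type*} [NormedAddCommGroup B] [NormedSpace ℝ B] (h : B) (u : B → ℝ) (x : B) : ℝ :=
  fderiv ℝ u x h

/-- `Tr (A D²u(x)) = ∑_{i,j} A_{ij} ∂_i ∂_j u(x)` with `A_{ij} = (η_i, A η_j)`; for cylinder
functions only finitely many terms are nonzero. -/
def traceTerm (A : X →L[ℝ] X) (u : X → ℝ) (x : X) : ℝ :=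
  ∑' ij : ℕ × ℕ, inner ℝ (eta ij.1) (A (eta ij.2)) * pd (eta ij.1) (pd (eta ij.2) u) x

/-- The Kolmogorov operator
`L u(x) = ½ Tr (A D²u(x)) + ∑_k ((Δx, η_k) + (F(x), η_k)) ∂_k u(x)`, `x ∈ H₀¹`. -/
def kolm (A : X →L[ℝ] X) (F : H01 → X) (u : X → ℝ) (x : H01) : ℝ :=
  1 / 2 * traceTerm A u x +
    ∑' k : ℕ, (lapCoeff x k + inner ℝ (F x) (eta k)) * pd (eta k) u x

/-- The operator `L_N v(ξ) = ½ Tr (A_N D²v)(ξ) + (ξ'' + G(ξ), Dv(ξ))` on `E_N`, where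
`A_N = P_N A P_N` and `G` is a vector field on `E_N`. -/
def kolmFin (A : X →L[ℝ] X) (N : ℕ) (G : E N → E N) (v : E N → ℝ) (ξ : E N) : ℝ :=
  1 / 2 * ∑ i : Fin N, ∑ j : Fin N, inner ℝ (eta i) (A (eta j)) *
      pd (EuclideanSpace.single i 1) (pd (EuclideanSpace.single j 1) v) ξ +
    ∑ k : Fin N, (lapCoeff (incl N ξ) k + G ξ k) * pd (EuclideanSpace.single k 1) v ξ

/-- The test functions `𝒟_{p,κ}`: all `u = g ∘ P_N` with `g ∈ C²(ℝ^N)` and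
`‖u‖_{p,κ} + ‖|Du|₂‖_{p,κ} + ‖Tr (A D²u)‖_{p,κ} < ∞`. One writes `𝒟_κ` for `𝒟_{2,κ}`. -/
def testFun (A : X →L[ℝ] X) (p κ : ℝ) : Set (X → ℝ) :=
  {u | (∃ (N : ℕ) (g : E N → ℝ), ContDiff ℝ 2 g ∧ u = g ∘ proj N) ∧
    wnorm (V p κ) (fun x : Xp p => u x) + wnorm (V p κ) (fun x : Xp p => ‖fderiv ℝ u x‖) +
      wnorm (V p κ) (fun x : Xp p => traceTerm A u x) < ⊤}

/-! ### The conditions on the drift -/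

/-- Bounded locally Lipschitz vector fields `F_N : E_N → E_N`, `N ≥ 1`. -/
def IsApprox (FN : (N : ℕ) → E N → E N) : Prop :=
  ∀ N : ℕ, 1 ≤ N → (∃ C : ℝ, ∀ ξ, ‖FN N ξ‖ ≤ C) ∧ LocallyLipschitz (FN N)

/-- Condition (F2a) with witnesses `κ₀`, `Q_reg`, `m_{q,κ}`, `λ_{q,κ}`:
`L_N V_{q,κ} ≤ λ_{q,κ} V_{q,κ} - m_{q,κ} Θ_{q,κ}` on `E_N` for all `N`.
Both weights are finite on `E_N`. -/
def CondF2a (A : X →L[ℝ] X) (FN : (N : ℕ) → E N → E N) (κ₀ : ℝ) (Qreg : Set ℝ)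
    (m lam : ℝ → ℝ → ℝ) : Prop :=
  0 < κ₀ ∧ ENNReal.ofReal κ₀ ≤ 1 / (4 * a0 A) ∧ Qreg ⊆ Ici 2 ∧ 2 ∈ Qreg ∧
    ∀ κ ∈ Ioo 0 κ₀, ∀ q ∈ Qreg, 0 < m q κ ∧
      ∀ N : ℕ, 1 ≤ N → ∀ ξ : E N,
        kolmFin A N (FN N) (fun ζ => (V q κ (incl N ζ)).toReal) ξ ≤
          lam q κ * (V q κ (incl N ξ)).toReal - m q κ * (Θ q κ (incl N ξ)).toReal

/-- Condition (F2c): `|P_N F(x) - F_N(P_N x)|₂ → 0` for all `x ∈ H₀¹`. -/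
def CondF2c (F : H01 → X) (FN : (N : ℕ) → E N → E N) : Prop :=
  ∀ x : H01, Tendsto (fun N => ‖proj N (F x) - FN N (proj N x)‖) atTop (𝓝 0)

end Kolmogorov

end

open Kolmogorov

/-!
If `u > 0` somewhere, then `u / V_{q,κ}` attains a positive maximum `c` over `X_q`, because the
sublevel sets of `V_{q,κ}` are weakly compact and `u` grows more slowly than `V_{q,κ}`. At a
maximiser `x` the first variation `Du(x) = c DV_{q,κ}(x)` reads `α x + β |x|^(q-2) x = e` with a
sine polynomial `e` and coefficients `α > 0`, `β ≥ 0`. Since `s ↦ α s + β |s|^(q-2) s` is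
continuously differentiable with positive derivative, `x` is continuously differentiable with
zero boundary values, so that `Θ_{q,κ}(x) < ∞`. The second variation bounds `D²u(x)` from above
by `c D²V_{q,κ}(x)`, hence `Tr (A D²u(x))` by `c Tr (A_n D²V_{q,κ}(P_n x))` up to an error which
tends to zero. The drift terms of `L` and `L_n` agree in the limit as well, so that (F2a) at
`P_n x` gives `L u(x) ≤ c (λ V_{q,κ} - m Θ_{q,κ})(x)` as `n → ∞`. Since `u(x) = c V_{q,κ}(x)`,
this is `m c Θ_{q,κ}(x) ≤ (λ u - L u)(x)`. The same argument applies to `-u`.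
-/

namespace Kolmogorov

noncomputable section

/-! ### The sine and cosine bases -/

instance : IsProbabilityMeasure unitVol := ⟨by simp⟩

lemma memLp_of_continuous {f : ℝ → ℝ} (hf : Continuous f) (p : ℝ≥0∞) : MemLp f p unitVol := by
  obtain ⟨C, hC⟩ := (isCompact_Icc (a := (0 : ℝ)) (b := 1)).exists_bound_of_continuousOn
    hf.continuousOn
  refine MemLp.of_bound hf.aestronglyMeasurable C ?_
  filter_upwards [ae_restrict_mem measurableSet_Ioo] with r hr
  exact hC r (Ioo_subset_Icc_self hr)

lemma integrable_of_continuous {f : ℝ → ℝ} (hf : Continuous f) : Integrable f unitVol :=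
  (memLp_of_continuous hf 1).integrable le_rfl

lemma integral_unitVol_eq (f : ℝ → ℝ) : ∫ r, f r ∂unitVol = ∫ r in (0 : ℝ)..1, f r := by
  rw [intervalIntegral.integral_of_le zero_le_one, integral_Ioc_eq_integral_Ioo]

lemma inner_eq_integral (x y : X) : inner ℝ x y = ∫ r, x r * y r ∂unitVol := by
  simp only [L2.inner_def, RCLike.inner_apply, conj_trivial, mul_comm]

lemma inner_eq_integral_of_ae_eq {x y : X} {f g : ℝ → ℝ} (hx : x =ᵐ[unitVol] f)
    (hy : y =ᵐ[unitVol] g) : inner ℝ x y = ∫ r, f r * g r ∂unitVol := by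
  rw [inner_eq_integral]
  exact integral_congr_ae (hx.mul hy)

lemma norm_sq_eq_integral {x : X} {f : ℝ → ℝ} (hx : x =ᵐ[unitVol] f) :
    ‖x‖ ^ 2 = ∫ r, f r ^ 2 ∂unitVol := by
  rw [← real_inner_self_eq_norm_sq, inner_eq_integral_of_ae_eq hx hx]
  simp only [sq]

section Multiplication

lemma ae_abs_comp_projIcc_mul_le (f : C(unitInterval, ℝ)) (x : X) :
    ∀ᵐ r ∂unitVol, ‖f (projIcc 0 1 zero_le_one r) * x r‖ ≤ ‖f‖ * ‖x r‖ :=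
  .of_forall fun r => by
    rw [norm_mul]
    gcongr
    exact f.norm_coe_le_norm _

lemma memLp_comp_projIcc_mul (f : C(unitInterval, ℝ)) (x : X) :
    MemLp (fun r => f (projIcc 0 1 zero_le_one r) * x r) 2 unitVol :=
  (Lp.memLp x).of_le_mul
    ((f.continuous.comp continuous_projIcc).aestronglyMeasurable.mul (Lp.aestronglyMeasurable x))
    (ae_abs_comp_projIcc_mul_le f x)

/-- Multiplication of an element of `X` by a continuous function on `[0,1]`. -/
def mulX : C(unitInterval, ℝ) →L[ℝ] X →L[ℝ] X :=
  LinearMap.mkContinuous₂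
    (LinearMap.mk₂ ℝ (fun f x => (memLp_comp_projIcc_mul f x).toLp _)
      (fun f g x => by
        rw [← MemLp.toLp_add]
        exact MemLp.toLp_congr _ _ (.of_forall fun r => add_mul _ _ _))
      (fun c f x => by
        rw [← MemLp.toLp_const_smul]
        exact MemLp.toLp_congr _ _ (.of_forall fun r => mul_assoc c _ _))
      (fun f x y => by
        rw [← MemLp.toLp_add]
        refine MemLp.toLp_congr _ _ ?_
        filter_upwards [Lp.coeFn_add x y] with r hr
        simp only [hr, Pi.add_apply, mul_add])
      (fun c f x => by
        rw [← MemLp.toLp_const_smul]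
        refine MemLp.toLp_congr _ _ ?_
        filter_upwards [Lp.coeFn_smul c x] with r hr
        simp only [hr, Pi.smul_apply, smul_eq_mul, mul_left_comm]))
    1 fun f x => by
      rw [one_mul]
      refine Lp.norm_le_mul_norm_of_ae_le_mul ?_
      filter_upwards [(memLp_comp_projIcc_mul f x).coeFn_toLp, ae_abs_comp_projIcc_mul_le f x]
        with r h h'
      simpa only [LinearMap.mk₂_apply, h] using h'

lemma coeFn_mulX (f : C(unitInterval, ℝ)) (x : X) :
    mulX f x =ᵐ[unitVol] fun r => f (projIcc 0 1 zero_le_one r) * x r :=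
  (memLp_comp_projIcc_mul f x).coeFn_toLp

/-- The embedding of `C[0,1]` into `X`. -/
def toX : C(unitInterval, ℝ) →L[ℝ] X := mulX.flip (Lp.const 2 unitVol 1)

lemma coeFn_toX (f : C(unitInterval, ℝ)) :
    toX f =ᵐ[unitVol] fun r => f (projIcc 0 1 zero_le_one r) := by
  filter_upwards [coeFn_mulX f (Lp.const 2 unitVol 1),
    Lp.coeFn_const (p := 2) (μ := unitVol) (1 : ℝ)] with r h h'
  exact h.trans (by rw [h', Function.const_apply, mul_one])

/-- The restriction of a function on the line to `[0,1]`. -/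
abbrev restr (f : C(ℝ, ℝ)) : C(unitInterval, ℝ) := f.restrict unitInterval

lemma coeFn_mulX_restr (f : C(ℝ, ℝ)) (x : X) :
    mulX (restr f) x =ᵐ[unitVol] fun r => f r * x r := by
  filter_upwards [coeFn_mulX (restr f) x, ae_restrict_mem measurableSet_Ioo] with r h hr
  rw [h, projIcc_of_mem _ (Ioo_subset_Icc_self hr)]
  rfl

lemma coeFn_toX_restr (f : C(ℝ, ℝ)) : toX (restr f) =ᵐ[unitVol] f := by
  filter_upwards [coeFn_toX (restr f), ae_restrict_mem measurableSet_Ioo] with r h hr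
  rw [h, projIcc_of_mem _ (Ioo_subset_Icc_self hr)]
  rfl

lemma eq_toX_restr {x : X} {f : C(ℝ, ℝ)} (h : x =ᵐ[unitVol] f) : x = toX (restr f) :=
  Lp.ext (h.trans (coeFn_toX_restr f).symm)

lemma inner_toX_restr (x : X) (f : C(ℝ, ℝ)) :
    inner ℝ x (toX (restr f)) = ∫ r, x r * f r ∂unitVol :=
  inner_eq_integral_of_ae_eq .rfl (coeFn_toX_restr f)

lemma inner_mulX_left (f : C(unitInterval, ℝ)) (x y : X) :
    inner ℝ (mulX f x) y = inner ℝ x (mulX f y) := by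
  rw [inner_eq_integral_of_ae_eq (coeFn_mulX f x) .rfl,
    inner_eq_integral_of_ae_eq .rfl (coeFn_mulX f y)]
  simp only [mul_left_comm, mul_assoc]

lemma mulX_toX (f g : C(unitInterval, ℝ)) : mulX f (toX g) = toX (f * g) := by
  refine Lp.ext ?_
  filter_upwards [coeFn_mulX f (toX g), coeFn_toX g, coeFn_toX (f * g)] with r h h' h''
  rw [h, h', h'', ContinuousMap.mul_apply]

lemma eq_zero_of_inner_toX {x : X} (h : ∀ f, inner ℝ x (toX f) = 0) : x = 0 := by
  rw [Lp.eq_zero_iff_ae_eq_zero]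
  refine ae_eq_zero_of_integral_contDiff_smul_eq_zero
    ((Lp.memLp x).integrable one_le_two).locallyIntegrable fun g hg _ => ?_
  simpa only [inner_toX_restr, ContinuousMap.coe_mk, smul_eq_mul, mul_comm] using
    h (restr ⟨g, hg.continuous⟩)

end Multiplication

section Trigonometric

lemma integral_cos_pi_int (m : ℤ) :
    ∫ r, Real.cos (Real.pi * m * r) ∂unitVol = if m = 0 then 1 else 0 := by
  rw [integral_unitVol_eq]
  split_ifs with h
  · simp [h]
  · have h0 : Real.pi * (m : ℝ) ≠ 0 := mul_ne_zero Real.pi_ne_zero (Int.cast_ne_zero.mpr h)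
    rw [intervalIntegral.integral_comp_mul_left _ h0]
    simp [mul_comm Real.pi (m : ℝ), Real.sin_int_mul_pi]

/-- `η_{k+1}` as a continuous function on the line. -/
def etaC (k : ℕ) : C(ℝ, ℝ) := ⟨etaFun k, by unfold etaFun; fun_prop⟩

/-- The cosine system `1, √2 cos(πr), √2 cos(2πr), …`. -/
def cosC (k : ℕ) : C(ℝ, ℝ) :=
  ⟨fun r => (if k = 0 then 1 else √2) * Real.cos (Real.pi * k * r), by fun_prop⟩

/-- The cosine system in `X`. -/
def cosX (k : ℕ) : X := toX (restr (cosC k))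

lemma coeFn_eta (k : ℕ) : eta k =ᵐ[unitVol] etaFun k := (memLp_etaFun k).coeFn_toLp

lemma eta_eq_toX (k : ℕ) : eta k = toX (restr (etaC k)) := eq_toX_restr (coeFn_eta k)

lemma coeFn_cosX (k : ℕ) : cosX k =ᵐ[unitVol] cosC k := coeFn_toX_restr _

lemma orthonormal_eta : Orthonormal ℝ eta := by
  rw [orthonormal_iff_ite]
  intro i j
  have prod_to_sum : ∀ r, etaFun i r * etaFun j r =
      Real.cos (Real.pi * ((i - j : ℤ) : ℝ) * r) -
        Real.cos (Real.pi * ((i + j + 2 : ℤ) : ℝ) * r) := fun r => by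
    calc etaFun i r * etaFun j r
        = √2 * √2 * Real.sin (Real.pi * (i + 1) * r) * Real.sin (Real.pi * (j + 1) * r) := by
          simp only [etaFun]; ring
      _ = _ := by
          rw [Real.mul_self_sqrt zero_le_two, Real.two_mul_sin_mul_sin]
          push_cast
          ring_nf
  rw [inner_eq_integral_of_ae_eq (coeFn_eta i) (coeFn_eta j), funext prod_to_sum,
    integral_sub (integrable_of_continuous (by fun_prop)) (integrable_of_continuous (by fun_prop)),
    integral_cos_pi_int, integral_cos_pi_int, if_neg (by lia : ¬(i + j + 2 : ℤ) = 0), sub_zero]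
  exact if_congr (by lia) rfl rfl

lemma orthonormal_cosX : Orthonormal ℝ cosX := by
  rw [orthonormal_iff_ite]
  intro i j
  have prod_to_sum : ∀ r, cosC i r * cosC j r =
      (if i = 0 then 1 else √2) * (if j = 0 then 1 else √2) / 2 *
        (Real.cos (Real.pi * ((i - j : ℤ) : ℝ) * r) +
          Real.cos (Real.pi * ((i + j : ℤ) : ℝ) * r)) := fun r => by
    have := Real.two_mul_cos_mul_cos (Real.pi * i * r) (Real.pi * j * r)
    simp only [← sub_mul, ← add_mul, ← mul_sub, ← mul_add] at this
    simp only [cosC, ContinuousMap.coe_mk, Int.cast_sub, Int.cast_add, Int.cast_natCast, ← this]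
    ring
  rw [inner_eq_integral_of_ae_eq (coeFn_cosX i) (coeFn_cosX j), funext prod_to_sum,
    integral_const_mul, integral_add (integrable_of_continuous (by fun_prop))
      (integrable_of_continuous (by fun_prop)), integral_cos_pi_int, integral_cos_pi_int,
    if_congr (by lia : (i - j : ℤ) = 0 ↔ i = j) rfl rfl,
    if_congr (by lia : (i + j : ℤ) = 0 ↔ i = 0 ∧ j = 0) rfl rfl]
  have sqrt_two_mul_self := Real.mul_self_sqrt (zero_le_two : (0 : ℝ) ≤ 2)
  rcases eq_or_ne i 0 with rfl | hi <;> rcases eq_or_ne j 0 with rfl | hj <;>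
    norm_num [*, Ne.symm]

/-- The cosine `r ↦ cos (π j r)` of integral frequency. -/
def cosZ (j : ℤ) : C(ℝ, ℝ) := ⟨fun r => Real.cos (Real.pi * j * r), by fun_prop⟩

lemma two_smul_cosZ_one_mul (j : ℤ) :
    (2 : ℝ) • (cosZ 1 * cosZ j) = cosZ (j + 1) + cosZ (j - 1) := by
  ext r
  have product := Real.two_mul_cos_mul_cos (Real.pi * j * r) (Real.pi * (1 : ℤ) * r)
  simp only [← sub_mul, ← add_mul, ← mul_sub, ← mul_add, ← Int.cast_add, ← Int.cast_sub] at product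
  simp only [cosZ, ContinuousMap.smul_apply, ContinuousMap.mul_apply, ContinuousMap.add_apply,
    ContinuousMap.coe_mk, smul_eq_mul]
  linarith

lemma inner_toX_cosZ_one_pow_mul {x : X} (h : ∀ j, inner ℝ x (toX (restr (cosZ j))) = 0)
    (n : ℕ) (j : ℤ) : inner ℝ x (toX (restr (cosZ 1) ^ n * restr (cosZ j))) = 0 := by
  induction n generalizing j with
  | zero => rw [pow_zero, one_mul, h]
  | succ n ih =>
    have expand : (2 : ℝ) • (restr (cosZ 1) ^ (n + 1) * restr (cosZ j)) =
        restr (cosZ 1) ^ n * restr (cosZ (j + 1)) + restr (cosZ 1) ^ n * restr (cosZ (j - 1)) := by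
      rw [← mul_add, pow_succ, mul_assoc, ← mul_smul_comm]
      exact congrArg (restr (cosZ 1) ^ n * restr ·) (two_smul_cosZ_one_mul j)
    have := congrArg (fun f => inner ℝ x (toX f)) expand
    simpa only [map_smul, map_add, inner_add_right, inner_smul_right, ih, add_zero, mul_eq_zero,
      two_ne_zero, false_or] using this

lemma adjoin_cosZ_one_topologicalClosure :
    (Algebra.adjoin ℝ {restr (cosZ 1)}).topologicalClosure = ⊤ := by
  refine ContinuousMap.subalgebra_topologicalClosure_eq_top_of_separatesPoints _ fun s t hst =>
    ⟨_, ⟨restr (cosZ 1), Algebra.self_mem_adjoin_singleton ℝ _, rfl⟩, fun heq => hst ?_⟩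
  have mem_Icc (r : unitInterval) : Real.pi * (1 : ℤ) * (r : ℝ) ∈ Icc 0 Real.pi :=
    ⟨by simpa using mul_nonneg Real.pi_pos.le r.2.1,
      by simpa using mul_le_of_le_one_right Real.pi_pos.le r.2.2⟩
  have := Real.injOn_cos (mem_Icc s) (mem_Icc t) heq
  exact Subtype.ext (by simpa [Real.pi_ne_zero] using this)

lemma eq_zero_of_inner_cosZ {x : X} (h : ∀ j, inner ℝ x (toX (restr (cosZ j))) = 0) : x = 0 := by
  refine eq_zero_of_inner_toX fun f => ?_
  have closed : IsClosed {f | inner ℝ x (toX f) = 0} :=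
    isClosed_eq (continuous_const.inner toX.continuous) continuous_const
  have mem_closure : f ∈ (Algebra.adjoin ℝ {restr (cosZ 1)}).topologicalClosure :=
    adjoin_cosZ_one_topologicalClosure ▸ Algebra.mem_top
  refine closed.closure_subset_iff.mpr (fun f hf => ?_) mem_closure
  obtain ⟨p, rfl⟩ := Algebra.adjoin_singleton_eq_range_aeval ℝ (restr (cosZ 1)) ▸ hf
  have restr_cosZ_zero : restr (cosZ 0) = 1 := by ext; simp [cosZ]
  change inner ℝ x (toX (Polynomial.aeval (restr (cosZ 1)) p)) = 0
  rw [Polynomial.aeval_eq_sum_range, map_sum, inner_sum]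
  refine Finset.sum_eq_zero fun n _ => ?_
  have := inner_toX_cosZ_one_pow_mul h n 0
  rw [restr_cosZ_zero, mul_one] at this
  rw [map_smul, inner_smul_right, this, mul_zero]

lemma eq_zero_of_inner_cosX {x : X} (h : ∀ k, inner ℝ x (cosX k) = 0) : x = 0 := by
  refine eq_zero_of_inner_cosZ fun j => ?_
  have cosX_eq : cosX j.natAbs =
      (if j.natAbs = 0 then 1 else √2 : ℝ) • toX (restr (cosZ j)) := by
    rw [cosX, ← map_smul]
    congr 1
    ext r
    obtain ⟨k, rfl | rfl⟩ := j.eq_nat_or_neg <;> by_cases hk : k = 0 <;> simp [cosC, cosZ, hk]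
  have := h j.natAbs
  rw [cosX_eq, inner_smul_right] at this
  exact (mul_eq_zero.mp this).resolve_left (by split_ifs <;> positivity)

lemma integral_mul_sin_eq_zero {x : X} (h : ∀ k, inner ℝ x (eta k) = 0) (j : ℤ) :
    ∫ r, x r * Real.sin (Real.pi * j * r) ∂unitVol = 0 := by
  have pos (k : ℕ) : ∫ r, x r * Real.sin (Real.pi * (k + 1) * r) ∂unitVol = 0 := by
    have := h k
    rw [inner_eq_integral_of_ae_eq .rfl (coeFn_eta k)] at this
    simp only [etaFun, mul_left_comm _ √2] at this
    rw [integral_const_mul] at this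
    exact (mul_eq_zero.mp this).resolve_left (by positivity)
  obtain ⟨_ | k, rfl | rfl⟩ := j.eq_nat_or_neg
  · simp
  · simp
  · simpa using pos k
  · simpa [integral_neg, -neg_add_rev] using pos k

lemma eq_zero_of_inner_eta {x : X} (h : ∀ k, inner ℝ x (eta k) = 0) : x = 0 := by
  let s : C(ℝ, ℝ) := ⟨fun r => Real.sin (Real.pi * r), by fun_prop⟩
  have sin_mul_cos (j : ℤ) (r : ℝ) : s r * cosZ j r =
      1 / 2 * Real.sin (Real.pi * ((j + 1 : ℤ) : ℝ) * r) -
        1 / 2 * Real.sin (Real.pi * ((j - 1 : ℤ) : ℝ) * r) := by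
    rw [← mul_sub, Real.sin_sub_sin]
    simp only [s, cosZ, ContinuousMap.coe_mk]
    push_cast
    ring_nf
  have integrable {f : ℝ → ℝ} (hf : Continuous f) : Integrable (fun r => x r * f r) unitVol :=
    (Lp.memLp x).integrable_mul (memLp_of_continuous hf 2)
  have mulX_eq_zero : mulX (restr s) x = 0 := by
    refine eq_zero_of_inner_cosZ fun j => ?_
    rw [inner_mulX_left, mulX_toX]
    refine (inner_toX_restr x (s * cosZ j)).trans ?_
    simp only [ContinuousMap.mul_apply, sin_mul_cos, mul_sub, mul_left_comm _ (1 / 2 : ℝ)]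
    rw [integral_sub ((integrable (by fun_prop)).const_mul _)
      ((integrable (by fun_prop)).const_mul _), integral_const_mul, integral_const_mul,
      integral_mul_sin_eq_zero h, integral_mul_sin_eq_zero h, sub_self]
  rw [Lp.eq_zero_iff_ae_eq_zero] at mulX_eq_zero ⊢
  filter_upwards [mulX_eq_zero, coeFn_mulX_restr s x, ae_restrict_mem measurableSet_Ioo]
    with r h0 hr hmem
  have sin_pos : 0 < s r := Real.sin_pos_of_pos_of_lt_pi (mul_pos Real.pi_pos hmem.1)
    (mul_lt_of_lt_one_right Real.pi_pos hmem.2)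
  exact (mul_eq_zero.mp (hr.symm.trans h0)).resolve_left sin_pos.ne'

/-- The Hilbert basis `η_1, η_2, …` of `X`. -/
def etaBasis : HilbertBasis ℕ ℝ X :=
  HilbertBasis.mkOfOrthogonalEqBot orthonormal_eta <| (Submodule.eq_bot_iff _).mpr fun _ hx =>
    eq_zero_of_inner_eta fun k =>
      Submodule.inner_left_of_mem_orthogonal (Submodule.subset_span (mem_range_self k)) hx

/-- The Hilbert basis of cosines, in which derivatives of sine series are expanded. -/
def cosBasis : HilbertBasis ℕ ℝ X :=
  HilbertBasis.mkOfOrthogonalEqBot orthonormal_cosX <| (Submodule.eq_bot_iff _).mpr fun _ hx =>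
    eq_zero_of_inner_cosX fun k =>
      Submodule.inner_left_of_mem_orthogonal (Submodule.subset_span (mem_range_self k)) hx

lemma etaBasis_apply (k : ℕ) : etaBasis k = eta k := by
  rw [etaBasis, HilbertBasis.coe_mkOfOrthogonalEqBot]

lemma cosBasis_apply (k : ℕ) : cosBasis k = cosX k := by
  rw [cosBasis, HilbertBasis.coe_mkOfOrthogonalEqBot]

lemma hasSum_inner_eta_sq (x : X) : HasSum (fun k => inner ℝ x (eta k) ^ 2) (‖x‖ ^ 2) := by
  have parseval := etaBasis.hasSum_inner_mul_inner x x
  simpa only [etaBasis_apply, real_inner_comm x, ← sq, real_inner_self_eq_norm_sq] using parseval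

lemma hasSum_cosX (x : X) : HasSum (fun k => inner ℝ x (cosX k) • cosX k) x := by
  have expansion := cosBasis.hasSum_repr x
  simpa only [cosBasis.repr_apply_apply, cosBasis_apply, real_inner_comm x] using expansion

lemma norm_eta (k : ℕ) : ‖eta k‖ = 1 := orthonormal_eta.1 k

end Trigonometric

/-! ### Weak derivatives -/

section WeakDerivative

/-- Smooth functions with compact support in `(0,1)`, the test functions of `HasWeakDeriv`. -/
structure IsTest (φ : ℝ → ℝ) : Prop where
  contDiff : ContDiff ℝ ∞ φ
  hasCompactSupport : HasCompactSupport φ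
  tsupport_subset : tsupport φ ⊆ Ioo 0 1

lemma IsTest.eq_zero {φ : ℝ → ℝ} (hφ : IsTest φ) {r : ℝ} (hr : r ∉ Ioo (0 : ℝ) 1) : φ r = 0 :=
  image_eq_zero_of_notMem_tsupport fun h => hr (hφ.tsupport_subset h)

lemma IsTest.zero {φ : ℝ → ℝ} (hφ : IsTest φ) : φ 0 = 0 := hφ.eq_zero (by simp)

lemma IsTest.one {φ : ℝ → ℝ} (hφ : IsTest φ) : φ 1 = 0 := hφ.eq_zero (by simp)

lemma IsTest.integrable_mul {φ f : ℝ → ℝ} (hφ : IsTest φ) (hf : LocallyIntegrableOn f (Ioo 0 1)) :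
    Integrable (fun r => f r * φ r) := by
  have integrableOn : IntegrableOn f (tsupport φ) :=
    hf.integrableOn_compact_subset hφ.tsupport_subset hφ.hasCompactSupport
  obtain ⟨C, hC⟩ := hφ.contDiff.continuous.bounded_above_of_compact_support hφ.hasCompactSupport
  refine (integrableOn_iff_integrable_of_support_subset fun r hr => ?_).mp
    (integrableOn.mul_bdd (c := C) hφ.contDiff.continuous.aestronglyMeasurable (.of_forall hC))
  exact subset_tsupport _ (right_ne_zero_of_mul hr)

lemma IsTest.integral_unitVol_mul {φ : ℝ → ℝ} (hφ : IsTest φ) (f : ℝ → ℝ) :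
    ∫ r, f r * φ r ∂unitVol = ∫ r, f r * φ r :=
  setIntegral_eq_integral_of_forall_compl_eq_zero fun r hr => by rw [hφ.eq_zero hr, mul_zero]

lemma ae_eq_zero_of_integral_mul_isTest {f : ℝ → ℝ} (hf : LocallyIntegrableOn f (Ioo 0 1))
    (h : ∀ φ, IsTest φ → ∫ r, f r * φ r ∂unitVol = 0) : f =ᵐ[unitVol] 0 := by
  rw [Filter.EventuallyEq, ae_restrict_iff' measurableSet_Ioo]
  refine isOpen_Ioo.ae_eq_zero_of_integral_contDiff_smul_eq_zero hf fun φ hφ hφc hφs => ?_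
  have test : IsTest φ := ⟨hφ, hφc, hφs⟩
  simpa only [test.integral_unitVol_mul, smul_eq_mul, mul_comm (φ _)] using h φ test

lemma IsTest.exists_bounds {h : ℝ → ℝ} (hh : IsTest h) :
    ∃ a b, 0 < a ∧ b < 1 ∧ (∀ r ≤ a, h r = 0) ∧ ∀ r ≥ b, h r = 0 := by
  rcases (tsupport h).eq_empty_or_nonempty with h0 | hne
  · have h_zero : h = 0 := tsupport_eq_empty_iff.mp h0
    exact ⟨1 / 2, 1 / 2, by norm_num, by norm_num, by simp [h_zero], by simp [h_zero]⟩
  have lower := hh.hasCompactSupport.isLeast_sInf hne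
  have upper := hh.hasCompactSupport.isGreatest_sSup hne
  have pos := (hh.tsupport_subset lower.1).1
  have lt_one := (hh.tsupport_subset upper.1).2
  refine ⟨sInf (tsupport h) / 2, (sSup (tsupport h) + 1) / 2, by linarith, by linarith,
    fun r hr => image_eq_zero_of_notMem_tsupport fun hmem => ?_,
    fun r hr => image_eq_zero_of_notMem_tsupport fun hmem => ?_⟩
  · linarith [lower.2 hmem]
  · linarith [upper.2 hmem]

lemma IsTest.exists_primitive {h : ℝ → ℝ} (hh : IsTest h) (hint : ∫ r, h r ∂unitVol = 0) :
    ∃ φ, IsTest φ ∧ deriv φ = h := by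
  obtain ⟨a, b, ha, hb, zero_left, zero_right⟩ := hh.exists_bounds
  have continuous := hh.contDiff.continuous
  have hasDerivAt (r : ℝ) : HasDerivAt (fun r => ∫ s in (0 : ℝ)..r, h s) (h r) r :=
    continuous.integral_hasStrictDerivAt 0 r |>.hasDerivAt
  have deriv_eq : deriv (fun r => ∫ s in (0 : ℝ)..r, h s) = h :=
    funext fun r => (hasDerivAt r).deriv
  have integral_zero {c r : ℝ} (hz : ∀ s ∈ uIcc c r, h s = 0) : ∫ s in c..r, h s = 0 :=
    (intervalIntegral.integral_congr hz).trans intervalIntegral.integral_zero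
  have support : tsupport (fun r => ∫ s in (0 : ℝ)..r, h s) ⊆ Icc a b := by
    refine closure_minimal (fun r hr => ?_) isClosed_Icc
    by_contra hmem
    rcases not_and_or.mp hmem with hra | hrb
    · exact hr (integral_zero fun s hs => zero_left s
        (hs.2.trans (max_le ha.le (not_le.mp hra).le)))
    · refine hr ?_
      calc ∫ s in (0 : ℝ)..r, h s
          = (∫ s in (0 : ℝ)..1, h s) + ∫ s in (1 : ℝ)..r, h s :=
            (intervalIntegral.integral_add_adjacent_intervals
              (continuous.intervalIntegrable 0 1) (continuous.intervalIntegrable 1 r)).symm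
        _ = 0 := by
            rw [← integral_unitVol_eq, hint, zero_add]
            exact integral_zero fun s hs =>
              zero_right s ((le_min hb.le (not_le.mp hrb).le).trans hs.1)
  exact ⟨_, ⟨contDiff_infty_iff_deriv.mpr
      ⟨fun r => (hasDerivAt r).differentiableAt, by rw [deriv_eq]; exact hh.contDiff⟩,
    isCompact_Icc.of_isClosed_subset (isClosed_tsupport _) support,
    support.trans (Icc_subset_Ioo ha hb)⟩, deriv_eq⟩

lemma IsTest.sub_const_mul {φ ρ : ℝ → ℝ} (hφ : IsTest φ) (hρ : IsTest ρ) (c : ℝ) :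
    IsTest fun r => φ r - c * ρ r where
  contDiff := hφ.contDiff.sub (contDiff_const.mul hρ.contDiff)
  hasCompactSupport := hφ.hasCompactSupport.sub hρ.hasCompactSupport.mul_left
  tsupport_subset := (tsupport_sub _ _).trans <| union_subset hφ.tsupport_subset <|
    tsupport_mul_subset_right.trans hρ.tsupport_subset

lemma exists_isTest_integral_eq_one : ∃ ρ, IsTest ρ ∧ ∫ r, ρ r ∂unitVol = 1 := by
  let bump : ContDiffBump (1 / 2 : ℝ) := ⟨1 / 8, 1 / 4, by norm_num, by norm_num⟩
  have test : IsTest (bump.normed volume) :=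
    ⟨bump.contDiff_normed, bump.hasCompactSupport_normed, by
      rw [bump.tsupport_normed_eq, Real.closedBall_eq_Icc]
      exact Icc_subset_Ioo (by norm_num [bump]) (by norm_num [bump])⟩
  have := test.integral_unitVol_mul fun _ => 1
  simp only [one_mul, bump.integral_normed] at this
  exact ⟨_, test, this⟩

namespace HasWeakDeriv

lemma sub {f₁ f₂ g₁ g₂ : ℝ → ℝ} (h₁ : HasWeakDeriv f₁ g₁) (h₂ : HasWeakDeriv f₂ g₂) :
    HasWeakDeriv (f₁ - f₂) (g₁ - g₂) := by
  refine ⟨h₁.1.sub h₂.1, h₁.2.1.sub h₂.2.1, fun φ hφ hφc hφs => ?_⟩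
  have test : IsTest φ := ⟨hφ, hφc, hφs⟩
  have test' : IsTest (deriv φ) :=
    ⟨(contDiff_infty_iff_deriv.mp hφ).2, hφc.deriv, tsupport_deriv_subset.trans hφs⟩
  simp only [Pi.sub_apply, sub_mul]
  rw [integral_sub (test'.integrable_mul h₁.1).restrict (test'.integrable_mul h₂.1).restrict,
    integral_sub (test.integrable_mul h₁.2.1).restrict (test.integrable_mul h₂.2.1).restrict,
    h₁.2.2 φ hφ hφc hφs, h₂.2.2 φ hφ hφc hφs]
  ring

lemma congr {f₁ f₂ g : ℝ → ℝ} (h : f₁ =ᵐ[unitVol] f₂) (hf : HasWeakDeriv f₂ g) :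
    HasWeakDeriv f₁ g := by
  refine ⟨hf.1.congr h.symm, hf.2.1, fun φ hφ hφc hφs => ?_⟩
  rw [← hf.2.2 φ hφ hφc hφs]
  exact integral_congr_ae (h.mono fun r hr => by simp only [hr])

lemma unique {f g₁ g₂ : ℝ → ℝ} (h₁ : HasWeakDeriv f g₁) (h₂ : HasWeakDeriv f g₂) :
    g₁ =ᵐ[unitVol] g₂ := by
  have hsub := h₁.sub h₂
  have sub_ae_zero := ae_eq_zero_of_integral_mul_isTest hsub.2.1 fun φ hφ => by
    simpa [eq_comm] using hsub.2.2 φ hφ.1 hφ.2 hφ.3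
  exact sub_ae_zero.mono fun r => sub_eq_zero.mp

lemma ae_eq_const {f : ℝ → ℝ} (hf : HasWeakDeriv f 0) : ∃ C : ℝ, f =ᵐ[unitVol] fun _ => C := by
  obtain ⟨ρ, hρ, integral_ρ⟩ := exists_isTest_integral_eq_one
  have locallyIntegrableOn_const (C : ℝ) : LocallyIntegrableOn (fun _ : ℝ => C) (Ioo 0 1) :=
    (locallyIntegrable_const C).locallyIntegrableOn _
  set C := ∫ r, f r * ρ r ∂unitVol with hC
  have sub_ae_zero := ae_eq_zero_of_integral_mul_isTest (hf.1.sub (locallyIntegrableOn_const C))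
      fun φ hφ => by
    -- Up to a multiple of `ρ`, every test function is the derivative of a test function.
    set c := ∫ r, φ r ∂unitVol with hc
    have integrable {g : ℝ → ℝ} (hg : IsTest g) : Integrable g unitVol :=
      integrable_of_continuous hg.contDiff.continuous
    obtain ⟨ψ, hψ, deriv_ψ⟩ := (hφ.sub_const_mul hρ c).exists_primitive (by
      rw [integral_sub (integrable hφ) ((integrable hρ).const_mul c), integral_const_mul,
        integral_ρ, mul_one, ← hc, sub_self])
    have weak := hf.2.2 ψ hψ.1 hψ.2 hψ.3
    simp only [deriv_ψ, Pi.zero_apply, zero_mul, integral_zero, neg_zero, mul_sub,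
      mul_left_comm _ c] at weak
    rw [integral_sub (hφ.integrable_mul hf.1).restrict
      ((hρ.integrable_mul hf.1).restrict.const_mul c), integral_const_mul, ← hC] at weak
    simp only [Pi.sub_apply, sub_mul]
    rw [integral_sub (hφ.integrable_mul hf.1).restrict
      (hφ.integrable_mul (locallyIntegrableOn_const C)).restrict, integral_const_mul, ← hc]
    linarith
  exact ⟨C, sub_ae_zero.mono fun r => sub_eq_zero.mp⟩

end HasWeakDeriv

lemma intervalIntegrable_of_integrable {g : ℝ → ℝ} (hg : Integrable g unitVol) :
    IntervalIntegrable g volume 0 1 := by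
  rwa [intervalIntegrable_iff_integrableOn_Ioo_of_le zero_le_one]

lemma absolutelyContinuousOnInterval_primitive {g : ℝ → ℝ} (hg : Integrable g unitVol) :
    AbsolutelyContinuousOnInterval (fun r => ∫ s in (0 : ℝ)..r, g s) 0 1 :=
  (intervalIntegrable_of_integrable hg).absolutelyContinuousOnInterval_intervalIntegral
    left_mem_uIcc

lemma continuousOn_primitive {g : ℝ → ℝ} (hg : Integrable g unitVol) :
    ContinuousOn (fun r => ∫ s in (0 : ℝ)..r, g s) (Icc 0 1) :=
  uIcc_of_le (zero_le_one' ℝ) ▸ (absolutelyContinuousOnInterval_primitive hg).continuousOn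

lemma ae_hasDerivAt_primitive {g : ℝ → ℝ} (hg : Integrable g unitVol) :
    ∀ᵐ r ∂unitVol, HasDerivAt (fun r => ∫ s in (0 : ℝ)..r, g s) (g r) r := by
  filter_upwards
    [ae_restrict_of_ae (intervalIntegrable_of_integrable hg).ae_hasDerivAt_integral,
    ae_restrict_mem measurableSet_Ioo] with r h hr
  exact h (uIcc_of_le (zero_le_one' ℝ) ▸ Ioo_subset_Icc_self hr) 0 left_mem_uIcc

lemma integral_primitive_mul_deriv {g w : ℝ → ℝ} (hg : Integrable g unitVol)
    (hw : ContDiff ℝ 1 w) :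
    ∫ r, (∫ s in (0 : ℝ)..r, g s) * deriv w r ∂unitVol =
      (∫ s, g s ∂unitVol) * w 1 - ∫ r, g r * w r ∂unitVol := by
  have parts := (absolutelyContinuousOnInterval_primitive hg).integral_mul_deriv_eq_deriv_mul
    hw.contDiffOn.absolutelyContinuousOnInterval
  have deriv_primitive : ∫ r in (0 : ℝ)..1, deriv (fun r => ∫ s in (0 : ℝ)..r, g s) r * w r =
      ∫ r, g r * w r ∂unitVol := by
    rw [← integral_unitVol_eq]
    refine integral_congr_ae ?_
    filter_upwards [ae_hasDerivAt_primitive hg] with r hr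
    rw [hr.deriv]
  rw [integral_unitVol_eq, parts, deriv_primitive, intervalIntegral.integral_same, zero_mul,
    sub_zero, integral_unitVol_eq g]

lemma hasWeakDeriv_primitive {g : ℝ → ℝ} (hg : Integrable g unitVol) :
    HasWeakDeriv (fun r => ∫ s in (0 : ℝ)..r, g s) g := by
  refine ⟨((continuousOn_primitive hg).mono Ioo_subset_Icc_self).locallyIntegrableOn
    measurableSet_Ioo,
    IntegrableOn.locallyIntegrableOn hg, fun φ hφ hφc hφs => ?_⟩
  rw [integral_primitive_mul_deriv hg (hφ.of_le (by simp)), (IsTest.mk hφ hφc hφs).one, mul_zero,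
    zero_sub]

lemma ae_eq_primitive_of_mem_H01 {x : X} (hx : x ∈ H01) {g : ℝ → ℝ} (hg : HasWeakDeriv x g)
    (hint : Integrable g unitVol) :
    x =ᵐ[unitVol] (fun r => ∫ s in (0 : ℝ)..r, g s) ∧ ∫ r, g r ∂unitVol = 0 := by
  obtain ⟨c, hc, hc0, hc1, hxc⟩ := hx.2
  obtain ⟨C, hC⟩ := HasWeakDeriv.ae_eq_const (by
    simpa only [sub_self] using hg.sub (hasWeakDeriv_primitive hint))
  have eqOn : EqOn (fun r => c r - ∫ s in (0 : ℝ)..r, g s) (fun _ => C) (Icc 0 1) := by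
    refine Measure.eqOn_Icc_of_ae_eq volume zero_ne_one ?_ (hc.sub (continuousOn_primitive hint))
      continuousOn_const
    rw [← Measure.restrict_congr_set Ioo_ae_eq_Icc]
    exact (hxc.symm.sub .rfl).trans hC
  have C_eq : C = 0 := by simpa [hc0] using (eqOn (left_mem_Icc.mpr zero_le_one)).symm
  subst C_eq
  refine ⟨hC.mono fun r => sub_eq_zero.mp, ?_⟩
  rw [integral_unitVol_eq]
  simpa [hc1] using eqOn (right_mem_Icc.mpr zero_le_one)

lemma integral_mul_deriv_of_mem_H01 {x : X} (hx : x ∈ H01) {g w : ℝ → ℝ} (hg : HasWeakDeriv x g)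
    (hint : Integrable g unitVol) (hw : ContDiff ℝ 1 w) :
    ∫ r, x r * deriv w r ∂unitVol = -∫ r, g r * w r ∂unitVol := by
  obtain ⟨x_eq, integral_g⟩ := ae_eq_primitive_of_mem_H01 hx hg hint
  rw [← zero_sub, ← zero_mul (w 1), ← integral_g, ← integral_primitive_mul_deriv hint hw]
  exact integral_congr_ae (x_eq.mul .rfl)

lemma integral_mul_deriv_eq_neg {f g f' g' : ℝ → ℝ} (hf : ∀ r, HasDerivAt f (f' r) r)
    (hg : ∀ r, HasDerivAt g (g' r) r) (hf' : Continuous f') (hg' : Continuous g') (h0 : f 0 = 0)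
    (h1 : f 1 = 0) : ∫ r, f r * g' r ∂unitVol = -∫ r, f' r * g r ∂unitVol := by
  rw [integral_unitVol_eq, integral_unitVol_eq,
    intervalIntegral.integral_mul_deriv_eq_deriv_mul (fun r _ => hf r) (fun r _ => hg r)
      (hf'.intervalIntegrable _ _) (hg'.intervalIntegrable _ _), h0, h1]
  ring

lemma hasWeakDeriv_of_hasDerivAt {y y' : C(ℝ, ℝ)} (h : ∀ r, HasDerivAt y (y' r) r) :
    HasWeakDeriv y y' := by
  refine ⟨y.continuous.locallyIntegrable.locallyIntegrableOn _,
    y'.continuous.locallyIntegrable.locallyIntegrableOn _, fun φ hφ hφc hφs => ?_⟩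
  have test : IsTest φ := ⟨hφ, hφc, hφs⟩
  have parts := integral_mul_deriv_eq_neg (fun r => (hφ.differentiable (by simp) r).hasDerivAt) h
    (hφ.continuous_deriv (by simp)) y'.continuous test.zero test.one
  simp only [mul_comm (φ _), mul_comm (deriv φ _)] at parts
  rw [parts, neg_neg]

end WeakDerivative

section DerivNorm

lemma derivNorm_eq {f g : ℝ → ℝ} (h : HasWeakDeriv f g) : derivNorm f = eLpNorm g 2 unitVol :=
  le_antisymm (iInf₂_le g h) (le_iInf₂ fun _ hg' => (eLpNorm_congr_ae (h.unique hg')).le)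

lemma ofReal_norm_toLp {g : ℝ → ℝ} (hg : MemLp g 2 unitVol) :
    ENNReal.ofReal ‖hg.toLp g‖ = eLpNorm g 2 unitVol := by
  rw [Lp.norm_toLp, ENNReal.ofReal_toReal hg.2.ne]

lemma derivNorm_sq_of_hasDerivAt {f : ℝ → ℝ} {y y' : C(ℝ, ℝ)} (h : ∀ r, HasDerivAt y (y' r) r)
    (hf : f =ᵐ[unitVol] y) : derivNorm f ^ 2 = ENNReal.ofReal (‖toX (restr y')‖ ^ 2) := by
  rw [derivNorm_eq ((hasWeakDeriv_of_hasDerivAt h).congr hf),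
    ENNReal.ofReal_pow (norm_nonneg _), Lp.norm_def,
    ENNReal.ofReal_toReal (Lp.eLpNorm_ne_top _), eLpNorm_congr_ae (coeFn_toX_restr y')]

lemma mul_inner_eta_of_mem_H01 {x : X} (hx : x ∈ H01) {g : ℝ → ℝ} (hg : HasWeakDeriv x g)
    (hg2 : MemLp g 2 unitVol) (k : ℕ) :
    Real.pi * (k + 1) * inner ℝ x (eta k) = inner ℝ (hg2.toLp g) (cosX (k + 1)) := by
  have deriv_cosC : deriv (cosC (k + 1)) = fun r => -(Real.pi * (k + 1)) * etaFun k r := by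
    funext r
    have := (((hasDerivAt_id r).const_mul (Real.pi * ((k + 1 : ℕ) : ℝ))).cos.const_mul √2).deriv
    simp only [cosC, ContinuousMap.coe_mk, k.succ_ne_zero, if_false]
    refine this.trans ?_
    simp only [etaFun, id]
    push_cast
    ring
  have parts := integral_mul_deriv_of_mem_H01 hx hg (hg2.integrable one_le_two)
    (w := cosC (k + 1)) (by simp only [cosC, ContinuousMap.coe_mk]; fun_prop)
  rw [inner_eq_integral_of_ae_eq .rfl (coeFn_eta k),
    inner_eq_integral_of_ae_eq hg2.coeFn_toLp (coeFn_cosX (k + 1))]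
  simp only [deriv_cosC, mul_left_comm _ (-(Real.pi * ((k : ℝ) + 1)))] at parts
  rw [integral_const_mul] at parts
  linarith

lemma sum_sq_le_derivNorm_sq {x : X} (hx : x ∈ H01) (s : Finset ℕ) :
    ENNReal.ofReal (∑ k ∈ s, (Real.pi * (k + 1) * inner ℝ x (eta k)) ^ 2) ≤ derivNorm x ^ 2 := by
  obtain ⟨g, hg2, hg⟩ := hx.1
  rw [derivNorm_eq hg, ← ofReal_norm_toLp hg2, ← ENNReal.ofReal_pow (norm_nonneg _)]
  refine ENNReal.ofReal_le_ofReal ?_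
  have bessel := (orthonormal_cosX.comp (· + 1) (add_left_injective 1)).sum_inner_products_le
    (x := hg2.toLp g) (s := s)
  simpa only [Function.comp_apply, real_inner_comm, Real.norm_eq_abs, sq_abs,
    mul_inner_eta_of_mem_H01 hx hg hg2] using bessel

end DerivNorm

section WeakContinuity

lemma continuous_weakTop_inner {D : Set X} (h : X) :
    @Continuous D ℝ (weakTop D) inferInstance fun x => inner ℝ (x : X) h := by
  let _ := weakTop D
  have inclusion : Continuous fun x : D => toWeakSpace ℝ X (x : X) := continuous_induced_dom
  have eval : Continuous fun z : WeakSpace ℝ X => innerSL ℝ h ((toWeakSpace ℝ X).symm z) :=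
    WeakBilin.eval_continuous _ (innerSL ℝ h)
  exact (eval.comp inclusion).congr fun x => real_inner_comm (x : X) h

/-- The tail of Parseval's sum, controlled by the frequencies `(π(k+1))² ≥ n + 1`. -/
lemma norm_sq_sub_sum_le {x : X} (hx : x ∈ H01) {R : ℝ≥0} (hR : derivNorm x ^ 2 ≤ R) (n : ℕ) :
    |‖x‖ ^ 2 - ∑ k ∈ Finset.range n, inner ℝ x (eta k) ^ 2| ≤ R / ((n : ℝ) + 1) := by
  have parseval := hasSum_inner_eta_sq x
  rw [abs_of_nonneg (sub_nonneg.mpr (sum_le_hasSum _ (fun _ _ => sq_nonneg _) parseval))]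
  refine le_of_tendsto (parseval.tendsto_sum_nat.sub_const _) ?_
  filter_upwards [eventually_ge_atTop n] with m hm
  rw [← Finset.sum_Ico_eq_sub _ hm, le_div_iff₀ (by positivity), Finset.sum_mul]
  have bessel : ∑ k ∈ Finset.Ico n m, (Real.pi * (k + 1) * inner ℝ x (eta k)) ^ 2 ≤ (R : ℝ) := by
    have := (sum_sq_le_derivNorm_sq hx (Finset.Ico n m)).trans hR
    rw [← ENNReal.ofReal_coe_nnreal] at this
    exact (ENNReal.ofReal_le_ofReal_iff R.2).mp this
  refine (Finset.sum_le_sum fun k hk => ?_).trans bessel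
  have hnk : (n : ℝ) ≤ k := Nat.cast_le.mpr (Finset.mem_Ico.mp hk).1
  have frequency : (n : ℝ) + 1 ≤ (Real.pi * (k + 1)) ^ 2 := by
    have : (n : ℝ) + 1 ≤ Real.pi * (k + 1) := by nlinarith [Real.pi_gt_three]
    nlinarith [n.cast_nonneg (α := ℝ)]
  rw [mul_pow, mul_comm]
  gcongr

lemma continuousOn_weakTop_norm_sq (R : ℝ≥0) :
    @ContinuousOn H01 ℝ (weakTop H01) inferInstance (fun x => ‖(x : X)‖ ^ 2)
      {x : H01 | derivNorm (x : X) ^ 2 ≤ R} := by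
  let _ := weakTop H01
  have uniform : TendstoUniformlyOn
      (fun (n : ℕ) (x : H01) => ∑ k ∈ Finset.range n, inner ℝ (x : X) (eta k) ^ 2)
      (fun x => ‖(x : X)‖ ^ 2) atTop {x : H01 | derivNorm (x : X) ^ 2 ≤ R} := by
    rw [Metric.tendstoUniformlyOn_iff]
    intro ε hε
    have tail : Tendsto (fun n : ℕ => (R : ℝ) / ((n : ℝ) + 1)) atTop (𝓝 0) :=
      tendsto_const_nhds.div_atTop
        (tendsto_atTop_add_const_right _ _ tendsto_natCast_atTop_atTop)
    filter_upwards [tail.eventually_lt_const hε] with n hn x hx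
    exact (norm_sq_sub_sum_le x.2 hx n).trans_lt hn
  refine uniform.continuousOn (.of_forall fun n => Continuous.continuousOn ?_)
  exact continuous_finsetSum _ fun k _ => (continuous_weakTop_inner (eta k)).pow 2

end WeakContinuity

section Projection

/-- `P_N` as a continuous linear map. -/
def projL (N : ℕ) : X →L[ℝ] E N :=
  ((PiLp.continuousLinearEquiv 2 ℝ fun _ : Fin N => ℝ).symm : (Fin N → ℝ) →L[ℝ] E N).comp
    (ContinuousLinearMap.pi fun i : Fin N => innerSL ℝ (eta i))

lemma coe_projL (N : ℕ) : ⇑(projL N) = proj N := by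
  ext x i
  exact real_inner_comm x (eta i)

lemma inner_eta_eta (i j : ℕ) : inner ℝ (eta i) (eta j) = if i = j then 1 else 0 :=
  orthonormal_iff_ite.mp orthonormal_eta i j

lemma projL_eta_of_le {N k : ℕ} (hk : N ≤ k) : projL N (eta k) = 0 := by
  ext i
  rw [coe_projL]
  exact (inner_eta_eta k i).trans (if_neg (i.2.trans_le hk).ne')

lemma inner_incl_eta (N : ℕ) (ξ : E N) (i : Fin N) : inner ℝ (incl N ξ) (eta i) = ξ i := by
  simp only [incl, sum_inner, real_inner_smul_left, inner_eta_eta, Fin.val_inj, mul_ite, mul_one,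
    mul_zero, Finset.sum_ite_eq', Finset.mem_univ, if_true]

end Projection

section SecondDerivative

variable {B : Type*} [NormedAddCommGroup B] [NormedSpace ℝ B] {u : B → ℝ}

lemma pd_pd (hu : ContDiff ℝ 2 u) (h k x : B) :
    pd h (pd k u) x = fderiv ℝ (fderiv ℝ u) x h k := by
  have differentiable : DifferentiableAt ℝ (fderiv ℝ u) x :=
    (hu.fderiv_right (m := 1) (by norm_num)).differentiable one_ne_zero x
  change fderiv ℝ (fun y => fderiv ℝ u y k) x h = _
  rw [(differentiable.hasFDerivAt.clm_apply (hasFDerivAt_const k x)).fderiv]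
  simp

lemma fderiv_fderiv_comm (hu : ContDiff ℝ 2 u) (h k x : B) :
    fderiv ℝ (fderiv ℝ u) x h k = fderiv ℝ (fderiv ℝ u) x k h :=
  (hu.contDiffAt.isSymmSndFDerivAt (by simp)).eq h k

end SecondDerivative

section Cylinder

/-- The trace of `P_n A P_n B` for a bilinear form `B`, in the basis `η_1, …, η_n`. -/
def finTrace (A : X →L[ℝ] X) (n : ℕ) (B : X →L[ℝ] X →L[ℝ] ℝ) : ℝ :=
  ∑ i : Fin n, ∑ j : Fin n, inner ℝ (eta i) (A (eta j)) * B (eta j) (eta i)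

variable {N : ℕ} {g : E N → ℝ}

lemma contDiff_cylinder {n : WithTop ℕ∞} (hg : ContDiff ℝ n g) : ContDiff ℝ n (g ∘ proj N) :=
  coe_projL N ▸ hg.comp (projL N).contDiff

lemma pd_cylinder (hg : Differentiable ℝ g) (h : X) :
    pd h (g ∘ proj N) = pd (projL N h) g ∘ proj N := by
  funext x
  rw [← coe_projL, Function.comp, pd, fderiv_comp x (hg _) (projL N).differentiableAt,
    ContinuousLinearMap.fderiv]
  rfl

lemma contDiff_pd (hg : ContDiff ℝ 2 g) (h : E N) : ContDiff ℝ 1 (pd h g) :=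
  (hg.fderiv_right (m := 1) (by norm_num)).clm_apply contDiff_const

lemma fderiv_cylinder_eta_of_le (hg : Differentiable ℝ g) {k : ℕ} (hk : N ≤ k) (x : X) :
    fderiv ℝ (g ∘ proj N) x (eta k) = 0 := by
  refine (congrFun (pd_cylinder hg (eta k)) x).trans ?_
  rw [projL_eta_of_le hk]
  exact map_zero _

lemma pd_pd_cylinder_of_le (hg : ContDiff ℝ 2 g) {k : ℕ} (hk : N ≤ k) (h x : X) :
    pd h (pd (eta k) (g ∘ proj N)) x = 0 := by
  have : pd (eta k) (g ∘ proj N) = fun _ => 0 :=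
    funext (fderiv_cylinder_eta_of_le (hg.differentiable two_ne_zero) hk)
  rw [this, pd, fderiv_fun_const]
  rfl

lemma traceTerm_cylinder (A : X →L[ℝ] X) (hg : ContDiff ℝ 2 g) {n : ℕ} (hn : N ≤ n) (x : X) :
    traceTerm A (g ∘ proj N) x = finTrace A n (fderiv ℝ (fderiv ℝ (g ∘ proj N)) x) := by
  have hu : ContDiff ℝ 2 (g ∘ proj N) := contDiff_cylinder hg
  rw [traceTerm, tsum_eq_sum (s := Finset.range n ×ˢ Finset.range n), Finset.sum_product,
    Finset.sum_range]
  · refine Finset.sum_congr rfl fun i _ => ?_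
    rw [Finset.sum_range]
    exact Finset.sum_congr rfl fun j _ => by rw [pd_pd hu, fderiv_fderiv_comm hu]
  · rintro ⟨i, j⟩ hij
    rw [Finset.mem_product, Finset.mem_range, Finset.mem_range, not_and_or, not_lt, not_lt] at hij
    rcases hij with h | h
    · rw [pd_pd hu, fderiv_fderiv_comm hu, ← pd_pd hu, pd_pd_cylinder_of_le hg (hn.trans h),
        mul_zero]
    · rw [pd_pd_cylinder_of_le hg (hn.trans h), mul_zero]

lemma kolm_cylinder (A : X →L[ℝ] X) (F : H01 → X) (hg : Differentiable ℝ g) {n : ℕ} (hn : N ≤ n)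
    (x : H01) :
    kolm A F (g ∘ proj N) x = 1 / 2 * traceTerm A (g ∘ proj N) x +
      ∑ k ∈ Finset.range n, (lapCoeff x k + inner ℝ (F x) (eta k)) *
        fderiv ℝ (g ∘ proj N) x (eta k) := by
  rw [kolm, tsum_eq_sum (s := Finset.range n)]
  · rfl
  · intro k hk
    rw [pd, fderiv_cylinder_eta_of_le hg (hn.trans (not_lt.mp (Finset.mem_range.not.mp hk))),
      mul_zero]

lemma continuous_weakTop_cylinder {D : Set X} (hg : Continuous g) :
    @Continuous D ℝ (weakTop D) inferInstance fun x => (g ∘ proj N) x := by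
  let _ := weakTop D
  exact hg.comp ((PiLp.continuous_toLp 2 _).comp
    (continuous_pi fun i => continuous_weakTop_inner (eta i)))

lemma continuous_weakTop_pd {D : Set X} (hg : ContDiff ℝ 2 g) (h : X) :
    @Continuous D ℝ (weakTop D) inferInstance fun x => pd h (g ∘ proj N) x := by
  rw [pd_cylinder (hg.differentiable two_ne_zero)]
  exact continuous_weakTop_cylinder (contDiff_pd hg _).continuous

lemma continuous_weakTop_traceTerm {D : Set X} (A : X →L[ℝ] X) (hg : ContDiff ℝ 2 g) :
    @Continuous D ℝ (weakTop D) inferInstance fun x => traceTerm A (g ∘ proj N) x := by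
  let _ := weakTop D
  simp only [traceTerm_cylinder A hg le_rfl, finTrace, ← pd_pd (contDiff_cylinder hg),
    pd_cylinder (hg.differentiable two_ne_zero),
    pd_cylinder ((contDiff_pd hg _).differentiable one_ne_zero)]
  exact continuous_finsetSum _ fun i _ => continuous_finsetSum _ fun j _ =>
    continuous_const.mul (continuous_weakTop_cylinder
      (((contDiff_pd hg _).continuous_fderiv one_ne_zero).clm_apply continuous_const))

end Cylinder

/-! ### Weighted estimates for test functions -/

section Weights

lemma expW_pos (κ : ℝ) (x : X) : 0 < expW κ x := Real.exp_pos _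

lemma one_le_expW {κ : ℝ} (hκ : 0 ≤ κ) (x : X) : 1 ≤ expW κ x :=
  Real.one_le_exp (by positivity)

lemma expW_add (κ κ' : ℝ) (x : X) : expW (κ + κ') x = expW κ x * expW κ' x := by
  rw [expW, add_mul, Real.exp_add, expW, expW]

lemma expW_mono {κ κ' : ℝ} (h : κ ≤ κ') (x : X) : expW κ x ≤ expW κ' x :=
  Real.exp_le_exp.mpr (by gcongr)

lemma ofReal_expW_le_V (p κ : ℝ) (x : X) : ENNReal.ofReal (expW κ x) ≤ V p κ x := by
  rw [V]
  split_ifs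
  · exact le_rfl
  · exact le_mul_of_one_le_right' le_self_add

lemma one_le_V {κ : ℝ} (hκ : 0 ≤ κ) (p : ℝ) (x : X) : 1 ≤ V p κ x :=
  (ENNReal.one_le_ofReal.mpr (one_le_expW hκ x)).trans (ofReal_expW_le_V p κ x)

lemma V_mul_le_Theta (p κ : ℝ) {x : X} (hx : x ∈ H01) :
    V p κ x * (1 + derivNorm x ^ 2) ≤ Θ p κ x := by
  rw [Θ, if_pos hx]
  exact le_self_add

lemma V_le_Theta (p κ : ℝ) {x : X} (hx : x ∈ H01) : V p κ x ≤ Θ p κ x :=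
  (le_mul_of_one_le_right' le_self_add).trans (V_mul_le_Theta p κ hx)

lemma derivNorm_sq_le_Theta {κ : ℝ} (hκ : 0 ≤ κ) (p : ℝ) {x : X} (hx : x ∈ H01) :
    derivNorm x ^ 2 ≤ Θ p κ x :=
  calc derivNorm x ^ 2 ≤ 1 + derivNorm x ^ 2 := le_add_self
    _ ≤ V p κ x * (1 + derivNorm x ^ 2) := le_mul_of_one_le_left' (one_le_V hκ p x)
    _ ≤ Θ p κ x := V_mul_le_Theta p κ hx

lemma mem_Xp_two (x : X) : x ∈ Xp 2 := by
  simpa [Xp, lpPow] using lintegral_rpow_enorm_lt_top_of_eLpNorm_lt_top (p := 2) (by norm_num)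
    (by norm_num) (Lp.memLp x).2

lemma V_two (κ : ℝ) (x : X) : V 2 κ x = ENNReal.ofReal (expW κ x) := if_pos rfl

end Weights

/-- The function `f` on `X` is bounded by a multiple of `V_κ`, that is, `‖f‖_{2,κ} < ∞`. -/
def ExpBounded (κ : ℝ) (f : X → ℝ) : Prop := ∃ C, 0 ≤ C ∧ ∀ x, |f x| ≤ C * expW κ x

namespace ExpBounded

variable {κ : ℝ} {f g : X → ℝ}

lemma of_wnorm_lt_top (h : wnorm (V 2 κ) (fun x : Xp 2 => f x) < ⊤) : ExpBounded κ f := by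
  refine ⟨(wnorm (V 2 κ) (fun x : Xp 2 => f x)).toReal, ENNReal.toReal_nonneg, fun x => ?_⟩
  have le_wnorm := le_iSup (fun x : Xp 2 => ‖f x‖ₑ / V 2 κ x) ⟨x, mem_Xp_two x⟩
  rw [V_two, ENNReal.div_le_iff (by simp [expW_pos]) ENNReal.ofReal_ne_top] at le_wnorm
  have := ENNReal.toReal_mono (ENNReal.mul_ne_top h.ne ENNReal.ofReal_ne_top) le_wnorm
  rwa [ENNReal.toReal_mul, ENNReal.toReal_ofReal (expW_pos κ x).le, toReal_enorm,
    Real.norm_eq_abs] at this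

lemma of_abs_le (hg : ExpBounded κ g) (h : ∀ x, |f x| ≤ |g x|) : ExpBounded κ f :=
  let ⟨C, hC, hle⟩ := hg
  ⟨C, hC, fun x => (h x).trans (hle x)⟩

lemma add (hf : ExpBounded κ f) (hg : ExpBounded κ g) : ExpBounded κ fun x => f x + g x := by
  obtain ⟨C, hC, hf⟩ := hf
  obtain ⟨C', hC', hg⟩ := hg
  refine ⟨C + C', add_nonneg hC hC', fun x => (abs_add_le _ _).trans ?_⟩
  rw [add_mul]
  exact add_le_add (hf x) (hg x)

lemma const_mul (c : ℝ) (hf : ExpBounded κ f) : ExpBounded κ fun x => c * f x := by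
  obtain ⟨C, hC, hf⟩ := hf
  refine ⟨|c| * C, by positivity, fun x => ?_⟩
  rw [abs_mul, mul_assoc]
  gcongr
  exact hf x

lemma sum {ι : Type*} (s : Finset ι) {f : ι → X → ℝ} (hf : ∀ i, ExpBounded κ (f i)) :
    ExpBounded κ fun x => ∑ i ∈ s, f i x := by
  choose C hC hf using hf
  refine ⟨∑ i ∈ s, C i, Finset.sum_nonneg fun i _ => hC i, fun x => ?_⟩
  rw [Finset.sum_mul]
  exact (Finset.abs_sum_le_sum_abs _ _).trans (Finset.sum_le_sum fun i _ => hf i x)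

lemma mono {κ' : ℝ} (hf : ExpBounded κ f) (h : κ ≤ κ') : ExpBounded κ' f := by
  obtain ⟨C, hC, hf⟩ := hf
  refine ⟨C, hC, fun x => (hf x).trans ?_⟩
  gcongr
  exact expW_mono h x

lemma inner_mul {κ' : ℝ} (hf : ExpBounded κ f) (h : κ < κ') (z : X) :
    ExpBounded κ' fun x => inner ℝ x z * f x := by
  obtain ⟨C, hC, hf⟩ := hf
  have gap : 0 < κ' - κ := sub_pos.mpr h
  have norm_le (x : X) : ‖x‖ ≤ (1 + 1 / (κ' - κ)) * expW (κ' - κ) x := by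
    have exp_ge := Real.add_one_le_exp ((κ' - κ) * ‖x‖ ^ 2)
    calc ‖x‖ ≤ 1 + ‖x‖ ^ 2 := by nlinarith [sq_nonneg (‖x‖ - 1)]
      _ ≤ (1 + 1 / (κ' - κ)) * ((κ' - κ) * ‖x‖ ^ 2 + 1) := by
          have : 1 / (κ' - κ) * ((κ' - κ) * ‖x‖ ^ 2) = ‖x‖ ^ 2 := by field_simp
          have : 0 ≤ (κ' - κ) * ‖x‖ ^ 2 + 1 / (κ' - κ) := by positivity
          linarith
      _ ≤ (1 + 1 / (κ' - κ)) * expW (κ' - κ) x := by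
          rw [expW]
          gcongr
  refine ⟨(1 + 1 / (κ' - κ)) * ‖z‖ * C, by positivity, fun x => ?_⟩
  calc |inner ℝ x z * f x| = |inner ℝ x z| * |f x| := abs_mul _ _
    _ ≤ ‖x‖ * ‖z‖ * (C * expW κ x) := by
        gcongr
        exacts [abs_real_inner_le_norm x z, hf x]
    _ ≤ (1 + 1 / (κ' - κ)) * expW (κ' - κ) x * ‖z‖ * (C * expW κ x) := by
        gcongr
        · exact mul_nonneg hC (expW_pos κ x).le
        · exact norm_le x
    _ = (1 + 1 / (κ' - κ)) * ‖z‖ * C * expW κ' x := by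
        rw [← sub_add_cancel κ' κ, expW_add]
        ring_nf

end ExpBounded

section MemWC

variable {D : Set X} {W : X → ℝ≥0∞}

lemma tendsto_iSup_enorm_div_of_le_rpow {f : D → ℝ} {C θ : ℝ} (hC : 0 ≤ C) (hθ : θ < 1)
    (hf : ∀ x : D, W x ≠ ⊤ → |f x| ≤ C * (W x).toReal ^ θ) :
    Tendsto (fun R : ℝ≥0 => ⨆ (x : D) (_ : (R : ℝ≥0∞) ≤ W x), ‖f x‖ₑ / W x) atTop (𝓝 0) := by
  have tendsto_bound :
      Tendsto (fun R : ℝ≥0 => ENNReal.ofReal (C * (R : ℝ) ^ (-(1 - θ)))) atTop (𝓝 0) := by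
    simpa only [mul_zero, ENNReal.ofReal_zero, Function.comp_def, id] using
      (ENNReal.tendsto_ofReal ((tendsto_rpow_neg_atTop (sub_pos.mpr hθ)).const_mul C)).comp
        (NNReal.tendsto_coe_atTop.2 tendsto_id)
  refine tendsto_of_tendsto_of_tendsto_of_le_of_le' tendsto_const_nhds tendsto_bound
    (.of_forall fun _ => zero_le) ?_
  filter_upwards [eventually_gt_atTop 0] with R hR
  refine iSup₂_le fun x hx => ?_
  rcases eq_or_ne (W x) ⊤ with top | ne_top
  · simp only [top, ENNReal.div_top, zero_le]
  have hfx := hf x ne_top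
  lift W x to ℝ≥0 using ne_top with w
  have hRw : (R : ℝ) ≤ w := by exact_mod_cast hx
  have hw : (0 : ℝ) < w := (NNReal.coe_pos.mpr hR).trans_le hRw
  rw [Real.enorm_eq_ofReal_abs, ← ENNReal.ofReal_coe_nnreal, ← ENNReal.ofReal_div_of_pos hw]
  refine ENNReal.ofReal_le_ofReal ?_
  calc |f x| / w ≤ C * (w : ℝ) ^ θ / w := by gcongr; exact hfx
    _ = C * (w : ℝ) ^ (-(1 - θ)) := by
        rw [mul_div_assoc, neg_sub, Real.rpow_sub hw, Real.rpow_one]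
    _ ≤ C * (R : ℝ) ^ (-(1 - θ)) := mul_le_mul_of_nonneg_left
        (Real.rpow_le_rpow_of_nonpos (NNReal.coe_pos.mpr hR) hRw (by linarith)) hC

lemma ExpBounded.memWC {κ κ' : ℝ} {f : X → ℝ} (hf : ExpBounded κ' f) (hκ' : 0 ≤ κ') (hκ : κ' < κ)
    (hW : ∀ x ∈ D, ENNReal.ofReal (expW κ x) ≤ W x)
    (hcont : @Continuous D ℝ (weakTop D) inferInstance fun x => f x) :
    MemWC W fun x : D => f x := by
  obtain ⟨C, hC, hfC⟩ := hf
  have hκ0 : 0 < κ := hκ'.trans_lt hκ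
  refine ⟨fun R => @Continuous.continuousOn D ℝ (weakTop D) _ _ _ hcont,
    tendsto_iSup_enorm_div_of_le_rpow hC ((div_lt_one hκ0).mpr hκ) fun x hx => ?_⟩
  have expW_rpow : expW κ' x = expW κ x ^ (κ' / κ) := by
    rw [expW, expW, ← Real.exp_mul]
    congr 1
    field_simp
  refine (hfC x).trans (mul_le_mul_of_nonneg_left ?_ hC)
  rw [expW_rpow]
  exact Real.rpow_le_rpow (expW_pos _ _).le ((ENNReal.ofReal_le_iff_le_toReal hx).mp (hW x x.2))
    (by positivity)

lemma MemWC.add {f g : D → ℝ} (hf : MemWC W f) (hg : MemWC W g) :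
    MemWC W fun x => f x + g x := by
  let _ := weakTop D
  refine ⟨fun R => (hf.1 R).add (hg.1 R), ?_⟩
  have tendsto_add := hf.2.add hg.2
  rw [add_zero] at tendsto_add
  refine tendsto_of_tendsto_of_tendsto_of_le_of_le tendsto_const_nhds tendsto_add
    (fun _ => zero_le) fun R => iSup₂_le fun x hx => ?_
  calc ‖f x + g x‖ₑ / W x ≤ (‖f x‖ₑ + ‖g x‖ₑ) / W x := by gcongr; exact enorm_add_le _ _
    _ = ‖f x‖ₑ / W x + ‖g x‖ₑ / W x := ENNReal.add_div
    _ ≤ _ := add_le_add (le_iSup₂ (f := fun (x : D) (_ : (R : ℝ≥0∞) ≤ W x) => ‖f x‖ₑ / W x) x hx)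
      (le_iSup₂ (f := fun (x : D) (_ : (R : ℝ≥0∞) ≤ W x) => ‖g x‖ₑ / W x) x hx)

lemma MemWC.bdd_mul {f b : D → ℝ} (hf : MemWC W f) {C : ℝ}
    (hb : ∀ R : ℝ≥0, @ContinuousOn D ℝ (weakTop D) inferInstance b {x : D | W x ≤ R})
    (hC : ∀ x, |b x| ≤ C) : MemWC W fun x => b x * f x := by
  let _ := weakTop D
  refine ⟨fun R => (hb R).mul (hf.1 R), ?_⟩
  have tendsto_mul := ENNReal.Tendsto.const_mul (a := ENNReal.ofReal C) hf.2
    (.inr ENNReal.ofReal_ne_top)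
  rw [mul_zero] at tendsto_mul
  refine tendsto_of_tendsto_of_tendsto_of_le_of_le tendsto_const_nhds tendsto_mul
    (fun _ => zero_le) fun R => iSup₂_le fun x hx => ?_
  calc ‖b x * f x‖ₑ / W x = ‖b x‖ₑ * (‖f x‖ₑ / W x) := by rw [enorm_mul, mul_div_assoc]
    _ ≤ _ := mul_le_mul'
      (Real.enorm_eq_ofReal_abs (b x) ▸ ENNReal.ofReal_le_ofReal (hC x))
      (le_iSup₂ (f := fun (x : D) (_ : (R : ℝ≥0∞) ≤ W x) => ‖f x‖ₑ / W x) x hx)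

lemma MemWC.add_sum {ι : Type*} (s : Finset ι) {f : D → ℝ} {g : ι → D → ℝ} (hf : MemWC W f)
    (hg : ∀ i, MemWC W (g i)) : MemWC W fun x => f x + ∑ i ∈ s, g i x := by
  classical
  induction s using Finset.induction_on with
  | empty => simpa only [Finset.sum_empty, add_zero] using hf
  | insert a s ha ih =>
    simpa only [Finset.sum_insert ha, add_left_comm] using (hg a).add ih

end MemWC

section Resolvent

variable {A : X →L[ℝ] X} {N : ℕ} {g : E N → ℝ} {q κ κ₁ : ℝ}

lemma exists_cylinder_of_mem_testFun {u : X → ℝ} (hu : u ∈ testFun A 2 κ₁) :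
    ∃ (N : ℕ) (g : E N → ℝ), ContDiff ℝ 2 g ∧ u = g ∘ proj N ∧ ExpBounded κ₁ u ∧
      (∀ k, ExpBounded κ₁ (pd (eta k) u)) ∧ ExpBounded κ₁ (traceTerm A u) := by
  obtain ⟨⟨N, g, hg, hug⟩, finite⟩ := hu
  rw [ENNReal.add_lt_top, ENNReal.add_lt_top] at finite
  refine ⟨N, g, hg, hug, .of_wnorm_lt_top finite.1.1, fun k =>
    (ExpBounded.of_wnorm_lt_top (f := fun x => ‖fderiv ℝ u x‖) finite.1.2).of_abs_le fun x => ?_,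
    .of_wnorm_lt_top finite.2⟩
  simpa only [pd, norm_eta, mul_one, abs_norm, Real.norm_eq_abs] using
    (fderiv ℝ u x).le_opNorm (eta k)

lemma memWC_testFun (hκ₁ : κ₁ ∈ Ico 0 κ) {u : X → ℝ} (hu : u ∈ testFun A 2 κ₁) :
    MemWC (V q κ) (fun x : Xp q => u x) := by
  obtain ⟨N, g, hg, rfl, bounded, -⟩ := exists_cylinder_of_mem_testFun hu
  exact bounded.memWC hκ₁.1 hκ₁.2 (fun x _ => ofReal_expW_le_V q κ x)
    (continuous_weakTop_cylinder hg.continuous)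

lemma memWC_driftless (hκ₁ : κ₁ ∈ Ico 0 κ) (hg : ContDiff ℝ 2 g)
    (hu : ExpBounded κ₁ (g ∘ proj N)) (hDu : ∀ k, ExpBounded κ₁ (pd (eta k) (g ∘ proj N)))
    (htrace : ExpBounded κ₁ (traceTerm A (g ∘ proj N))) (l : ℝ) :
    MemWC (Θ q κ) fun x : H01 => l * (g ∘ proj N) x + (-(1 / 2) * traceTerm A (g ∘ proj N) x +
      ∑ k ∈ Finset.range N,
        (Real.pi * (k + 1)) ^ 2 * (inner ℝ (x : X) (eta k) * pd (eta k) (g ∘ proj N) x)) := by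
  obtain ⟨κ', hκ', hκ'κ⟩ := exists_between hκ₁.2
  let _ := weakTop H01
  refine ExpBounded.memWC (κ' := κ') (f := fun x : X => l * (g ∘ proj N) x +
    (-(1 / 2) * traceTerm A (g ∘ proj N) x + ∑ k ∈ Finset.range N,
      (Real.pi * (k + 1)) ^ 2 * (inner ℝ x (eta k) * pd (eta k) (g ∘ proj N) x))) ?_
    (hκ₁.1.trans hκ'.le) hκ'κ (fun x hx => (ofReal_expW_le_V q κ x).trans (V_le_Theta q κ hx)) ?_
  · exact ((hu.mono hκ'.le).const_mul l).add (((htrace.mono hκ'.le).const_mul _).add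
      (.sum _ fun k => ((hDu k).inner_mul hκ' (eta k)).const_mul _))
  · exact (continuous_const.mul (continuous_weakTop_cylinder hg.continuous)).add
      ((continuous_const.mul (continuous_weakTop_traceTerm A hg)).add
        (continuous_finsetSum _ fun k _ => continuous_const.mul
          ((continuous_weakTop_inner (eta k)).mul (continuous_weakTop_pd hg (eta k)))))

lemma memWC_pd_mul {G : H01 → ℝ} (hG : MemWC (Θ q κ) fun x => expW κ₁ x * G x)
    (hκ : 0 ≤ κ) (hg : ContDiff ℝ 2 g) {h : X} (hDu : ExpBounded κ₁ (pd h (g ∘ proj N))) :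
    MemWC (Θ q κ) fun x : H01 => -(pd h (g ∘ proj N) x * G x) := by
  obtain ⟨C, -, hC⟩ := hDu
  let _ := weakTop H01
  have expW_neg (x : X) : expW (-κ₁) x * expW κ₁ x = 1 := by
    rw [← expW_add, neg_add_cancel, expW, zero_mul, Real.exp_zero]
  have := hG.bdd_mul (b := fun x : H01 => -(pd h (g ∘ proj N) x * expW (-κ₁) x)) (C := C)
    (fun R => ((continuous_weakTop_pd hg h).continuousOn.mul <|
      Real.continuous_exp.comp_continuousOn <| continuousOn_const.mul <|
        (continuousOn_weakTop_norm_sq R).mono fun x hx =>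
          (derivNorm_sq_le_Theta hκ q x.2).trans hx).neg)
    fun x => by
      rw [abs_neg, abs_mul, abs_of_pos (expW_pos _ _)]
      calc _ ≤ C * expW κ₁ x * expW (-κ₁) x := by
            gcongr
            exacts [(expW_pos _ _).le, hC x]
        _ = C := by rw [mul_assoc, mul_comm (expW κ₁ _), expW_neg, mul_one]
  convert this using 2 with x
  linear_combination (pd h (g ∘ proj N) x * G x) * expW_neg x

lemma memWC_resolvent {F : H01 → X} (hκ₁ : κ₁ ∈ Ico 0 κ)
    (hF : ∀ k : ℕ, MemWC (Θ q κ) fun x : H01 => expW κ₁ x * inner ℝ (F x) (eta k))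
    {u : X → ℝ} (hu : u ∈ testFun A 2 κ₁) (l : ℝ) :
    MemWC (Θ q κ) (fun x : H01 => l * u x - kolm A F u x) := by
  obtain ⟨N, g, hg, rfl, hu, hDu, htrace⟩ := exists_cylinder_of_mem_testFun hu
  have := (memWC_driftless hκ₁ hg hu hDu htrace l).add_sum (Finset.range N) fun k =>
    memWC_pd_mul (hF k) (hκ₁.1.trans hκ₁.2.le) hg (hDu k)
  convert this using 2 with x
  rw [kolm_cylinder A F (hg.differentiable two_ne_zero) le_rfl, add_assoc, add_assoc,
    ← Finset.sum_add_distrib, sub_eq_add_neg, neg_add, ← Finset.sum_neg_distrib, neg_mul_eq_neg_mul]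
  refine congrArg (_ + ·) (congrArg (_ + ·) (Finset.sum_congr rfl fun k _ => ?_))
  rw [pd, lapCoeff]
  ring

end Resolvent

/-! ### Maximisers of the weighted ratio -/

section WeakTopology

lemma lowerSemicontinuous_ennreal_mul {α : Type*} [TopologicalSpace α] {f g : α → ℝ≥0∞}
    (hf : LowerSemicontinuous f) (hg : LowerSemicontinuous g) :
    LowerSemicontinuous fun x => f x * g x := by
  intro x b hb
  obtain ⟨a, ha, a', ha', hlt⟩ : ∃ a < f x, ∃ a' < g x, b < a * a' := by
    contrapose! hb
    exact ENNReal.mul_le_of_forall_lt hb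
  filter_upwards [hf x a ha, hg x a' ha'] with y hy hy'
  exact hlt.trans_le (mul_le_mul' hy.le hy'.le)

variable {H : Type*} [NormedAddCommGroup H]

lemma lowerSemicontinuous_weakSpace [NormedSpace ℝ H] {β : Type*} [LinearOrder β] {f : H → β}
    (hf : QuasiconvexOn ℝ univ f) (hcont : LowerSemicontinuous f) :
    LowerSemicontinuous (f ∘ (toWeakSpace ℝ H).symm) := by
  refine lowerSemicontinuous_iff_isClosed_preimage.mpr fun b => ?_
  have convex : Convex ℝ (f ⁻¹' Iic b) := by
    simpa only [mem_univ, true_and] using! hf b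
  rw [preimage_comp, ← LinearEquiv.image_eq_preimage_symm,
    ← (hcont.isClosed_preimage b).closure_eq, convex.toWeakSpace_closure ℝ]
  exact isClosed_closure

lemma isCompact_weakSpace_closedBall [InnerProductSpace ℝ H] [CompleteSpace H] (B : ℝ) :
    IsCompact (toWeakSpace ℝ H '' Metric.closedBall 0 B) := by
  let riesz : WeakDual ℝ H → WeakSpace ℝ H := fun ℓ =>
    toWeakSpace ℝ H ((InnerProductSpace.toDual ℝ H).symm (WeakDual.toStrongDual ℓ))
  have continuous_riesz : Continuous riesz := by
    refine WeakBilin.continuous_of_continuous_eval _ fun ℓ => ?_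
    refine (WeakDual.eval_continuous ((InnerProductSpace.toDual ℝ H).symm ℓ)).congr fun ℓ' => ?_
    change WeakDual.toStrongDual ℓ' _ =
      ℓ ((InnerProductSpace.toDual ℝ H).symm (WeakDual.toStrongDual ℓ'))
    rw [← InnerProductSpace.toDual_symm_apply (y := ℓ), real_inner_comm,
      InnerProductSpace.toDual_symm_apply]
  convert (WeakDual.isCompact_closedBall (𝕜 := ℝ) (0 : StrongDual ℝ H) B).image continuous_riesz
    using 1
  ext z
  refine ⟨fun ⟨x, hx, hxz⟩ => ⟨StrongDual.toWeakDual (InnerProductSpace.toDual ℝ H x), ?_, ?_⟩, ?_⟩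
  · simpa using hx
  · simp [riesz, hxz]
  · rintro ⟨ℓ, hℓ, rfl⟩
    exact ⟨_, by simpa using hℓ, rfl⟩

end WeakTopology

section Maximizer

variable {p κ : ℝ}

lemma lpPow_eq_eLpNorm_rpow (hp : 0 < p) (x : X) :
    lpPow p x = eLpNorm x (ENNReal.ofReal p) unitVol ^ p := by
  rw [lpPow, lintegral_rpow_enorm_eq_rpow_eLpNorm' hp, eLpNorm_eq_eLpNorm' (by simpa using hp)
    ENNReal.ofReal_ne_top, ENNReal.toReal_ofReal hp.le]

lemma quasiconvexOn_eLpNorm {p : ℝ≥0∞} (hp : 1 ≤ p) :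
    QuasiconvexOn ℝ univ fun x : X => eLpNorm x p unitVol := by
  rintro r x ⟨-, hx⟩ y ⟨-, hy⟩ a b ha hb hab
  refine ⟨mem_univ _, ?_⟩
  have coeFn_combination : ⇑(a • x + b • y) =ᵐ[unitVol] a • ⇑x + b • ⇑y :=
    (Lp.coeFn_add _ _).trans ((Lp.coeFn_smul a x).add (Lp.coeFn_smul b y))
  calc eLpNorm (a • x + b • y : X) p unitVol = eLpNorm (a • ⇑x + b • ⇑y) p unitVol :=
        eLpNorm_congr_ae coeFn_combination
    _ ≤ eLpNorm (a • ⇑x) p unitVol + eLpNorm (b • ⇑y) p unitVol :=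
        eLpNorm_add_le ((Lp.memLp x).1.const_smul a) ((Lp.memLp y).1.const_smul b) hp
    _ ≤ ENNReal.ofReal a * r + ENNReal.ofReal b * r := by
        rw [eLpNorm_const_smul, eLpNorm_const_smul, Real.enorm_of_nonneg ha,
          Real.enorm_of_nonneg hb]
        gcongr
    _ = r := by rw [← add_mul, ← ENNReal.ofReal_add ha hb, hab, ENNReal.ofReal_one, one_mul]

lemma lowerSemicontinuous_eLpNorm (p : ℝ≥0∞) :
    LowerSemicontinuous fun x : X => eLpNorm x p unitVol := by
  refine lowerSemicontinuous_iff_isClosed_preimage.mpr fun b => IsSeqClosed.isClosed ?_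
  intro x x₀ hx hlim
  obtain ⟨φ, -, hφ⟩ := (tendstoInMeasure_of_tendsto_Lp hlim).exists_seq_tendsto_ae
  refine (Lp.eLpNorm_lim_le_liminf_eLpNorm (fun n => (Lp.memLp (x (φ n))).1) _ hφ).trans ?_
  exact (liminf_le_liminf (.of_forall fun n => hx (φ n))).trans (liminf_const b).le

lemma lowerSemicontinuous_weakSpace_lpPow (hp : 1 ≤ p) :
    LowerSemicontinuous (lpPow p ∘ (toWeakSpace ℝ X).symm) := by
  rw [show lpPow p = _ from funext (lpPow_eq_eLpNorm_rpow (zero_lt_one.trans_le hp))]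
  exact (ENNReal.continuous_rpow_const).comp_lowerSemicontinuous
    (lowerSemicontinuous_weakSpace (quasiconvexOn_eLpNorm (ENNReal.one_le_ofReal.mpr hp))
      (lowerSemicontinuous_eLpNorm _)) (ENNReal.monotone_rpow_of_nonneg (by linarith))

lemma lowerSemicontinuous_weakSpace_expW (hκ : 0 ≤ κ) :
    LowerSemicontinuous fun z => ENNReal.ofReal (expW κ ((toWeakSpace ℝ X).symm z)) := by
  have lsc_norm : LowerSemicontinuous ((fun x : X => ‖x‖₊) ∘ (toWeakSpace ℝ X).symm) :=
    lowerSemicontinuous_weakSpace (fun r => convexOn_univ_norm.quasiconvexOn (r : ℝ))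
      continuous_nnnorm.lowerSemicontinuous
  refine Continuous.comp_lowerSemicontinuous
    (g := fun t : ℝ≥0 => ENNReal.ofReal (Real.exp (κ * t ^ 2))) ?_ lsc_norm ?_
  · exact ENNReal.continuous_ofReal.comp (by fun_prop)
  · intro s t hst
    dsimp only
    gcongr

lemma lowerSemicontinuous_weakSpace_V (hp : 2 ≤ p) (hκ : 0 ≤ κ) :
    LowerSemicontinuous (V p κ ∘ (toWeakSpace ℝ X).symm) := by
  have lsc_expW := lowerSemicontinuous_weakSpace_expW hκ
  rcases eq_or_ne p 2 with rfl | hp2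
  · simpa only [Function.comp_def, V_two] using lsc_expW
  · simpa only [Function.comp_def, V, if_neg hp2] using
      lowerSemicontinuous_ennreal_mul lsc_expW (lowerSemicontinuous_const.add
        (lowerSemicontinuous_weakSpace_lpPow (by linarith)))

lemma V_ne_top_iff {x : X} : V p κ x ≠ ⊤ ↔ x ∈ Xp p := by
  rcases eq_or_ne p 2 with rfl | hp
  · simp [V_two, mem_Xp_two]
  · simp [V, hp, Xp, ENNReal.mul_eq_top, expW_pos, lt_top_iff_ne_top]

lemma isCompact_weakTop_V_le (hp : 2 ≤ p) (hκ : 0 < κ) (R : ℝ≥0) :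
    @IsCompact (Xp p) (weakTop (Xp p)) {x | V p κ x ≤ R} := by
  let _ := weakTop (Xp p)
  have sublevel : (fun x : Xp p => toWeakSpace ℝ X x) '' {x | V p κ x ≤ R} =
      (V p κ ∘ (toWeakSpace ℝ X).symm) ⁻¹' Iic R := by
    ext z
    refine ⟨?_, fun hz => ⟨⟨(toWeakSpace ℝ X).symm z, ?_⟩, hz, LinearEquiv.apply_symm_apply _ z⟩⟩
    · rintro ⟨x, hx, rfl⟩
      simpa using hx
    · exact V_ne_top_iff.mp (ne_top_of_le_ne_top ENNReal.coe_ne_top hz)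
  rw [Topology.IsInducing.isCompact_iff ⟨rfl⟩, sublevel]
  refine (isCompact_weakSpace_closedBall (R / κ + 1)).of_isClosed_subset
    ((lowerSemicontinuous_weakSpace_V hp hκ.le).isClosed_preimage _) fun z hz => ?_
  refine ⟨(toWeakSpace ℝ X).symm z, mem_closedBall_zero_iff.mpr ?_,
    LinearEquiv.apply_symm_apply _ z⟩
  set x := (toWeakSpace ℝ X).symm z
  have expW_le : expW κ x ≤ R := by
    rw [← ENNReal.ofReal_le_ofReal_iff R.coe_nonneg, ENNReal.ofReal_coe_nnreal]
    exact (ofReal_expW_le_V p κ x).trans hz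
  have : ‖x‖ ^ 2 ≤ R / κ := by
    rw [le_div_iff₀' hκ]
    exact (le_add_of_nonneg_right zero_le_one).trans ((Real.add_one_le_exp _).trans expW_le)
  nlinarith [sq_nonneg (‖x‖ - 1)]

lemma upperSemicontinuousOn_ofReal_div {α : Type*} [TopologicalSpace α] {f : α → ℝ}
    {W : α → ℝ≥0∞} {s : Set α} (hf : ContinuousOn f s) (hW : LowerSemicontinuous W)
    (hW0 : ∀ x, W x ≠ 0) :
    UpperSemicontinuousOn (fun x => ENNReal.ofReal (f x) / W x) s := by
  intro x hx b hb
  rw [ENNReal.div_lt_iff (.inl (hW0 x)) (.inr ENNReal.ofReal_ne_top)] at hb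
  obtain ⟨a, hfa, haW⟩ := exists_between hb
  have lsc_mul := lowerSemicontinuous_ennreal_mul (lowerSemicontinuous_const (z := b)) hW
  filter_upwards [(ENNReal.tendsto_ofReal (hf x hx)).eventually_lt_const hfa,
    (lsc_mul x a haW).filter_mono nhdsWithin_le_nhds] with y hfy hWy
  exact ENNReal.div_lt_of_lt_mul (hfy.trans hWy)

lemma MemWC.exists_forall_le {D : Set X} {W : X → ℝ≥0∞} {f : D → ℝ} (hf : MemWC W f)
    (hW0 : ∀ x, W x ≠ 0) (hW : ∀ x ∈ D, W x ≠ ⊤)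
    (hlsc : LowerSemicontinuous (W ∘ (toWeakSpace ℝ X).symm))
    (hcompact : ∀ R : ℝ≥0, @IsCompact D (weakTop D) {x | W x ≤ R}) {y : D} (hy : 0 < f y) :
    ∃ x₀ : D, ∀ x, ENNReal.ofReal (f x) / W x ≤ ENNReal.ofReal (f x₀) / W x₀ := by
  let _ := weakTop D
  set ratio : D → ℝ≥0∞ := fun x => ENNReal.ofReal (f x) / W x
  have ratio_pos : 0 < ratio y :=
    ENNReal.div_pos (ENNReal.ofReal_pos.mpr hy).ne' (hW y y.2)
  obtain ⟨R, hyR, small⟩ :=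
    ((eventually_ge_atTop (W y).toNNReal).and (hf.2.eventually_lt_const ratio_pos)).exists
  have ratio_le (x : D) (hx : R ≤ W x) : ratio x ≤ ratio y := calc
    ratio x ≤ ‖f x‖ₑ / W x := ENNReal.div_le_div_right (Real.ofReal_le_enorm _) _
    _ ≤ _ := le_iSup₂ (f := fun (x : D) (_ : (R : ℝ≥0∞) ≤ W x) => ‖f x‖ₑ / W x) x hx
    _ ≤ ratio y := small.le
  have hyR : W y ≤ R := by rwa [← ENNReal.coe_toNNReal (hW y y.2), ENNReal.coe_le_coe]
  have usc : UpperSemicontinuousOn ratio {x | W x ≤ R} :=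
    upperSemicontinuousOn_ofReal_div (hf.1 R)
      (W := fun x : D => W x) (hlsc.comp continuous_induced_dom) fun x => hW0 x
  obtain ⟨x₀, -, hx₀⟩ := usc.exists_isMaxOn ⟨y, hyR⟩ (hcompact R)
  refine ⟨x₀, fun x => ?_⟩
  rcases le_total (W x) R with hx | hx
  · exact hx₀ hx
  · exact (ratio_le x hx).trans (hx₀ hyR)

/-- `x₀` maximises `u / V_{q,κ}` over `X_q`, and the maximum `c` is positive. Both are stated
without the denominator, in `ℝ`. -/
structure IsRatioMax (q κ : ℝ) (u : X → ℝ) (c : ℝ) (x₀ : X) : Prop where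
  pos : 0 < c
  mem : x₀ ∈ Xp q
  eq : u x₀ = c * (V q κ x₀).toReal
  le : ∀ x ∈ Xp q, u x ≤ c * (V q κ x).toReal

lemma exists_isRatioMax (hp : 2 ≤ p) (hκ : 0 < κ) {u : X → ℝ}
    (hu : MemWC (V p κ) fun x : Xp p => u x) {y : X} (hy : y ∈ Xp p) (hy0 : 0 < u y) :
    ∃ c x₀, IsRatioMax p κ u c x₀ := by
  have V_ne_zero (x : X) : V p κ x ≠ 0 := (zero_lt_one.trans_le (one_le_V hκ.le p x)).ne'
  have toReal_pos {x : X} (hx : x ∈ Xp p) : 0 < (V p κ x).toReal :=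
    ENNReal.toReal_pos (V_ne_zero x) (V_ne_top_iff.mpr hx)
  obtain ⟨⟨x₀, hx₀⟩, hmax⟩ := hu.exists_forall_le V_ne_zero (fun x hx => V_ne_top_iff.mpr hx)
    (lowerSemicontinuous_weakSpace_V hp hκ.le) (isCompact_weakTop_V_le hp hκ) (y := ⟨y, hy⟩) hy0
  have ratio_eq {x : X} (hx : x ∈ Xp p) : ENNReal.ofReal (u x) / V p κ x =
      ENNReal.ofReal (u x / (V p κ x).toReal) := by
    rw [ENNReal.ofReal_div_of_pos (toReal_pos hx), ENNReal.ofReal_toReal (V_ne_top_iff.mpr hx)]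
  have hc : 0 < u x₀ / (V p κ x₀).toReal := by
    rw [← ENNReal.ofReal_pos, ← ratio_eq hx₀]
    refine lt_of_lt_of_le ?_ (hmax ⟨y, hy⟩)
    exact ENNReal.div_pos (ENNReal.ofReal_pos.mpr hy0).ne' (V_ne_top_iff.mpr hy)
  refine ⟨_, x₀, hc, hx₀, (div_mul_cancel₀ _ (toReal_pos hx₀).ne').symm, fun x hx => ?_⟩
  rw [← div_le_iff₀ (toReal_pos hx), ← ENNReal.ofReal_le_ofReal_iff hc.le, ← ratio_eq hx,
    ← ratio_eq hx₀]
  exact hmax ⟨x, hx⟩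

end Maximizer

/-! ### The Lyapunov function along continuous directions -/

section OddPower

variable {q : ℝ}

/-- The odd power `|s|^(p-2) s`, which is `1 / p` times the derivative of `|s|^p`. -/
def oddPow (p s : ℝ) : ℝ := |s| ^ (p - 2) * s

lemma oddPow_zero (p : ℝ) : oddPow p 0 = 0 := mul_zero _

lemma abs_oddPow (hq : 1 < q) (s : ℝ) : |oddPow q s| = |s| ^ (q - 1) := by
  rw [oddPow, abs_mul, Real.abs_rpow_of_nonneg (abs_nonneg _), abs_abs]
  rcases eq_or_ne s 0 with rfl | hs
  · rw [abs_zero, mul_zero, Real.zero_rpow (by linarith)]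
  · rw [← Real.rpow_add_one (abs_ne_zero.mpr hs)]
    ring_nf

lemma hasDerivAt_abs_rpow_oddPow (hq : 1 < q) (s : ℝ) :
    HasDerivAt (fun s => |s| ^ q) (q * oddPow q s) s :=
  (hasDerivAt_abs_rpow s hq).congr_deriv (mul_assoc _ _ _)

lemma continuous_oddPow (hq : 1 < q) : Continuous (oddPow q) := by
  have h : Continuous (deriv fun s : ℝ => |s| ^ q) :=
    (contDiff_norm_rpow (E := ℝ) hq).continuous_deriv le_rfl
  rw [show (deriv fun s : ℝ => |s| ^ q) = fun s => q * oddPow q s from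
    funext fun s => (hasDerivAt_abs_rpow_oddPow hq s).deriv] at h
  refine (h.const_mul q⁻¹).congr fun s => ?_
  field_simp

lemma continuous_abs_rpow_sub_two (hq : 2 ≤ q) : Continuous fun s : ℝ => |s| ^ (q - 2) :=
  continuous_abs.rpow_const fun _ => .inr (by linarith)

lemma hasDerivAt_oddPow_zero (hq : 2 < q) : HasDerivAt (oddPow q) 0 0 := by
  refine hasDerivAt_iff_tendsto_slope.mpr ?_
  have h := (continuous_abs_rpow_sub_two hq.le).tendsto 0
  rw [abs_zero, Real.zero_rpow (by linarith)] at h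
  refine (h.mono_left nhdsWithin_le_nhds).congr' ?_
  filter_upwards [self_mem_nhdsWithin] with t ht
  rw [slope_def_field, oddPow_zero, oddPow, sub_zero, sub_zero, mul_div_assoc,
    div_self (mem_compl_singleton_iff.mp ht), mul_one]

lemma hasDerivAt_oddPow (hq : 2 ≤ q) (s : ℝ) :
    HasDerivAt (oddPow q) ((q - 1) * |s| ^ (q - 2)) s := by
  rcases hq.eq_or_lt with rfl | hq
  · refine ((hasDerivAt_id' s).congr_of_eventuallyEq (.of_forall fun t => ?_)).congr_deriv ?_
    · simp [oddPow]
    · norm_num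
  rcases eq_or_ne s 0 with rfl | hs
  · simpa [Real.zero_rpow (show q - 2 ≠ 0 by linarith)] using hasDerivAt_oddPow_zero hq
  · refine (((hasDerivAt_abs hs).rpow_const (p := q - 2) (.inl (abs_ne_zero.mpr hs))).mul
      (hasDerivAt_id' s)).congr_deriv ?_
    rw [show |s| ^ (q - 2) = |s| ^ (q - 2 - 1) * |s| by
      rw [← Real.rpow_add_one (abs_ne_zero.mpr hs), sub_add_cancel]]
    linear_combination (q - 2) * |s| ^ (q - 2 - 1) * sign_mul_self s

lemma oddPow_half_sq (hq : 2 < q) (s : ℝ) : oddPow (q / 2) s ^ 2 = |s| ^ (q - 2) := by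
  rw [← sq_abs, abs_oddPow (by linarith), ← Real.rpow_natCast, ← Real.rpow_mul (abs_nonneg _)]
  congr 1
  push_cast
  ring

lemma abs_rpow_le_one_add_abs_rpow {a : ℝ} (ha : 0 ≤ a) (haq : a ≤ q) (s : ℝ) :
    |s| ^ a ≤ (1 + |s|) ^ q :=
  (Real.rpow_le_rpow (abs_nonneg s) (by linarith) ha).trans
    (Real.rpow_le_rpow_of_exponent_le (by linarith [abs_nonneg s]) haq)

end OddPower

section Nemytskii

variable {q : ℝ} {y : ℝ → ℝ}

lemma integrable_one_add_rpow (hq : 0 < q) (hy : MemLp y (ENNReal.ofReal q) unitVol) {D : ℝ}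
    (hD : 0 ≤ D) : Integrable (fun r => (1 + (|y r| + D)) ^ q) unitVol := by
  have h : MemLp (fun r => 1 + (|y r| + D)) (ENNReal.ofReal q) unitVol :=
    MemLp.add (f := fun _ => (1 : ℝ)) (g := fun r => |y r| + D) (memLp_const 1)
      (MemLp.add (f := fun r => |y r|) (g := fun _ => D) hy.abs (memLp_const D))
  have hint := h.integrable_norm_rpow (ENNReal.ofReal_pos.mpr hq).ne' ENNReal.ofReal_ne_top
  rw [ENNReal.toReal_ofReal hq.le] at hint
  refine hint.congr (.of_forall fun r => ?_)
  dsimp only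
  rw [Real.norm_of_nonneg (by positivity)]

lemma exists_ae_norm_le_of_continuous {B : Type*} [NormedAddCommGroup B] {ℓ : ℝ → B}
    (hℓ : Continuous ℓ) :
    ∃ K, 0 ≤ K ∧ ∀ᵐ r ∂unitVol, ‖ℓ r‖ ≤ K := by
  obtain ⟨K, hK⟩ := (isCompact_Icc (a := (0 : ℝ)) (b := 1)).exists_bound_of_continuousOn
    hℓ.continuousOn
  refine ⟨K, (norm_nonneg _).trans (hK 0 (by simp)), ?_⟩
  filter_upwards [ae_restrict_mem measurableSet_Ioo] with r hr
  exact hK r (Ioo_subset_Icc_self hr)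

lemma integrable_comp_of_growth (hq : 0 < q) (hy : MemLp y (ENNReal.ofReal q) unitVol)
    {ρ : ℝ → ℝ} (hρ : Continuous ρ) {C : ℝ} (hC : ∀ s, |ρ s| ≤ C * (1 + |s|) ^ q) :
    Integrable (fun r => ρ (y r)) unitVol := by
  have h := (integrable_one_add_rpow hq hy le_rfl).const_mul C
  simp only [add_zero] at h
  exact h.mono' (hρ.comp_aestronglyMeasurable hy.1) (.of_forall fun r => hC _)

lemma integrable_mul_of_continuous {f z : ℝ → ℝ} (hf : Integrable f unitVol) (hz : Continuous z) :
    Integrable (fun r => f r * z r) unitVol := by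
  obtain ⟨K, -, hK⟩ := exists_ae_norm_le_of_continuous hz
  exact hf.mul_bdd hz.aestronglyMeasurable hK

variable {B : Type*} [NormedAddCommGroup B] [NormedSpace ℝ B]

lemma memLp_add_apply (hy : MemLp y (ENNReal.ofReal q) unitVol) {ℓ : ℝ → B →L[ℝ] ℝ}
    (hℓ : Continuous ℓ) (ξ : B) :
    MemLp (fun r => y r + ℓ r ξ) (ENNReal.ofReal q) unitVol :=
  hy.add (memLp_of_continuous (hℓ.clm_apply continuous_const) _)

lemma hasFDerivAt_integral_comp (hq : 0 < q) (hy : MemLp y (ENNReal.ofReal q) unitVol)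
    {ℓ : ℝ → B →L[ℝ] ℝ} (hℓ : Continuous ℓ) {ρ ρ' : ℝ → ℝ} (hρ : ∀ s, HasDerivAt ρ (ρ' s) s)
    (hρ' : Continuous ρ') {C : ℝ} (hC : ∀ s, |ρ s| ≤ C * (1 + |s|) ^ q)
    (hC' : ∀ s, |ρ' s| ≤ C * (1 + |s|) ^ q) {z : ℝ → ℝ} (hz : Continuous z) (ξ : B) :
    HasFDerivAt (fun ξ => ∫ r, ρ (y r + ℓ r ξ) * z r ∂unitVol)
      (∫ r, (ρ' (y r + ℓ r ξ) * z r) • ℓ r ∂unitVol) ξ := by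
  have hρc : Continuous ρ := continuous_iff_continuousAt.mpr fun s => (hρ s).continuousAt
  have hC0 : 0 ≤ C := by simpa using (abs_nonneg _).trans (hC 0)
  obtain ⟨K, hK0, hK⟩ := exists_ae_norm_le_of_continuous hℓ
  obtain ⟨K', hK0', hK'⟩ := exists_ae_norm_le_of_continuous hz
  have integrable (ζ : B) : Integrable (fun r => ρ (y r + ℓ r ζ) * z r) unitVol :=
    integrable_mul_of_continuous (integrable_comp_of_growth hq (memLp_add_apply hy hℓ ζ) hρc hC) hz
  have bound : ∀ᵐ r ∂unitVol, ∀ ζ ∈ Metric.ball ξ 1, ‖(ρ' (y r + ℓ r ζ) * z r) • ℓ r‖ ≤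
      C * (1 + (|y r| + K * (‖ξ‖ + 1))) ^ q * K' * K := by
    filter_upwards [hK, hK'] with r hr hr' ζ hζ
    have norm_le : ‖ζ‖ ≤ ‖ξ‖ + 1 := by
      have := norm_sub_norm_le ζ ξ
      rw [Metric.mem_ball, dist_eq_norm] at hζ
      linarith
    have apply_le : |ℓ r ζ| ≤ K * (‖ξ‖ + 1) := ((ℓ r).le_opNorm ζ).trans (by gcongr)
    have arg_le : |y r + ℓ r ζ| ≤ |y r| + K * (‖ξ‖ + 1) := (abs_add_le _ _).trans (by gcongr)
    rw [norm_smul, norm_mul]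
    gcongr
    exact (hC' _).trans (by gcongr)
  refine hasFDerivAt_integral_of_dominated_of_fderiv_le (Metric.ball_mem_nhds ξ one_pos)
    (.of_forall fun ζ => (integrable ζ).aestronglyMeasurable) (integrable ξ) ?_ bound
    ((((integrable_one_add_rpow hq hy (by positivity)).const_mul C).mul_const K').mul_const K)
    (.of_forall fun r ζ _ => ?_)
  · exact ((hρ'.comp_aestronglyMeasurable (memLp_add_apply hy hℓ ξ).1).mul
      hz.aestronglyMeasurable).smul hℓ.aestronglyMeasurable
  · refine (((hρ _).comp_hasFDerivAt ζ ((ℓ r).hasFDerivAt.const_add _)).mul_const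
      (z r)).congr_fderiv ?_
    rw [smul_smul, mul_comm]

lemma integral_smul_clm_apply {f : ℝ → ℝ} (hf : Integrable f unitVol) {ℓ : ℝ → B →L[ℝ] ℝ}
    (hℓ : Continuous ℓ) (a : B) :
    (∫ r, f r • ℓ r ∂unitVol) a = ∫ r, f r * ℓ r a ∂unitVol := by
  obtain ⟨K, -, hK⟩ := exists_ae_norm_le_of_continuous hℓ
  exact ContinuousLinearMap.integral_apply (hf.smul_bdd K hℓ.aestronglyMeasurable hK) a

lemma hasFDerivAt_integral_abs_rpow (hq : 1 < q) (hy : MemLp y (ENNReal.ofReal q) unitVol)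
    {ℓ : ℝ → B →L[ℝ] ℝ} (hℓ : Continuous ℓ) (ξ : B) :
    HasFDerivAt (fun ξ => ∫ r, |y r + ℓ r ξ| ^ q ∂unitVol)
      (q • ∫ r, oddPow q (y r + ℓ r ξ) • ℓ r ∂unitVol) ξ := by
  have growth (s : ℝ) : |(|s| ^ q)| ≤ q * (1 + |s|) ^ q := by
    rw [Real.abs_rpow_of_nonneg (abs_nonneg s), abs_abs]
    exact (abs_rpow_le_one_add_abs_rpow (by linarith) le_rfl s).trans
      (le_mul_of_one_le_left (by positivity) hq.le)
  have growth' (s : ℝ) : |q * oddPow q s| ≤ q * (1 + |s|) ^ q := by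
    rw [abs_mul, abs_of_pos (by linarith : 0 < q), abs_oddPow hq]
    gcongr
    exact abs_rpow_le_one_add_abs_rpow (by linarith) (by linarith) s
  simpa only [mul_one, mul_smul, integral_smul] using
    hasFDerivAt_integral_comp (by linarith) hy hℓ (hasDerivAt_abs_rpow_oddPow hq)
      ((continuous_oddPow hq).const_mul q) growth growth' (z := fun _ => 1) continuous_const ξ

lemma hasFDerivAt_integral_oddPow (hq : 2 ≤ q) (hy : MemLp y (ENNReal.ofReal q) unitVol)
    {ℓ : ℝ → B →L[ℝ] ℝ} (hℓ : Continuous ℓ) {a : ℝ → ℝ} (ha : Continuous a) (ξ : B) :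
    HasFDerivAt (fun ξ => ∫ r, oddPow q (y r + ℓ r ξ) * a r ∂unitVol)
      ((q - 1) • ∫ r, (|y r + ℓ r ξ| ^ (q - 2) * a r) • ℓ r ∂unitVol) ξ := by
  have growth (s : ℝ) : |oddPow q s| ≤ (q - 1) * (1 + |s|) ^ q := by
    rw [abs_oddPow (by linarith)]
    exact (abs_rpow_le_one_add_abs_rpow (by linarith) (by linarith) s).trans
      (le_mul_of_one_le_left (by positivity) (by linarith))
  have growth' (s : ℝ) : |(q - 1) * |s| ^ (q - 2)| ≤ (q - 1) * (1 + |s|) ^ q := by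
    rw [abs_mul, abs_of_nonneg (by linarith : 0 ≤ q - 1),
      Real.abs_rpow_of_nonneg (abs_nonneg s), abs_abs]
    exact mul_le_mul_of_nonneg_left
      (abs_rpow_le_one_add_abs_rpow (by linarith) (by linarith) s) (by linarith)
  simpa only [mul_assoc, mul_smul, integral_smul] using
    hasFDerivAt_integral_comp (by linarith) hy hℓ (hasDerivAt_oddPow hq)
      ((continuous_abs_rpow_sub_two hq).const_mul _) growth growth' ha ξ

lemma integrable_oddPow_comp (hq : 2 ≤ q) (hy : MemLp y (ENNReal.ofReal q) unitVol) :
    Integrable (fun r => oddPow q (y r)) unitVol := by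
  refine integrable_comp_of_growth (by linarith) hy (continuous_oddPow (by linarith)) (C := 1)
    fun s => ?_
  rw [abs_oddPow (by linarith), one_mul]
  exact abs_rpow_le_one_add_abs_rpow (by linarith) (by linarith) s

lemma integrable_abs_rpow_comp (hq : 2 ≤ q) (hy : MemLp y (ENNReal.ofReal q) unitVol) :
    Integrable (fun r => |y r| ^ (q - 2)) unitVol := by
  refine integrable_comp_of_growth (by linarith) hy (continuous_abs_rpow_sub_two hq) (C := 1)
    fun s => ?_
  rw [abs_of_nonneg (by positivity), one_mul]
  exact abs_rpow_le_one_add_abs_rpow (by linarith) (by linarith) s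

end Nemytskii

section Lyapunov

variable {q κ : ℝ}

/-- The coefficient of the `L^q` part of the Lyapunov function `V q κ`, which is absent for
`q = 2`. -/
def lqCoeff (q : ℝ) : ℝ := if q = 2 then 0 else 1

lemma lqCoeff_nonneg (q : ℝ) : 0 ≤ lqCoeff q := by
  rw [lqCoeff]
  split_ifs <;> norm_num

/-- The value of the Lyapunov function `V q κ` at the class of `f`, for `f ∈ L^q`. -/
def lyap (q κ : ℝ) (f : ℝ → ℝ) : ℝ :=
  Real.exp (κ * ∫ r, f r ^ 2 ∂unitVol) * (1 + lqCoeff q * ∫ r, |f r| ^ q ∂unitVol)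

/-- The coefficient of `oddPow q f` in the gradient
`2 κ lyap q κ f • f + oddCoeff q κ f • oddPow q f` of `lyap q κ` at `f`. -/
def oddCoeff (q κ : ℝ) (f : ℝ → ℝ) : ℝ :=
  lqCoeff q * q * Real.exp (κ * ∫ r, f r ^ 2 ∂unitVol)

/-- The derivative of `lyap q κ` at `f` in the direction `a`. Allowing a vector-valued `a` covers
the derivative along a family of directions. -/
def dlyap {W : Type*} [NormedAddCommGroup W] [NormedSpace ℝ W] (q κ : ℝ) (f : ℝ → ℝ)
    (a : ℝ → W) : W :=
  (2 * κ * lyap q κ f) • ∫ r, f r • a r ∂unitVol +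
    oddCoeff q κ f • ∫ r, oddPow q (f r) • a r ∂unitVol

/-- The second derivative of `lyap q κ` at `f` in the directions `a` and `b`, where `b` may be
vector-valued. -/
def ddlyap {W : Type*} [NormedAddCommGroup W] [NormedSpace ℝ W] (q κ : ℝ) (f a : ℝ → ℝ)
    (b : ℝ → W) : W :=
  (2 * κ * ∫ r, f r * a r ∂unitVol) • dlyap q κ f b +
    (2 * κ * lyap q κ f) • ∫ r, a r • b r ∂unitVol +
    (2 * κ * oddCoeff q κ f * ∫ r, oddPow q (f r) * a r ∂unitVol) • ∫ r, f r • b r ∂unitVol +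
    (oddCoeff q κ f * (q - 1)) • ∫ r, (|f r| ^ (q - 2) * a r) • b r ∂unitVol

lemma lyap_pos (q κ : ℝ) (f : ℝ → ℝ) : 0 < lyap q κ f := by
  have : 0 ≤ ∫ r, |f r| ^ q ∂unitVol := integral_nonneg fun r => by positivity
  have := lqCoeff_nonneg q
  rw [lyap]
  positivity

lemma oddCoeff_nonneg (hq : 0 ≤ q) (κ : ℝ) (f : ℝ → ℝ) : 0 ≤ oddCoeff q κ f := by
  have := lqCoeff_nonneg q
  rw [oddCoeff]
  positivity

variable {f₁ f₂ : ℝ → ℝ}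

lemma integral_comp_congr (h : f₁ =ᵐ[unitVol] f₂) (ρ : ℝ → ℝ) :
    ∫ r, ρ (f₁ r) ∂unitVol = ∫ r, ρ (f₂ r) ∂unitVol :=
  integral_congr_ae (h.fun_comp ρ)

lemma lyap_congr (h : f₁ =ᵐ[unitVol] f₂) : lyap q κ f₁ = lyap q κ f₂ := by
  rw [lyap, lyap, integral_comp_congr h (· ^ 2), integral_comp_congr h (|·| ^ q)]

lemma oddCoeff_congr (h : f₁ =ᵐ[unitVol] f₂) : oddCoeff q κ f₁ = oddCoeff q κ f₂ := by
  rw [oddCoeff, oddCoeff, integral_comp_congr h (· ^ 2)]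

variable {B : Type*} [NormedAddCommGroup B] [NormedSpace ℝ B] {y : ℝ → ℝ} {ℓ : ℝ → B →L[ℝ] ℝ}

lemma memLp_two_of_memLp (hq : 2 ≤ q) (hy : MemLp y (ENNReal.ofReal q) unitVol) :
    MemLp y (ENNReal.ofReal 2) unitVol :=
  hy.mono_exponent (ENNReal.ofReal_le_ofReal hq)

lemma hasFDerivAt_exp_integral_sq (κ : ℝ) (hy : MemLp y (ENNReal.ofReal 2) unitVol)
    (hℓ : Continuous ℓ) (ξ : B) :
    HasFDerivAt (fun ξ => Real.exp (κ * ∫ r, (y r + ℓ r ξ) ^ 2 ∂unitVol))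
      (Real.exp (κ * ∫ r, (y r + ℓ r ξ) ^ 2 ∂unitVol) •
        (2 * κ) • ∫ r, (y r + ℓ r ξ) • ℓ r ∂unitVol) ξ := by
  have h := ((hasFDerivAt_integral_abs_rpow one_lt_two hy hℓ ξ).const_mul κ).exp
  simp only [Real.rpow_two, sq_abs, oddPow, sub_self, Real.rpow_zero, one_mul] at h
  rwa [smul_smul κ, mul_comm κ 2] at h

lemma hasFDerivAt_lyap (hq : 2 ≤ q) (κ : ℝ) (hy : MemLp y (ENNReal.ofReal q) unitVol)
    (hℓ : Continuous ℓ) (ξ : B) :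
    HasFDerivAt (fun ξ => lyap q κ fun r => y r + ℓ r ξ)
      (dlyap q κ (fun r => y r + ℓ r ξ) ℓ) ξ := by
  refine ((hasFDerivAt_exp_integral_sq κ (memLp_two_of_memLp hq hy) hℓ ξ).mul
    (((hasFDerivAt_integral_abs_rpow (by linarith) hy hℓ ξ).const_mul
      (lqCoeff q)).const_add 1)).congr_fderiv ?_
  rw [dlyap, lyap, oddCoeff]
  module

lemma hasFDerivAt_dlyap (hq : 2 ≤ q) (κ : ℝ) (hy : MemLp y (ENNReal.ofReal q) unitVol)
    (hℓ : Continuous ℓ) {a : ℝ → ℝ} (ha : Continuous a) (ξ : B) :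
    HasFDerivAt (fun ξ => dlyap q κ (fun r => y r + ℓ r ξ) a)
      (ddlyap q κ (fun r => y r + ℓ r ξ) a ℓ) ξ := by
  have hy2 := memLp_two_of_memLp hq hy
  have h := hasFDerivAt_integral_oddPow le_rfl hy2 hℓ ha ξ
  simp only [oddPow, sub_self, Real.rpow_zero, one_mul] at h
  refine (((hasFDerivAt_lyap hq κ hy hℓ ξ).const_mul (2 * κ)).mul h |>.add
    (((hasFDerivAt_exp_integral_sq κ hy2 hℓ ξ).const_mul (lqCoeff q * q)).mul
      (hasFDerivAt_integral_oddPow hq hy hℓ ha ξ))).congr_fderiv ?_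
  simp only [ddlyap, oddCoeff]
  module

lemma integrable_of_memLp (hq : 2 ≤ q) (hy : MemLp y (ENNReal.ofReal q) unitVol) :
    Integrable y unitVol :=
  hy.integrable (ENNReal.one_le_ofReal.mpr (by linarith))

lemma dlyap_clm_apply (hq : 2 ≤ q) (κ : ℝ) (hy : MemLp y (ENNReal.ofReal q) unitVol)
    (hℓ : Continuous ℓ) (b : B) : dlyap q κ y ℓ b = dlyap q κ y fun r => ℓ r b := by
  simp only [dlyap, add_apply, smul_apply, smul_eq_mul,
    integral_smul_clm_apply (integrable_of_memLp hq hy) hℓ,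
    integral_smul_clm_apply (integrable_oddPow_comp hq hy) hℓ]

lemma ddlyap_clm_apply (hq : 2 ≤ q) (κ : ℝ) (hy : MemLp y (ENNReal.ofReal q) unitVol)
    (hℓ : Continuous ℓ) {a : ℝ → ℝ} (ha : Continuous a) (b : B) :
    ddlyap q κ y a ℓ b = ddlyap q κ y a fun r => ℓ r b := by
  simp only [ddlyap, add_apply, smul_apply, smul_eq_mul,
    dlyap_clm_apply hq κ hy hℓ, integral_smul_clm_apply (integrable_of_continuous ha) hℓ,
    integral_smul_clm_apply (integrable_of_memLp hq hy) hℓ,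
    integral_smul_clm_apply
      (integrable_mul_of_continuous (integrable_abs_rpow_comp hq hy) ha) hℓ]

variable {x : X} {f : ℝ → ℝ}

lemma mem_Xp_iff_memLp (hq : 0 < q) (hx : x =ᵐ[unitVol] f) :
    x ∈ Xp q ↔ MemLp f (ENNReal.ofReal q) unitVol := by
  rw [← memLp_congr_ae hx, MemLp, and_iff_right (Lp.aestronglyMeasurable x),
    eLpNorm_lt_top_iff_lintegral_rpow_enorm_lt_top (ENNReal.ofReal_pos.mpr hq).ne'
      ENNReal.ofReal_ne_top, ENNReal.toReal_ofReal hq.le]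
  rfl

lemma expW_eq (κ : ℝ) (hx : x =ᵐ[unitVol] f) :
    expW κ x = Real.exp (κ * ∫ r, f r ^ 2 ∂unitVol) := by
  rw [expW, norm_sq_eq_integral hx]

lemma toReal_lpPow (hq : 0 ≤ q) (hx : x =ᵐ[unitVol] f) :
    (lpPow q x).toReal = ∫ r, |f r| ^ q ∂unitVol := by
  rw [← integral_comp_congr hx (|·| ^ q), lpPow, integral_eq_lintegral_of_nonneg_ae
    (.of_forall fun r => by positivity)
    ((Lp.aestronglyMeasurable x).aemeasurable.abs.pow_const q).aestronglyMeasurable]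
  simp only [← Real.norm_eq_abs, ← ENNReal.ofReal_rpow_of_nonneg (norm_nonneg _) hq,
    ofReal_norm]

lemma toReal_V (hq : 0 < q) (κ : ℝ) (hx : x =ᵐ[unitVol] f)
    (hf : MemLp f (ENNReal.ofReal q) unitVol) : (V q κ x).toReal = lyap q κ f := by
  rw [V, lyap, ← expW_eq κ hx, lqCoeff]
  split_ifs with h
  · rw [ENNReal.toReal_ofReal (expW_pos κ x).le, zero_mul, add_zero, mul_one]
  · rw [ENNReal.toReal_mul, ENNReal.toReal_ofReal (expW_pos κ x).le, ENNReal.toReal_add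
      ENNReal.one_ne_top ((mem_Xp_iff_memLp hq hx).mpr hf).ne, toReal_lpPow hq.le hx,
      ENNReal.toReal_one, one_mul]

end Lyapunov

/-! ### Sine polynomials -/

section Dirichlet

/-- `y` is continuously differentiable with derivative `y'` and vanishes at `0` and `1`. Both are
functions on the whole line, so that no one-sided derivatives are needed. -/
structure IsDirichlet (y y' : C(ℝ, ℝ)) : Prop where
  hasDerivAt : ∀ r, HasDerivAt y (y' r) r
  zero : y 0 = 0
  one : y 1 = 0

namespace IsDirichlet

variable {y y' w w' : C(ℝ, ℝ)}

lemma sub (h : IsDirichlet y y') (hw : IsDirichlet w w') : IsDirichlet (y - w) (y' - w') where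
  hasDerivAt r := (h.hasDerivAt r).sub (hw.hasDerivAt r)
  zero := by rw [ContinuousMap.sub_apply, h.zero, hw.zero, sub_zero]
  one := by rw [ContinuousMap.sub_apply, h.one, hw.one, sub_zero]

lemma comp (h : IsDirichlet y y') {ρ ρ' : C(ℝ, ℝ)} (hρ : ∀ s, HasDerivAt ρ (ρ' s) s)
    (h0 : ρ 0 = 0) : IsDirichlet (ρ.comp y) (ρ'.comp y * y') where
  hasDerivAt r := (hρ _).comp r (h.hasDerivAt r)
  zero := by rw [ContinuousMap.comp_apply, h.zero, h0]
  one := by rw [ContinuousMap.comp_apply, h.one, h0]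

lemma hasWeakDeriv (h : IsDirichlet y y') : HasWeakDeriv (toX (restr y)) y' :=
  (hasWeakDeriv_of_hasDerivAt h.hasDerivAt).congr (coeFn_toX_restr y)

lemma mem_H01 (h : IsDirichlet y y') : toX (restr y) ∈ H01 :=
  ⟨⟨y', memLp_of_continuous y'.continuous 2, h.hasWeakDeriv⟩,
    y, y.continuous.continuousOn, h.zero, h.one, coeFn_toX_restr y⟩

lemma mul_inner_eta (h : IsDirichlet y y') (k : ℕ) :
    Real.pi * (k + 1) * inner ℝ (toX (restr y)) (eta k) =
      inner ℝ (toX (restr y')) (cosX (k + 1)) := by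
  have memLp := memLp_of_continuous y'.continuous 2
  rw [mul_inner_eta_of_mem_H01 h.mem_H01 h.hasWeakDeriv memLp, eq_toX_restr memLp.coeFn_toLp]

lemma inner_cosX_zero (h : IsDirichlet y y') : inner ℝ (toX (restr y')) (cosX 0) = 0 := by
  rw [inner_eq_integral_of_ae_eq (coeFn_toX_restr y') (coeFn_cosX 0), integral_unitVol_eq]
  simp only [cosC, ContinuousMap.coe_mk, if_true, Nat.cast_zero, mul_zero, zero_mul, Real.cos_zero,
    mul_one]
  rw [intervalIntegral.integral_eq_sub_of_hasDerivAt (fun r _ => h.hasDerivAt r)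
    (y'.continuous.intervalIntegrable _ _), h.one, h.zero, sub_zero]

lemma hasSum_lapCoeff_mul (h : IsDirichlet y y') (hw : IsDirichlet w w') :
    HasSum (fun k => lapCoeff (toX (restr y)) k * inner ℝ (toX (restr w)) (eta k))
      (-inner ℝ (toX (restr y')) (toX (restr w'))) := by
  have parseval := cosBasis.hasSum_inner_mul_inner (toX (restr y')) (toX (restr w'))
  simp only [cosBasis_apply] at parseval
  rw [← hasSum_nat_add_iff' 1, Finset.sum_range_one, h.inner_cosX_zero, zero_mul, sub_zero]
    at parseval
  refine parseval.neg.congr_fun fun k => ?_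
  rw [← h.mul_inner_eta, real_inner_comm (toX (restr w')), ← hw.mul_inner_eta, lapCoeff]
  ring

lemma norm_restr_le (h : IsDirichlet y y') : ‖restr y‖ ≤ ‖toX (restr y')‖ := by
  refine (ContinuousMap.norm_le _ (norm_nonneg _)).mpr fun ⟨r, hr⟩ => ?_
  let ind := indicatorConstLp 2 (measurableSet_Ioo (a := 0) (b := r))
    (measure_ne_top unitVol _) (1 : ℝ)
  have norm_ind : ‖ind‖ ≤ 1 := by
    refine (norm_indicatorConstLp_le).trans ?_
    rw [norm_one, one_mul]
    exact Real.rpow_le_one measureReal_nonneg measureReal_le_one (by positivity)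
  have apply_eq_inner : y r = inner ℝ ind (toX (restr y')) := by
    rw [L2.inner_indicatorConstLp_one,
      integral_congr_ae (ae_restrict_of_ae (coeFn_toX_restr y')),
      Measure.restrict_restrict measurableSet_Ioo, inter_eq_left.mpr (Ioo_subset_Ioo_right hr.2),
      ← integral_Ioc_eq_integral_Ioo, ← intervalIntegral.integral_of_le hr.1,
      intervalIntegral.integral_eq_sub_of_hasDerivAt (fun r _ => h.hasDerivAt r)
        (y'.continuous.intervalIntegrable _ _), h.zero, sub_zero]
  calc ‖y r‖ ≤ ‖ind‖ * ‖toX (restr y')‖ := apply_eq_inner ▸ norm_inner_le_norm _ _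
    _ ≤ ‖toX (restr y')‖ := mul_le_of_le_one_left (norm_nonneg _) norm_ind

end IsDirichlet

/-- The sine polynomial with coefficients `ξ`: an element of `E n` as a function on the line. -/
def sinePoly {n : ℕ} (ξ : E n) : C(ℝ, ℝ) := ∑ i : Fin n, ξ i • etaC i

/-- The derivative of a sine polynomial. -/
def sinePolyDeriv {n : ℕ} (ξ : E n) : C(ℝ, ℝ) :=
  ∑ i : Fin n, (Real.pi * (i + 1) * ξ i) • cosC (i + 1)

lemma isDirichlet_etaC (k : ℕ) : IsDirichlet (etaC k) ((Real.pi * (k + 1)) • cosC (k + 1)) where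
  hasDerivAt r := by
    refine (((hasDerivAt_id' r).const_mul (Real.pi * (k + 1))).sin.const_mul √2).congr_deriv ?_
    simp only [cosC, ContinuousMap.smul_apply, ContinuousMap.coe_mk, Nat.add_eq_zero_iff,
      one_ne_zero, and_false, if_false, Nat.cast_add, Nat.cast_one, smul_eq_mul]
    ring
  zero := by simp [etaC, etaFun]
  one := by
    have := Real.sin_nat_mul_pi (k + 1)
    rw [mul_comm, Nat.cast_add, Nat.cast_one] at this
    simp [etaC, etaFun, this]

lemma isDirichlet_sinePoly {n : ℕ} (ξ : E n) : IsDirichlet (sinePoly ξ) (sinePolyDeriv ξ) where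
  hasDerivAt r := by
    simp only [sinePoly, sinePolyDeriv, ContinuousMap.coe_sum, Finset.sum_apply]
    refine HasDerivAt.sum fun i _ => ?_
    refine (((isDirichlet_etaC i).hasDerivAt r).const_mul (ξ i)).congr_deriv ?_
    simp only [ContinuousMap.smul_apply, smul_eq_mul]
    ring
  zero := by simp [sinePoly, (isDirichlet_etaC _).zero]
  one := by simp [sinePoly, (isDirichlet_etaC _).one]

lemma toX_restr_sum_smul {ι : Type*} (s : Finset ι) (a : ι → ℝ) (f : ι → C(ℝ, ℝ)) :
    toX (restr (∑ i ∈ s, a i • f i)) = ∑ i ∈ s, a i • toX (restr (f i)) := by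
  have restr_sum : restr (∑ i ∈ s, a i • f i) = ∑ i ∈ s, a i • restr (f i) := by
    ext r
    simp
  rw [restr_sum, map_sum]
  simp only [map_smul]

lemma toX_sinePoly {n : ℕ} (ξ : E n) : toX (restr (sinePoly ξ)) = incl n ξ := by
  rw [sinePoly, toX_restr_sum_smul]
  simp only [← eta_eq_toX, incl]

namespace IsDirichlet

variable {y y' : C(ℝ, ℝ)}

lemma tendsto_sinePolyDeriv (h : IsDirichlet y y') :
    Tendsto (fun n => toX (restr (sinePolyDeriv (proj n (toX (restr y)))))) atTop
      (𝓝 (toX (restr y'))) := by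
  have partial_sums := (hasSum_nat_add_iff' 1).mpr (hasSum_cosX (toX (restr y')))
  rw [Finset.sum_range_one, h.inner_cosX_zero, zero_smul, sub_zero] at partial_sums
  refine partial_sums.tendsto_sum_nat.congr fun n => ?_
  rw [sinePolyDeriv, toX_restr_sum_smul, Finset.sum_range]
  simp only [proj, h.mul_inner_eta, cosX]

lemma tendsto_sinePoly (h : IsDirichlet y y') :
    Tendsto (fun n => restr (sinePoly (proj n (toX (restr y))))) atTop (𝓝 (restr y)) := by
  refine tendsto_iff_norm_sub_tendsto_zero.mpr <| squeeze_zero (fun _ => norm_nonneg _)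
    (fun n => ?_) (tendsto_iff_norm_sub_tendsto_zero.mp h.tendsto_sinePolyDeriv)
  rw [← map_sub]
  exact ((isDirichlet_sinePoly _).sub h).norm_restr_le

end IsDirichlet

end Dirichlet

section LyapunovOnContinuousFunctions

variable {q : ℝ}

/-- The odd power `oddPow q` as a bundled continuous function. -/
def oddPowC (hq : 2 ≤ q) : C(ℝ, ℝ) := ⟨oddPow q, continuous_oddPow (by linarith)⟩

/-- The even power `s ↦ |s| ^ (q - 2)` as a bundled continuous function; up to the factor `q - 1`
it is the derivative of `oddPow q`. -/
def evenPowC (hq : 2 ≤ q) : C(ℝ, ℝ) := ⟨fun s => |s| ^ (q - 2), continuous_abs_rpow_sub_two hq⟩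

lemma coeFn_toX_comp (ρ : C(ℝ, ℝ)) (f : C(unitInterval, ℝ)) :
    toX (ρ.comp f) =ᵐ[unitVol] fun r => ρ (toX f r) := by
  filter_upwards [coeFn_toX f, coeFn_toX (ρ.comp f)] with r hf hρ
  rw [hf, hρ, ContinuousMap.comp_apply]

lemma integral_abs_rpow_toX (hq : 2 ≤ q) (f : C(unitInterval, ℝ)) :
    ∫ r, |toX f r| ^ q ∂unitVol = inner ℝ (toX ((oddPowC hq).comp f)) (toX f) := by
  rw [inner_eq_integral_of_ae_eq (coeFn_toX_comp _ f) .rfl]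
  refine integral_congr_ae (.of_forall fun r => ?_)
  have rpow_eq := Real.rpow_add_natCast' (n := 2) (abs_nonneg (toX f r))
    (y := q - 2) (by push_cast; linarith)
  rw [Nat.cast_ofNat, sub_add_cancel, sq_abs, sq, ← mul_assoc] at rpow_eq
  exact rpow_eq

lemma continuous_expW_toX (κ : ℝ) : Continuous fun f => expW κ (toX f) := by
  unfold expW
  fun_prop

lemma continuous_toX_comp (ρ : C(ℝ, ℝ)) : Continuous fun f => toX (ρ.comp f) :=
  toX.continuous.comp ρ.continuous_postcomp

lemma continuous_lyap_toX (hq : 2 ≤ q) (κ : ℝ) : Continuous fun f => lyap q κ (toX f) := by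
  simp only [lyap, ← expW_eq κ (ae_eq_refl _), integral_abs_rpow_toX hq]
  exact (continuous_expW_toX κ).mul
    (((continuous_toX_comp _).inner toX.continuous).const_mul _ |>.const_add 1)

lemma continuous_oddCoeff_toX (κ : ℝ) : Continuous fun f => oddCoeff q κ (toX f) := by
  simp only [oddCoeff, ← expW_eq κ (ae_eq_refl _)]
  exact (continuous_expW_toX κ).const_mul _

/-- The gradient of the Lyapunov function `V q κ` at a continuous function. -/
def gradX (hq : 2 ≤ q) (κ : ℝ) (f : C(unitInterval, ℝ)) : X :=
  (2 * κ * lyap q κ (toX f)) • toX f + oddCoeff q κ (toX f) • toX ((oddPowC hq).comp f)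

lemma continuous_gradX (hq : 2 ≤ q) (κ : ℝ) : Continuous (gradX hq κ) :=
  (((continuous_lyap_toX hq κ).const_mul _).smul toX.continuous).add
    ((continuous_oddCoeff_toX κ).smul (continuous_toX_comp _))

/-- The inner product of `X` as a bundled bilinear form. -/
def innerX : X →L[ℝ] X →L[ℝ] ℝ := innerSL ℝ

lemma innerX_apply (x y : X) : innerX x y = inner ℝ x y := rfl

/-- The Hessian of the Lyapunov function `V q κ` at a continuous function, cf. `ddlyap`. -/
def hess (hq : 2 ≤ q) (κ : ℝ) (f : C(unitInterval, ℝ)) : X →L[ℝ] X →L[ℝ] ℝ :=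
  (2 * κ) • (innerX (toX f)).smulRight (innerX (gradX hq κ f)) +
    (2 * κ * lyap q κ (toX f)) • innerX +
    (2 * κ * oddCoeff q κ (toX f)) •
      (innerX (toX ((oddPowC hq).comp f))).smulRight (innerX (toX f)) +
    (oddCoeff q κ (toX f) * (q - 1)) • innerX ∘L mulX ((evenPowC hq).comp f)

lemma continuous_smulRight_innerX {a b : C(unitInterval, ℝ) → X} (ha : Continuous a)
    (hb : Continuous b) : Continuous fun f => (innerX (a f)).smulRight (innerX (b f)) :=
  (ContinuousLinearMap.smulRightL ℝ X (X →L[ℝ] ℝ)).continuous₂.comp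
    ((innerX.continuous.comp ha).prodMk (innerX.continuous.comp hb))

set_option maxSynthPendingDepth 3 in
lemma continuous_hess (hq : 2 ≤ q) (κ : ℝ) : Continuous (hess hq κ) := by
  have lyap := continuous_lyap_toX hq κ
  have oddCoeff := continuous_oddCoeff_toX (q := q) κ
  have grad_part := continuous_smulRight_innerX toX.continuous (continuous_gradX hq κ)
  have odd_part := continuous_smulRight_innerX (continuous_toX_comp (oddPowC hq)) toX.continuous
  have : Continuous fun f => innerX ∘L mulX ((evenPowC hq).comp f) :=
    continuous_const.clm_comp (mulX.continuous.comp (evenPowC hq).continuous_postcomp)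
  unfold hess
  fun_prop

lemma comp_restr (ρ y : C(ℝ, ℝ)) : ρ.comp (restr y) = restr (ρ.comp y) := rfl

lemma restr_mul (f g : C(ℝ, ℝ)) : restr (f * g) = restr f * restr g := rfl

lemma dlyap_eq_inner_gradX (hq : 2 ≤ q) (κ : ℝ) (y a : C(ℝ, ℝ)) :
    dlyap q κ y a = inner ℝ (gradX hq κ (restr y)) (toX (restr a)) := by
  rw [gradX, inner_add_left, real_inner_smul_left, real_inner_smul_left,
    lyap_congr (coeFn_toX_restr y), oddCoeff_congr (coeFn_toX_restr y), comp_restr,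
    inner_eq_integral_of_ae_eq (coeFn_toX_restr y) (coeFn_toX_restr a),
    inner_eq_integral_of_ae_eq (coeFn_toX_restr _) (coeFn_toX_restr a)]
  rfl

lemma ddlyap_eq_hess (hq : 2 ≤ q) (κ : ℝ) (y a b : C(ℝ, ℝ)) :
    ddlyap q κ y a b = hess hq κ (restr y) (toX (restr a)) (toX (restr b)) := by
  simp only [hess, add_apply, smul_apply, ContinuousLinearMap.smulRight_apply,
    ContinuousLinearMap.comp_apply, innerX_apply, comp_restr, mulX_toX, ← restr_mul, smul_eq_mul,
    ← dlyap_eq_inner_gradX, lyap_congr (coeFn_toX_restr y), oddCoeff_congr (coeFn_toX_restr y)]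
  rw [inner_eq_integral_of_ae_eq (coeFn_toX_restr y) (coeFn_toX_restr a),
    inner_eq_integral_of_ae_eq (coeFn_toX_restr y) (coeFn_toX_restr b),
    inner_eq_integral_of_ae_eq (coeFn_toX_restr a) (coeFn_toX_restr b),
    inner_eq_integral_of_ae_eq (coeFn_toX_restr _) (coeFn_toX_restr a),
    inner_eq_integral_of_ae_eq (coeFn_toX_restr ((evenPowC hq).comp y * a)) (coeFn_toX_restr b)]
  simp only [ddlyap, smul_eq_mul, ContinuousMap.mul_apply, ContinuousMap.comp_apply, evenPowC,
    oddPowC, ContinuousMap.coe_mk]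
  ring

/-- The left-hand side `α s + β oddPow q s` of the pointwise Euler-Lagrange equation. -/
def linAddOdd (hq : 2 ≤ q) (α β : ℝ) : C(ℝ, ℝ) := α • .id ℝ + β • oddPowC hq

/-- The derivative of `linAddOdd`. -/
def linAddOddDeriv (hq : 2 ≤ q) (α β : ℝ) : C(ℝ, ℝ) :=
  .const ℝ α + (β * (q - 1)) • evenPowC hq

lemma hasDerivAt_linAddOdd (hq : 2 ≤ q) (α β s : ℝ) :
    HasDerivAt (linAddOdd hq α β) (linAddOddDeriv hq α β s) s := by
  refine (((hasDerivAt_id s).const_mul α).add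
    ((hasDerivAt_oddPow hq s).const_mul β)).congr_deriv ?_
  rw [mul_one, ← mul_assoc]
  rfl

lemma linAddOdd_zero (hq : 2 ≤ q) (α β : ℝ) : linAddOdd hq α β 0 = 0 := by
  simp [linAddOdd, oddPowC, oddPow_zero]

lemma gradX_restr (hq : 2 ≤ q) (κ : ℝ) (y : C(ℝ, ℝ)) :
    gradX hq κ (restr y) = toX (restr ((linAddOdd hq (2 * κ * lyap q κ (toX (restr y)))
      (oddCoeff q κ (toX (restr y)))).comp y)) := by
  rw [gradX, ← map_smul, ← map_smul, ← map_add]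
  rfl

lemma toX_linAddOddDeriv (hq : 2 ≤ q) (α β : ℝ) (y w : C(ℝ, ℝ)) :
    toX (restr ((linAddOddDeriv hq α β).comp y * w)) = α • toX (restr w) +
      (β * (q - 1)) • mulX ((evenPowC hq).comp (restr y)) (toX (restr w)) := by
  rw [mulX_toX, ← map_smul, ← map_smul, ← map_add]
  congr 1
  ext r
  simp only [linAddOddDeriv, ContinuousMap.restrict_apply, ContinuousMap.mul_apply,
    ContinuousMap.comp_apply, ContinuousMap.add_apply, ContinuousMap.const_apply,
    ContinuousMap.smul_apply, smul_eq_mul]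
  ring

/-- The dissipation `⟨w, ∂ᵣ gradX⟩`: minus the pairing of the Laplacian of `f` with the gradient of
the Lyapunov function at `f`, where `w` stands for `f'`. -/
def diss (hq : 2 ≤ q) (κ : ℝ) (f : C(unitInterval, ℝ)) (w : X) : ℝ :=
  inner ℝ w ((2 * κ * lyap q κ (toX f)) • w +
    (oddCoeff q κ (toX f) * (q - 1)) • mulX ((evenPowC hq).comp f) w)

/-- The finite value of the weight `Θ q κ` at a continuously differentiable `f`, where `w` stands
for `f'`. -/
def coercive (hq : 2 ≤ q) (κ : ℝ) (f : C(unitInterval, ℝ)) (w : X) : ℝ :=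
  lyap q κ (toX f) * (1 + ‖w‖ ^ 2) +
    lqCoeff q * (expW κ (toX f) * ((q / 2) ^ 2 * inner ℝ w (mulX ((evenPowC hq).comp f) w)))

lemma continuous_mulX_evenPow (hq : 2 ≤ q) :
    Continuous fun p : C(unitInterval, ℝ) × X => mulX ((evenPowC hq).comp p.1) p.2 :=
  mulX.continuous₂.comp
    (((evenPowC hq).continuous_postcomp.comp continuous_fst).prodMk continuous_snd)

lemma continuous_diss (hq : 2 ≤ q) (κ : ℝ) :
    Continuous fun p : C(unitInterval, ℝ) × X => diss hq κ p.1 p.2 :=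
  continuous_snd.inner <|
    ((((continuous_lyap_toX hq κ).comp continuous_fst).const_mul _).smul continuous_snd).add
      ((((continuous_oddCoeff_toX κ).comp continuous_fst).mul_const _).smul
        (continuous_mulX_evenPow hq))

lemma continuous_coercive (hq : 2 ≤ q) (κ : ℝ) :
    Continuous fun p : C(unitInterval, ℝ) × X => coercive hq κ p.1 p.2 :=
  (((continuous_lyap_toX hq κ).comp continuous_fst).mul
    ((continuous_snd.norm.pow 2).const_add 1)).add
    ((((continuous_expW_toX κ).comp continuous_fst).mul
      ((continuous_snd.inner (continuous_mulX_evenPow hq)).const_mul _)).const_mul _)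

lemma inner_mulX_evenPow_nonneg (hq : 2 ≤ q) (f : C(unitInterval, ℝ)) (w : X) :
    0 ≤ inner ℝ w (mulX ((evenPowC hq).comp f) w) := by
  rw [inner_eq_integral_of_ae_eq .rfl (coeFn_mulX _ w)]
  refine integral_nonneg fun r => ?_
  rw [mul_left_comm]
  exact mul_nonneg (Real.rpow_nonneg (abs_nonneg _) _) (mul_self_nonneg _)

lemma coercive_nonneg (hq : 2 ≤ q) (κ : ℝ) (f : C(unitInterval, ℝ)) (w : X) :
    0 ≤ coercive hq κ f w := by
  have := lyap_pos q κ (toX f)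
  have := lqCoeff_nonneg q
  have := expW_pos κ (toX f)
  have := inner_mulX_evenPow_nonneg hq f w
  unfold coercive
  positivity

lemma V_toX_restr (hq : 2 ≤ q) (κ : ℝ) (y : C(ℝ, ℝ)) :
    V q κ (toX (restr y)) = ENNReal.ofReal (lyap q κ (toX (restr y))) := by
  have mem := memLp_of_continuous y.continuous (ENNReal.ofReal q)
  have hq0 : 0 < q := by linarith
  rw [lyap_congr (coeFn_toX_restr y), ← toReal_V hq0 κ (coeFn_toX_restr y) mem,
    ENNReal.ofReal_toReal]
  exact V_ne_top_iff.mpr ((mem_Xp_iff_memLp hq0 (coeFn_toX_restr y)).mpr mem)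

namespace IsDirichlet

variable {y y' : C(ℝ, ℝ)}

lemma hasSum_lapCoeff_mul_gradX (h : IsDirichlet y y') (hq : 2 ≤ q) (κ : ℝ) :
    HasSum (fun k => lapCoeff (toX (restr y)) k * inner ℝ (gradX hq κ (restr y)) (eta k))
      (-diss hq κ (restr y) (toX (restr y'))) := by
  rw [gradX_restr, diss, ← toX_linAddOddDeriv]
  exact h.hasSum_lapCoeff_mul (h.comp (hasDerivAt_linAddOdd hq _ _) (linAddOdd_zero hq _ _))

lemma derivNorm_abs_rpow_sq (h : IsDirichlet y y') (hq : 2 < q) :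
    derivNorm (fun r => |toX (restr y) r| ^ (q / 2)) ^ 2 =
      ENNReal.ofReal ((q / 2) ^ 2 *
        inner ℝ (toX (restr y')) (mulX ((evenPowC hq.le).comp (restr y)) (toX (restr y')))) := by
  let z : C(ℝ, ℝ) := ⟨fun r => |y r| ^ (q / 2),
    y.continuous.abs.rpow_const fun _ => .inr (by linarith)⟩
  let z' : C(ℝ, ℝ) := ⟨fun r => q / 2 * oddPow (q / 2) (y r) * y' r,
    (((continuous_oddPow (by linarith)).comp y.continuous).const_mul _).mul y'.continuous⟩
  have deriv_z : ∀ r, HasDerivAt z (z' r) r := fun r =>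
    (hasDerivAt_abs_rpow_oddPow (by linarith) (y r)).comp r (h.hasDerivAt r)
  have ae_eq : (fun r => |toX (restr y) r| ^ (q / 2)) =ᵐ[unitVol] z :=
    (coeFn_toX_restr y).fun_comp (|·| ^ (q / 2))
  rw [derivNorm_sq_of_hasDerivAt deriv_z ae_eq,
    norm_sq_eq_integral (coeFn_toX_restr z'), comp_restr,
    inner_eq_integral_of_ae_eq (coeFn_toX_restr y') ((coeFn_mulX_restr _ _).trans
      (.mul .rfl (coeFn_toX_restr y'))), ← integral_const_mul]
  refine congrArg _ (integral_congr_ae (.of_forall fun r => ?_))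
  change (q / 2 * oddPow (q / 2) (y r) * y' r) ^ 2 =
    (q / 2) ^ 2 * (y' r * (|y r| ^ (q - 2) * y' r))
  rw [mul_pow, mul_pow, oddPow_half_sq hq]
  ring

lemma Theta_eq (h : IsDirichlet y y') (hq : 2 ≤ q) (κ : ℝ) :
    Θ q κ (toX (restr y)) = ENNReal.ofReal (coercive hq κ (restr y) (toX (restr y'))) := by
  have lyap_pos := lyap_pos q κ (toX (restr y))
  have expW_pos := expW_pos κ (toX (restr y))
  have even_nonneg := inner_mulX_evenPow_nonneg hq (restr y) (toX (restr y'))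
  rw [Θ, if_pos h.mem_H01, V_toX_restr hq,
    derivNorm_sq_of_hasDerivAt h.hasDerivAt (coeFn_toX_restr y),
    ← ENNReal.ofReal_one, ← ENNReal.ofReal_add zero_le_one (sq_nonneg _),
    ← ENNReal.ofReal_mul lyap_pos.le, coercive, lqCoeff]
  split_ifs with h2
  · rw [zero_mul, add_zero, add_zero]
  · rw [h.derivNorm_abs_rpow_sq (hq.lt_of_ne' h2), ← ENNReal.ofReal_mul expW_pos.le, one_mul,
      ← ENNReal.ofReal_add (by positivity) (by positivity)]

end IsDirichlet

end LyapunovOnContinuousFunctions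

section FiniteDimensional

variable {q : ℝ} {n : ℕ}

/-- Evaluation of an element of `E n`, as a sine polynomial, at the point `r`. -/
def evalE (n : ℕ) (r : ℝ) : E n →L[ℝ] ℝ := ∑ i : Fin n, etaFun i r • EuclideanSpace.proj i

lemma evalE_apply (r : ℝ) (ξ : E n) : evalE n r ξ = sinePoly ξ r := by
  simp [evalE, sinePoly, etaC, mul_comm]

lemma continuous_evalE : Continuous (evalE n) :=
  continuous_finsetSum _ fun i _ => (etaC i).continuous.smul continuous_const

lemma sinePoly_single (i : Fin n) : sinePoly (EuclideanSpace.single i 1) = etaC i := by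
  simp [sinePoly, ite_smul]

lemma toReal_V_incl (hq : 2 ≤ q) (κ : ℝ) (ζ : E n) :
    (V q κ (incl n ζ)).toReal = lyap q κ fun r => 0 + evalE n r ζ := by
  simp only [zero_add, evalE_apply]
  exact toReal_V (by linarith) κ (toX_sinePoly ζ ▸ coeFn_toX_restr _)
    (memLp_of_continuous (sinePoly ζ).continuous _)

lemma pd_lyap_evalE (hq : 2 ≤ q) (κ : ℝ) (k : Fin n) (ζ : E n) :
    pd (EuclideanSpace.single k 1) (fun ζ => lyap q κ fun r => 0 + evalE n r ζ) ζ =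
      dlyap q κ (fun r => 0 + evalE n r ζ) (etaC k) := by
  rw [pd, (hasFDerivAt_lyap hq κ MemLp.zero' continuous_evalE ζ).fderiv,
    dlyap_clm_apply hq κ (memLp_add_apply MemLp.zero' continuous_evalE ζ) continuous_evalE]
  simp only [evalE_apply, sinePoly_single]

lemma pd_dlyap_evalE (hq : 2 ≤ q) (κ : ℝ) (i : Fin n) (a : C(ℝ, ℝ)) (ζ : E n) :
    pd (EuclideanSpace.single i 1) (fun ζ => dlyap q κ (fun r => 0 + evalE n r ζ) a) ζ =
      ddlyap q κ (fun r => 0 + evalE n r ζ) a (etaC i) := by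
  rw [pd, (hasFDerivAt_dlyap hq κ MemLp.zero' continuous_evalE a.continuous ζ).fderiv,
    ddlyap_clm_apply hq κ (memLp_add_apply MemLp.zero' continuous_evalE ζ) continuous_evalE
      a.continuous]
  simp only [evalE_apply, sinePoly_single]

lemma kolmFin_V (hq : 2 ≤ q) (κ : ℝ) (A : X →L[ℝ] X) (G : E n → E n) (ξ : E n) :
    kolmFin A n G (fun ζ => (V q κ (incl n ζ)).toReal) ξ =
      1 / 2 * finTrace A n (hess hq κ (restr (sinePoly ξ))) +
      ∑ k : Fin n, (lapCoeff (incl n ξ) k + G ξ k) *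
        inner ℝ (gradX hq κ (restr (sinePoly ξ))) (eta k) := by
  have grad_eq (k : Fin n) := funext fun ζ => pd_lyap_evalE hq κ k ζ
  rw [kolmFin, funext fun ζ => toReal_V_incl hq κ ζ]
  simp only [grad_eq, pd_dlyap_evalE hq]
  simp only [finTrace, zero_add, evalE_apply, ddlyap_eq_hess hq, dlyap_eq_inner_gradX hq,
    eta_eq_toX]

end FiniteDimensional

/-! ### First and second variation at a maximiser -/

section SecondOrderTest

lemma deriv_eq_zero_and_deriv2_nonpos_of_le {φ φ' : ℝ → ℝ} {d : ℝ}
    (h : ∀ t, HasDerivAt φ (φ' t) t) (h' : HasDerivAt φ' d 0) (hmax : ∀ t, φ t ≤ φ 0) :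
    φ' 0 = 0 ∧ d ≤ 0 := by
  have critical : φ' 0 = 0 :=
    IsLocalMax.hasDerivAt_eq_zero (.of_forall hmax) (h 0)
  refine ⟨critical, not_lt.mp fun hd => ?_⟩
  have deriv_eq : deriv φ = φ' := funext fun t => (h t).deriv
  have isLocalMin : IsLocalMin φ 0 := isLocalMin_of_deriv_deriv_pos
    (by rwa [deriv_eq, h'.deriv]) (by rwa [deriv_eq]) (h 0).continuousAt
  -- A maximum that is also a local minimum forces `φ` to be locally constant.
  have φ_const : φ =ᶠ[𝓝 0] fun _ => φ 0 := isLocalMin.mono fun t => (hmax t).antisymm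
  have deriv_const : φ' =ᶠ[𝓝 0] fun _ => 0 := by
    simpa only [deriv_eq, deriv_const'] using φ_const.deriv
  exact hd.ne' (h'.unique ((hasDerivAt_const 0 0).congr_of_eventuallyEq deriv_const))

end SecondOrderTest

section Variation

variable {q κ c : ℝ} {u : X → ℝ} {x₀ : X}

/-- The line through the origin in the direction `a`, as a family of linear functionals of the
parameter. -/
def direction (a : C(ℝ, ℝ)) (r : ℝ) : ℝ →L[ℝ] ℝ := a r • .id ℝ ℝ

lemma direction_apply (a : C(ℝ, ℝ)) (r t : ℝ) : direction a r t = a r * t := rfl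

lemma continuous_direction (a : C(ℝ, ℝ)) : Continuous (direction a) :=
  a.continuous.smul continuous_const

lemma coeFn_add_smul_toX {x : X} {y : ℝ → ℝ} (hy : x =ᵐ[unitVol] y) (a : C(ℝ, ℝ)) (t : ℝ) :
    (x + t • toX (restr a) : X) =ᵐ[unitVol] fun r => y r + direction a r t := by
  filter_upwards [Lp.coeFn_add x (t • toX (restr a)), Lp.coeFn_smul t (toX (restr a)),
    coeFn_toX_restr a, hy] with r hadd hsmul ha hy
  rw [hadd, Pi.add_apply, hy, hsmul, Pi.smul_apply, ha, smul_eq_mul, mul_comm, direction_apply]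

lemma hasDerivAt_lyap_direction (hq : 2 ≤ q) (κ : ℝ) {y : ℝ → ℝ}
    (hy : MemLp y (ENNReal.ofReal q) unitVol) (a : C(ℝ, ℝ)) (t : ℝ) :
    HasDerivAt (fun t => lyap q κ fun r => y r + direction a r t)
      (dlyap q κ (fun r => y r + direction a r t) a) t := by
  have h := (hasFDerivAt_lyap hq κ hy (continuous_direction a) t).hasDerivAt
  rw [dlyap_clm_apply hq κ (memLp_add_apply hy (continuous_direction a) t)
    (continuous_direction a)] at h
  simpa only [direction_apply, mul_one] using h

lemma hasDerivAt_dlyap_direction (hq : 2 ≤ q) (κ : ℝ) {y : ℝ → ℝ}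
    (hy : MemLp y (ENNReal.ofReal q) unitVol) (a : C(ℝ, ℝ)) (t : ℝ) :
    HasDerivAt (fun t => dlyap q κ (fun r => y r + direction a r t) a)
      (ddlyap q κ (fun r => y r + direction a r t) a a) t := by
  have h := (hasFDerivAt_dlyap hq κ hy (continuous_direction a) a.continuous t).hasDerivAt
  rw [ddlyap_clm_apply hq κ (memLp_add_apply hy (continuous_direction a) t)
    (continuous_direction a) a.continuous] at h
  simpa only [direction_apply, mul_one] using h

lemma IsRatioMax.variation (h : IsRatioMax q κ u c x₀) (hq : 2 ≤ q) (hu : ContDiff ℝ 2 u)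
    {y : ℝ → ℝ} (hy : x₀ =ᵐ[unitVol] y) (a : C(ℝ, ℝ)) :
    fderiv ℝ u x₀ (toX (restr a)) = c * dlyap q κ y a ∧
      fderiv ℝ (fderiv ℝ u) x₀ (toX (restr a)) (toX (restr a)) ≤ c * ddlyap q κ y a a := by
  set v := toX (restr a)
  have hq0 : 0 < q := by linarith
  have memLp := (mem_Xp_iff_memLp hq0 hy).mp h.mem
  have memLp_line (t : ℝ) := memLp_add_apply memLp (continuous_direction a) t
  have V_line (t : ℝ) : (V q κ (x₀ + t • v)).toReal = lyap q κ fun r => y r + direction a r t :=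
    toReal_V hq0 κ (coeFn_add_smul_toX hy a t) (memLp_line t)
  have line (t : ℝ) : HasDerivAt (fun t : ℝ => x₀ + t • v) v t := by
    simpa only [one_smul] using ((hasDerivAt_id' t).smul_const v).const_add x₀
  have first (t : ℝ) := ((hu.differentiable two_ne_zero _).hasFDerivAt.comp_hasDerivAt t
    (line t)).sub ((hasDerivAt_lyap_direction hq κ memLp a t).const_mul c)
  have second := ((((hu.fderiv_right (m := 1) (by norm_num)).clm_apply
    (contDiff_const (c := v))).differentiable one_ne_zero _).hasFDerivAt.comp_hasDerivAt 0
    (line 0)).sub ((hasDerivAt_dlyap_direction hq κ memLp a 0).const_mul c)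
  have line_zero : (fun r => y r + direction a r 0) = y := by
    funext r
    rw [map_zero, add_zero]
  obtain ⟨critical, concave⟩ := deriv_eq_zero_and_deriv2_nonpos_of_le first second fun t => by
    have le := h.le _ ((mem_Xp_iff_memLp hq0 (coeFn_add_smul_toX hy a t)).mpr (memLp_line t))
    have eq := h.eq
    rw [← add_zero x₀, ← zero_smul ℝ v, V_line] at eq
    rw [V_line] at le
    exact (sub_nonpos.mpr le).trans_eq (sub_eq_zero.mpr eq).symm
  rw [line_zero, zero_smul, add_zero] at critical concave
  exact ⟨sub_eq_zero.mp critical, pd_pd hu v v x₀ ▸ sub_nonpos.mp concave⟩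

end Variation

section EulerLagrange

variable {q α β : ℝ}

lemma le_linAddOddDeriv (hq : 2 ≤ q) (hβ : 0 ≤ β) (s : ℝ) : α ≤ linAddOddDeriv hq α β s :=
  le_add_of_nonneg_right
    (mul_nonneg (mul_nonneg hβ (by linarith)) (Real.rpow_nonneg (abs_nonneg s) _))

lemma surjective_linAddOdd (hq : 2 ≤ q) (hα : 0 < α) (hβ : 0 ≤ β) :
    Function.Surjective (linAddOdd hq α β) := by
  have even_nonneg (s : ℝ) : 0 ≤ |s| ^ (q - 2) := Real.rpow_nonneg (abs_nonneg s) _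
  refine (linAddOdd hq α β).continuous.surjective
    (tendsto_atTop_mono' _ ?_ (tendsto_id.const_mul_atTop hα))
    (tendsto_atBot_mono' _ ?_ (tendsto_id.const_mul_atBot hα))
  · filter_upwards [eventually_ge_atTop 0] with s hs
    exact le_add_of_nonneg_right (mul_nonneg hβ (mul_nonneg (even_nonneg s) hs))
  · filter_upwards [eventually_le_atBot 0] with s hs
    exact add_le_of_nonpos_right
      (mul_nonpos_of_nonneg_of_nonpos hβ (mul_nonpos_of_nonneg_of_nonpos (even_nonneg s) hs))

lemma exists_inverse_linAddOdd (hq : 2 ≤ q) (hα : 0 < α) (hβ : 0 ≤ β) :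
    ∃ ψ ψ' : C(ℝ, ℝ), (∀ s, HasDerivAt ψ (ψ' s) s) ∧ ∀ s, ψ (linAddOdd hq α β s) = s := by
  have deriv_pos (s : ℝ) : 0 < linAddOddDeriv hq α β s := hα.trans_le (le_linAddOddDeriv hq hβ s)
  have strictMono : StrictMono (linAddOdd hq α β) := strictMono_of_deriv_pos fun s => by
    rw [(hasDerivAt_linAddOdd hq α β s).deriv]
    exact deriv_pos s
  let e : ℝ ≃o ℝ := strictMono.orderIsoOfSurjective _ (surjective_linAddOdd hq hα hβ)
  refine ⟨⟨e.symm, e.symm.continuous⟩, ⟨fun s => (linAddOddDeriv hq α β (e.symm s))⁻¹,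
    ((linAddOddDeriv hq α β).continuous.comp e.symm.continuous).inv₀ fun s => (deriv_pos _).ne'⟩,
    fun s => ?_, e.symm_apply_apply⟩
  exact (hasDerivAt_linAddOdd hq α β _).of_local_left_inverse e.symm.continuous.continuousAt
    (deriv_pos _).ne' (.of_forall e.apply_symm_apply)

lemma ae_eq_zero_of_integral_mul_eq_zero {f : ℝ → ℝ} (hf : Integrable f unitVol)
    (h : ∀ a : C(ℝ, ℝ), ∫ r, f r * a r ∂unitVol = 0) : f =ᵐ[unitVol] 0 := by
  refine ae_eq_zero_of_integral_contDiff_smul_eq_zero hf.locallyIntegrable fun a ha _ => ?_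
  rw [← h ⟨a, ha.continuous⟩]
  exact integral_congr_ae (.of_forall fun r => mul_comm _ _)

variable {κ : ℝ} {x : X}

lemma linAddOdd_ae_eq (hq : 2 ≤ q) (hx : x ∈ Xp q) {e : C(ℝ, ℝ)}
    (h : ∀ a : C(ℝ, ℝ), dlyap q κ x a = inner ℝ (toX (restr e)) (toX (restr a))) :
    (fun r => linAddOdd hq (2 * κ * lyap q κ x) (oddCoeff q κ x) (x r)) =ᵐ[unitVol] e := by
  have memLp := (mem_Xp_iff_memLp (by linarith) (ae_eq_refl x)).mp hx
  have int_x := integrable_of_memLp hq memLp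
  have int_odd := integrable_oddPow_comp hq memLp
  have int_e := integrable_of_continuous e.continuous
  have int_lin : Integrable
      (fun r => linAddOdd hq (2 * κ * lyap q κ x) (oddCoeff q κ x) (x r)) unitVol :=
    (int_x.const_mul _).add (int_odd.const_mul _)
  rw [← sub_ae_eq_zero]
  refine ae_eq_zero_of_integral_mul_eq_zero (int_lin.sub int_e) fun a => ?_
  have euler := h a
  rw [inner_eq_integral_of_ae_eq (coeFn_toX_restr e) (coeFn_toX_restr a), dlyap] at euler
  simp only [smul_eq_mul, ← integral_const_mul] at euler
  rw [← integral_add ((integrable_mul_of_continuous int_x a.continuous).const_mul _)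
    ((integrable_mul_of_continuous int_odd a.continuous).const_mul _)] at euler
  simp only [Pi.sub_apply, sub_mul]
  rw [integral_sub (integrable_mul_of_continuous int_lin a.continuous)
    (integrable_mul_of_continuous int_e a.continuous), sub_eq_zero, ← euler]
  refine integral_congr_ae (.of_forall fun r => ?_)
  simp only [linAddOdd, oddPowC, ContinuousMap.add_apply, ContinuousMap.smul_apply,
    ContinuousMap.id_apply, ContinuousMap.coe_mk, smul_eq_mul]
  ring

lemma exists_isDirichlet_of_dlyap_eq (hq : 2 ≤ q) (hκ : 0 < κ) (hx : x ∈ Xp q) {e e' : C(ℝ, ℝ)}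
    (he : IsDirichlet e e')
    (h : ∀ a : C(ℝ, ℝ), dlyap q κ x a = inner ℝ (toX (restr e)) (toX (restr a))) :
    ∃ y y' : C(ℝ, ℝ), IsDirichlet y y' ∧ x = toX (restr y) := by
  have hα : 0 < 2 * κ * lyap q κ x := mul_pos (by positivity) (lyap_pos q κ x)
  obtain ⟨ψ, ψ', deriv_ψ, left_inv⟩ :=
    exists_inverse_linAddOdd hq hα (oddCoeff_nonneg (by linarith : 0 ≤ q) κ x)
  have ψ_zero : ψ 0 = 0 := by simpa only [linAddOdd_zero] using left_inv 0
  refine ⟨ψ.comp e, _, he.comp deriv_ψ ψ_zero, eq_toX_restr ?_⟩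
  filter_upwards [linAddOdd_ae_eq hq hx h] with r hr
  rw [ContinuousMap.comp_apply, ← hr, left_inv]

end EulerLagrange

/-! ### Passage to the limit in the dimension -/

section Projection

variable {N : ℕ} {g : E N → ℝ}

lemma inner_incl_eq_sum (ξ : E N) (x : X) :
    inner ℝ (incl N ξ) x = ∑ i, ξ i * inner ℝ x (eta i) := by
  simp only [incl, sum_inner, real_inner_smul_left]
  exact Finset.sum_congr rfl fun i _ => by rw [real_inner_comm]

lemma inner_incl (ξ : E N) (x : X) : inner ℝ (incl N ξ) x = inner ℝ ξ (proj N x) :=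
  (inner_incl_eq_sum ξ x).trans (Finset.sum_congr rfl fun _ _ => mul_comm _ _)

lemma incl_sub (ξ ζ : E N) : incl N (ξ - ζ) = incl N ξ - incl N ζ := by
  simp only [incl, PiLp.sub_apply, sub_smul, Finset.sum_sub_distrib]

lemma norm_incl (ξ : E N) : ‖incl N ξ‖ = ‖ξ‖ := by
  have proj_incl : proj N (incl N ξ) = ξ := PiLp.ext fun i => inner_incl_eta N ξ i
  rw [norm_eq_sqrt_real_inner, inner_incl, proj_incl, ← norm_eq_sqrt_real_inner]

lemma tendsto_incl_proj (x : X) : Tendsto (fun n => incl n (proj n x)) atTop (𝓝 x) := by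
  refine (etaBasis.hasSum_repr x).tendsto_sum_nat.congr fun n => ?_
  rw [Finset.sum_range, incl]
  simp only [etaBasis.repr_apply_apply, etaBasis_apply, proj, real_inner_comm x]

lemma fderiv_cylinder_apply (hg : Differentiable ℝ g) (x h : X) :
    fderiv ℝ (g ∘ proj N) x h = inner ℝ (incl N (gradient g (proj N x))) h := by
  rw [inner_incl, inner_gradient_left, ← coe_projL]
  exact coe_projL N ▸ congrFun (pd_cylinder hg h) x

end Projection

section Trace

variable {A : X →L[ℝ] X} {n : ℕ}

lemma IsCovariance.posSemidef (hA : IsCovariance A) (n : ℕ) :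
    (Matrix.of fun i j : Fin n => inner ℝ (eta i) (A (eta j))).PosSemidef := by
  refine .of_dotProduct_mulVec_nonneg (.ext fun i j => ?_) fun ξ => ?_
  · exact (real_inner_comm _ _).trans (hA.1.1 _ _)
  · refine (hA.1.2 (∑ i, ξ i • eta i)).trans_eq ?_
    change inner ℝ (A (∑ i, ξ i • eta i)) _ = _
    rw [real_inner_comm, map_sum, sum_inner]
    simp only [dotProduct, Matrix.mulVec, Matrix.of_apply, star_trivial, inner_sum, map_smul,
      real_inner_smul_left, real_inner_smul_right, Finset.mul_sum]
    exact Finset.sum_congr rfl fun i _ => Finset.sum_congr rfl fun j _ => by ring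

lemma exists_finTrace_eq_sum (hA : IsCovariance A) (n : ℕ) :
    ∃ (m : ℕ) (w : Fin m → E n), ∀ B : X →L[ℝ] X →L[ℝ] ℝ,
      finTrace A n B = ∑ k, B (incl n (w k)) (incl n (w k)) := by
  obtain ⟨m, v, hv⟩ := Matrix.posSemidef_iff_eq_sum_vecMulVec.mp (hA.posSemidef n)
  have entry (i j : Fin n) : inner ℝ (eta i) (A (eta j)) = ∑ k, v k i * v k j := by
    simpa [Matrix.sum_apply, Matrix.vecMulVec_apply] using congrFun (congrFun hv i) j
  refine ⟨m, fun k => WithLp.toLp 2 (v k), fun B => ?_⟩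
  have expand (k : Fin m) : B (incl n (WithLp.toLp 2 (v k))) (incl n (WithLp.toLp 2 (v k))) =
      ∑ i : Fin n, ∑ j : Fin n, v k i * v k j * B (eta j) (eta i) := by
    simp only [incl, map_sum, map_smul, sum_apply, smul_apply, smul_eq_mul,
      Finset.mul_sum, mul_assoc]
  simp only [expand, finTrace, entry, Finset.sum_mul]
  rw [Finset.sum_comm (γ := Fin m)]
  exact Finset.sum_congr rfl fun i _ => Finset.sum_comm

lemma neg_mul_tsum_le_finTrace (hA : IsCovariance A) {B : X →L[ℝ] X →L[ℝ] ℝ} {ε : ℝ} (hε : 0 ≤ ε)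
    (hB : ∀ ξ : E n, -(ε * ‖incl n ξ‖ ^ 2) ≤ B (incl n ξ) (incl n ξ)) :
    -(ε * ∑' k, inner ℝ (eta k) (A (eta k))) ≤ finTrace A n B := by
  obtain ⟨m, w, finTrace_eq⟩ := exists_finTrace_eq_sum hA n
  have trace_le : ∑ k, ‖incl n (w k)‖ ^ 2 ≤ ∑' k, inner ℝ (eta k) (A (eta k)) := by
    calc ∑ k, ‖incl n (w k)‖ ^ 2 = finTrace A n innerX := by
          simp only [finTrace_eq, innerX_apply, real_inner_self_eq_norm_sq]
      _ = ∑ i ∈ Finset.range n, inner ℝ (eta i) (A (eta i)) := by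
          simp [finTrace, innerX_apply, inner_eta_eta, Finset.sum_range, Fin.val_inj]
      _ ≤ _ := hA.2.sum_le_tsum _ fun k _ =>
          (hA.1.2 (eta k)).trans_eq (real_inner_comm (eta k) (A (eta k)))
  rw [finTrace_eq]
  refine le_trans ?_ (Finset.sum_le_sum fun k _ => hB (w k))
  rw [Finset.sum_neg_distrib, ← Finset.mul_sum]
  gcongr

lemma finTrace_smul_sub (A : X →L[ℝ] X) (n : ℕ) (c : ℝ) (B D : X →L[ℝ] X →L[ℝ] ℝ) :
    finTrace A n (c • B - D) = c * finTrace A n B - finTrace A n D := by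
  simp only [finTrace, sub_apply, smul_apply, smul_eq_mul, mul_sub, Finset.sum_sub_distrib,
    Finset.mul_sum, mul_left_comm c]

end Trace

section Maximizer

variable {q κ c : ℝ} {u : X → ℝ} {A : X →L[ℝ] X}

lemma IsRatioMax.exists_isDirichlet {N : ℕ} {g : E N → ℝ} {x₀ : X}
    (h : IsRatioMax q κ (g ∘ proj N) c x₀) (hq : 2 ≤ q) (hκ : 0 < κ) (hg : ContDiff ℝ 2 g) :
    ∃ y y' : C(ℝ, ℝ), IsDirichlet y y' ∧ x₀ = toX (restr y) := by
  refine exists_isDirichlet_of_dlyap_eq hq hκ h.mem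
    (isDirichlet_sinePoly (c⁻¹ • gradient g (proj N x₀))) fun a => ?_
  have critical := (h.variation hq (contDiff_cylinder hg) .rfl a).1
  rw [fderiv_cylinder_apply (hg.differentiable two_ne_zero), inner_incl] at critical
  rw [toX_sinePoly, inner_incl, real_inner_smul_left, critical, inv_mul_cancel_left₀ h.pos.ne']

lemma IsDirichlet.kolm_eq {y y' : C(ℝ, ℝ)} (hy : IsDirichlet y y') (hq : 2 ≤ q)
    (F : H01 → X)
    (grad_eq : ∀ k, pd (eta k) u (toX (restr y)) = c * inner ℝ (gradX hq κ (restr y)) (eta k)) :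
    kolm A F u ⟨toX (restr y), hy.mem_H01⟩ = 1 / 2 * traceTerm A u (toX (restr y)) +
      c * (-diss hq κ (restr y) (toX (restr y')) +
        inner ℝ (F ⟨toX (restr y), hy.mem_H01⟩) (gradX hq κ (restr y))) := by
  have drift := etaBasis.hasSum_inner_mul_inner (F ⟨toX (restr y), hy.mem_H01⟩)
    (gradX hq κ (restr y))
  simp only [etaBasis_apply, ← real_inner_comm (eta _) (gradX hq κ _)] at drift
  rw [kolm, ← (((hy.hasSum_lapCoeff_mul_gradX hq κ).add drift).mul_left c).tsum_eq]
  congr 2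
  funext k
  rw [grad_eq]
  ring

lemma kolmFin_V_eq_diss {n : ℕ} (hq : 2 ≤ q) (κ : ℝ) (A : X →L[ℝ] X) (G : E n → E n) (ξ : E n) :
    kolmFin A n G (fun ζ => (V q κ (incl n ζ)).toReal) ξ =
      1 / 2 * finTrace A n (hess hq κ (restr (sinePoly ξ))) +
      (-diss hq κ (restr (sinePoly ξ)) (toX (restr (sinePolyDeriv ξ))) +
        inner ℝ (incl n (G ξ)) (gradX hq κ (restr (sinePoly ξ)))) := by
  have lap := (isDirichlet_sinePoly ξ).hasSum_lapCoeff_mul_gradX hq κ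
  rw [toX_sinePoly] at lap
  have lapCoeff_of_le (k : ℕ) (hk : k ∉ Finset.range n) : lapCoeff (incl n ξ) k = 0 := by
    rw [lapCoeff, inner_incl, ← coe_projL,
      projL_eta_of_le (not_lt.mp (Finset.mem_range.not.mp hk)), inner_zero_right, mul_zero]
  rw [kolmFin_V hq, ← lap.tsum_eq, tsum_eq_sum (s := Finset.range n)
    fun k hk => by rw [lapCoeff_of_le k hk, zero_mul], Finset.sum_range, inner_incl_eq_sum]
  simp only [add_mul, Finset.sum_add_distrib]

lemma IsRatioMax.traceTerm_le {N n : ℕ} {g : E N → ℝ} {y : C(ℝ, ℝ)}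
    (h : IsRatioMax q κ (g ∘ proj N) c (toX (restr y))) (hA : IsCovariance A) (hq : 2 ≤ q)
    (hg : ContDiff ℝ 2 g) (hn : N ≤ n) (f : C(unitInterval, ℝ)) :
    traceTerm A (g ∘ proj N) (toX (restr y)) ≤ c * finTrace A n (hess hq κ f) +
      c * ‖hess hq κ f - hess hq κ (restr y)‖ * ∑' k, inner ℝ (eta k) (A (eta k)) := by
  set H₀ := hess hq κ (restr y)
  set D := fderiv ℝ (fderiv ℝ (g ∘ proj N)) (toX (restr y))
  rw [traceTerm_cylinder A hg hn, ← sub_le_iff_le_add', ← neg_le_neg_iff, neg_sub,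
    ← finTrace_smul_sub]
  refine neg_mul_tsum_le_finTrace hA (mul_nonneg h.pos.le (ContinuousLinearMap.opNorm_nonneg _))
    fun ξ => ?_
  have concave := (h.variation hq (contDiff_cylinder hg) (coeFn_toX_restr y) (sinePoly ξ)).2
  rw [ddlyap_eq_hess hq, toX_sinePoly] at concave
  set v := incl n ξ
  have hess_sub : -(‖hess hq κ f - H₀‖ * ‖v‖ * ‖v‖) ≤ (hess hq κ f - H₀) v v :=
    (abs_le.mp ((hess hq κ f - H₀).le_opNorm₂ v v)).1
  calc -(c * ‖hess hq κ f - H₀‖ * ‖v‖ ^ 2)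
      = c * -(‖hess hq κ f - H₀‖ * ‖v‖ * ‖v‖) := by ring
    _ ≤ c * (hess hq κ f - H₀) v v := mul_le_mul_of_nonneg_left hess_sub h.pos.le
    _ = c * hess hq κ f v v - c * H₀ v v := mul_sub c _ _
    _ ≤ c * hess hq κ f v v - D v v := sub_le_sub_left concave _

/-- The inequality `L_n V ≤ l V - m Θ` on `E_n`, `n ≥ 1`, which condition (F2a) requires for each
pair `(q, κ)`. -/
def LyapunovBound (A : X →L[ℝ] X) (FN : (n : ℕ) → E n → E n) (q κ l m : ℝ) : Prop :=
  ∀ n : ℕ, 1 ≤ n → ∀ ξ : E n,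
    kolmFin A n (FN n) (fun ζ => (V q κ (incl n ζ)).toReal) ξ ≤
      l * (V q κ (incl n ξ)).toReal - m * (Θ q κ (incl n ξ)).toReal

variable {F : H01 → X} {FN : (n : ℕ) → E n → E n} {l m : ℝ}

lemma LyapunovBound.sinePoly_le (h : LyapunovBound A FN q κ l m) (hq : 2 ≤ q) {n : ℕ} (hn : 1 ≤ n)
    (ξ : E n) :
    1 / 2 * finTrace A n (hess hq κ (restr (sinePoly ξ))) +
      (-diss hq κ (restr (sinePoly ξ)) (toX (restr (sinePolyDeriv ξ))) +
        inner ℝ (incl n (FN n ξ)) (gradX hq κ (restr (sinePoly ξ)))) ≤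
      l * lyap q κ (toX (restr (sinePoly ξ))) -
        m * coercive hq κ (restr (sinePoly ξ)) (toX (restr (sinePolyDeriv ξ))) := by
  have bound := h n hn ξ
  rwa [kolmFin_V_eq_diss hq, ← toX_sinePoly ξ, V_toX_restr hq, (isDirichlet_sinePoly ξ).Theta_eq hq,
    ENNReal.toReal_ofReal (lyap_pos _ _ _).le, ENNReal.toReal_ofReal (coercive_nonneg _ _ _ _)]
    at bound

lemma CondF2c.tendsto_incl (hF : CondF2c F FN) (x : H01) :
    Tendsto (fun n => incl n (FN n (proj n x))) atTop (𝓝 (F x)) := by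
  refine (tendsto_incl_proj (F x)).congr_dist ((hF x).congr fun n => ?_)
  rw [dist_eq_norm, ← norm_incl, incl_sub]

set_option maxSynthPendingDepth 3 in
lemma IsDirichlet.tendsto_norm_hess_sub {y y' : C(ℝ, ℝ)} (hy : IsDirichlet y y') (hq : 2 ≤ q)
    (κ : ℝ) :
    Tendsto (fun n => ‖hess hq κ (restr (sinePoly (proj n (toX (restr y))))) -
      hess hq κ (restr y)‖) atTop (𝓝 0) :=
  tendsto_iff_norm_sub_tendsto_zero.mp (((continuous_hess hq κ).tendsto _).comp hy.tendsto_sinePoly)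

lemma IsRatioMax.kolm_le {N : ℕ} {g : E N → ℝ} {y y' : C(ℝ, ℝ)}
    (h : IsRatioMax q κ (g ∘ proj N) c (toX (restr y))) (hy : IsDirichlet y y')
    (hA : IsCovariance A) (hq : 2 ≤ q) (hg : ContDiff ℝ 2 g) (hF : CondF2c F FN)
    (hL : LyapunovBound A FN q κ l m) :
    kolm A F (g ∘ proj N) ⟨toX (restr y), hy.mem_H01⟩ ≤
      c * (l * lyap q κ (toX (restr y)) - m * coercive hq κ (restr y) (toX (restr y'))) := by
  have grad_eq (k : ℕ) : pd (eta k) (g ∘ proj N) (toX (restr y)) =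
      c * inner ℝ (gradX hq κ (restr y)) (eta k) := by
    rw [pd, eta_eq_toX, (h.variation hq (contDiff_cylinder hg) (coeFn_toX_restr y) (etaC k)).1,
      dlyap_eq_inner_gradX hq]
  rw [hy.kolm_eq hq F grad_eq]
  have poly := hy.tendsto_sinePoly
  have poly_deriv := poly.prodMk_nhds hy.tendsto_sinePolyDeriv
  have lim_trace := ((((hy.tendsto_norm_hess_sub hq κ).const_mul c).mul_const
    (∑' k, inner ℝ (eta k) (A (eta k)))).const_sub
      (traceTerm A (g ∘ proj N) (toX (restr y)))).const_mul (1 / 2)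
  rw [mul_zero, zero_mul, sub_zero] at lim_trace
  have lim_diss := ((continuous_diss hq κ).tendsto _).comp poly_deriv
  have lim_drift := (hF.tendsto_incl ⟨_, hy.mem_H01⟩).inner (𝕜 := ℝ)
    (((continuous_gradX hq κ).tendsto _).comp poly)
  have lim_lyap := ((continuous_lyap_toX hq κ).tendsto _).comp poly
  have lim_coercive := ((continuous_coercive hq κ).tendsto _).comp poly_deriv
  refine le_of_tendsto_of_tendsto (lim_trace.add ((lim_diss.neg.add lim_drift).const_mul c))
    (((lim_lyap.const_mul l).sub (lim_coercive.const_mul m)).const_mul c) ?_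
  filter_upwards [eventually_ge_atTop N, eventually_ge_atTop 1] with n hN h1
  have trace_le := h.traceTerm_le hA hq hg hN (restr (sinePoly (proj n (toX (restr y)))))
  have bound := mul_le_mul_of_nonneg_left (hL.sinePoly_le hq h1 (proj n (toX (restr y)))) h.pos.le
  simp only [Function.comp_apply]
  linarith

lemma IsRatioMax.exists_kolm_le {N : ℕ} {g : E N → ℝ} {x₀ : X}
    (h : IsRatioMax q κ (g ∘ proj N) c x₀) (hA : IsCovariance A) (hq : 2 ≤ q) (hκ : 0 < κ)
    (hg : ContDiff ℝ 2 g) (hF : CondF2c F FN) (hL : LyapunovBound A FN q κ l m) :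
    ∃ hx : x₀ ∈ H01, Θ q κ x₀ ≠ ⊤ ∧ kolm A F (g ∘ proj N) ⟨x₀, hx⟩ ≤
      c * (l * (V q κ x₀).toReal - m * (Θ q κ x₀).toReal) := by
  obtain ⟨y, y', hy, rfl⟩ := h.exists_isDirichlet hq hκ hg
  refine ⟨hy.mem_H01, hy.Theta_eq hq κ ▸ ENNReal.ofReal_ne_top, ?_⟩
  rw [V_toX_restr hq, hy.Theta_eq hq, ENNReal.toReal_ofReal (lyap_pos _ _ _).le,
    ENNReal.toReal_ofReal (coercive_nonneg _ _ _ _)]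
  exact h.kolm_le hy hA hq hg hF hL

end Maximizer

/-! ### The resolvent estimate -/

section Estimate

variable {q κ c : ℝ} {u : X → ℝ} {A : X →L[ℝ] X}

lemma pd_neg {B : Type*} [NormedAddCommGroup B] [NormedSpace ℝ B] (h : B) (u : B → ℝ) :
    pd h (-u) = -pd h u :=
  funext fun x => by simp only [pd, fderiv_neg, Pi.neg_apply, neg_apply]

lemma traceTerm_neg (A : X →L[ℝ] X) (u : X → ℝ) (x : X) :
    traceTerm A (-u) x = -traceTerm A u x := by
  simp only [traceTerm, pd_neg, Pi.neg_apply, mul_neg, tsum_neg]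

lemma kolm_neg (A : X →L[ℝ] X) (F : H01 → X) (u : X → ℝ) (x : H01) :
    kolm A F (-u) x = -kolm A F u x := by
  simp only [kolm, traceTerm_neg, pd_neg, Pi.neg_apply, mul_neg, tsum_neg, neg_add]

lemma neg_mem_testFun (hu : u ∈ testFun A q κ) : -u ∈ testFun A q κ := by
  obtain ⟨⟨N, g, hg, rfl⟩, bounded⟩ := hu
  refine ⟨⟨N, -g, hg.neg, rfl⟩, ?_⟩
  simpa only [wnorm, Pi.neg_apply, enorm_neg, fderiv_neg, norm_neg, traceTerm_neg] using bounded

variable {F : H01 → X} {FN : (n : ℕ) → E n → E n} {κ₁ l₀ l m : ℝ}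

lemma wnorm_neg_resolvent (A : X →L[ℝ] X) (F : H01 → X) (W : X → ℝ≥0∞) (u : X → ℝ) (l : ℝ) :
    wnorm W (fun x : H01 => l * (-u) x - kolm A F (-u) x) =
      wnorm W fun x : H01 => l * u x - kolm A F u x := by
  refine iSup_congr fun x => ?_
  beta_reduce
  rw [kolm_neg, Pi.neg_apply, mul_neg, neg_sub_neg, ← enorm_neg, neg_sub]

lemma IsRatioMax.ofReal_mul_le_wnorm {N : ℕ} {g : E N → ℝ} {x₀ : X}
    (h : IsRatioMax q κ (g ∘ proj N) c x₀) (hA : IsCovariance A) (hq : 2 ≤ q) (hκ : 0 < κ)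
    (hg : ContDiff ℝ 2 g) (hF : CondF2c F FN) (hL : LyapunovBound A FN q κ l₀ m) (hl : l₀ ≤ l) :
    ENNReal.ofReal (c * m) ≤
      wnorm (Θ q κ) fun x : H01 => l * (g ∘ proj N) x - kolm A F (g ∘ proj N) x := by
  obtain ⟨hx, Θ_ne_top, kolm_le⟩ := h.exists_kolm_le hA hq hκ hg hF hL
  have Θ_ne_zero : Θ q κ x₀ ≠ 0 :=
    (one_pos.trans_le ((one_le_V hκ.le q x₀).trans (V_le_Theta q κ hx))).ne'
  have mul_le : c * m * (Θ q κ x₀).toReal ≤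
      l * (g ∘ proj N) x₀ - kolm A F (g ∘ proj N) ⟨x₀, hx⟩ := by
    have := mul_le_mul_of_nonneg_right hl (mul_nonneg h.pos.le (V q κ x₀).toReal_nonneg)
    rw [h.eq]
    linarith
  refine le_iSup_of_le ⟨x₀, hx⟩ ?_
  rw [ENNReal.le_div_iff_mul_le (.inl Θ_ne_zero) (.inl Θ_ne_top),
    ← ENNReal.ofReal_toReal Θ_ne_top, ← ENNReal.ofReal_mul' ENNReal.toReal_nonneg]
  exact (ENNReal.ofReal_le_ofReal mul_le).trans (Real.ofReal_le_enorm _)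

lemma ofReal_div_V_le_resolvent (hA : IsCovariance A) (hF : CondF2c F FN) (hq : 2 ≤ q)
    (hκ₁ : κ₁ ∈ Ico 0 κ) (hm : 0 < m) (hL : LyapunovBound A FN q κ l₀ m) (hl : l₀ ≤ l)
    (hu : u ∈ testFun A 2 κ₁) (x : Xp q) :
    ENNReal.ofReal (u x) / V q κ x ≤
      (ENNReal.ofReal m)⁻¹ * wnorm (Θ q κ) fun x : H01 => l * u x - kolm A F u x := by
  have hκ : 0 < κ := hκ₁.1.trans_lt hκ₁.2
  obtain ux | ux := le_or_gt (u x) 0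
  · rw [ENNReal.ofReal_of_nonpos ux, ENNReal.zero_div]
    exact zero_le
  obtain ⟨c, x₀, h⟩ := exists_isRatioMax hq hκ (memWC_testFun hκ₁ hu) x.2 ux
  obtain ⟨N, g, hg, rfl, -⟩ := exists_cylinder_of_mem_testFun hu
  have max_le := h.ofReal_mul_le_wnorm hA hq hκ hg hF hL hl
  rw [ENNReal.ofReal_mul h.pos.le] at max_le
  rw [mul_comm, ← div_eq_mul_inv]
  refine le_trans ?_ ((ENNReal.le_div_iff_mul_le (.inl (ENNReal.ofReal_pos.mpr hm).ne')
    (.inl ENNReal.ofReal_ne_top)).mpr max_le)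
  refine ENNReal.div_le_of_le_mul ?_
  rw [← ENNReal.ofReal_toReal (V_ne_top_iff.mpr x.2), ← ENNReal.ofReal_mul h.pos.le]
  exact ENNReal.ofReal_le_ofReal (h.le x x.2)

lemma wnorm_le_resolvent (hA : IsCovariance A) (hF : CondF2c F FN) (hq : 2 ≤ q)
    (hκ₁ : κ₁ ∈ Ico 0 κ) (hm : 0 < m) (hL : LyapunovBound A FN q κ l₀ m) (hl : l₀ ≤ l)
    (hu : u ∈ testFun A 2 κ₁) :
    wnorm (V q κ) (fun x : Xp q => u x) ≤
      (ENNReal.ofReal m)⁻¹ * wnorm (Θ q κ) fun x : H01 => l * u x - kolm A F u x := by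
  refine iSup_le fun x => ?_
  obtain ux | ux := le_total 0 (u x)
  · rw [Real.enorm_of_nonneg ux]
    exact ofReal_div_V_le_resolvent hA hF hq hκ₁ hm hL hl hu x
  · rw [← wnorm_neg_resolvent, ← enorm_neg, Real.enorm_of_nonneg (neg_nonneg.mpr ux)]
    exact ofReal_div_V_le_resolvent hA hF hq hκ₁ hm hL hl (neg_mem_testFun hu) x

end Estimate

end

end Kolmogorov

theorem proposition6p1_general {A : X →L[ℝ] X} (hA : IsCovariance A) {F : H01 → X}
    {FN : (N : ℕ) → E N → E N} (hF2c : CondF2c F FN) {q κ κ₁ l₀ m : ℝ} (hq : 2 ≤ q)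
    (hκ₁ : κ₁ ∈ Ico 0 κ) (hm : 0 < m) (hL : LyapunovBound A FN q κ l₀ m)
    (hF : ∀ k : ℕ, MemWC (Θ q κ) fun x : H01 => expW κ₁ x * inner ℝ (F x) (eta k))
    {u : X → ℝ} (hu : u ∈ testFun A 2 κ₁) {l : ℝ} (hl : l₀ ≤ l) :
    MemWC (V q κ) (fun x : Xp q => u x) ∧
      MemWC (Θ q κ) (fun x : H01 => l * u x - kolm A F u x) ∧
      wnorm (V q κ) (fun x : Xp q => u x) ≤
        (ENNReal.ofReal m)⁻¹ * wnorm (Θ q κ) (fun x : H01 => l * u x - kolm A F u x) :=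
  ⟨memWC_testFun hκ₁ hu, memWC_resolvent hκ₁ hF hu l,
    wnorm_le_resolvent hA hF2c hq hκ₁ hm hL hl hu⟩

theorem proposition6p1
    (A : X →L[ℝ] X) (hA : IsCovariance A)
    (F : H01 → X) (FN : (N : ℕ) → E N → E N) (hFN : IsApprox FN)
    (κ₀ : ℝ) (Qreg : Set ℝ) (m lam : ℝ → ℝ → ℝ)
    (hF2a : CondF2a A FN κ₀ Qreg m lam) (hF2c : CondF2c F FN)
    (q : ℝ) (hq : q ∈ Qreg) (κ : ℝ) (hκ : κ ∈ Ioo 0 κ₀) (κ₁ : ℝ) (hκ₁ : κ₁ ∈ Ico 0 κ)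
    (hF : ∀ k : ℕ, MemWC (Θ q κ) fun x : H01 => expW κ₁ x * inner ℝ (F x) (eta k)) :
    ∀ u ∈ testFun A 2 κ₁, ∀ l : ℝ, lam q κ ≤ l →
      MemWC (V q κ) (fun x : Xp q => u x) ∧
      MemWC (Θ q κ) (fun x : H01 => l * u x - kolm A F u x) ∧
      wnorm (V q κ) (fun x : Xp q => u x) ≤
        (ENNReal.ofReal (m q κ))⁻¹ * wnorm (Θ q κ) (fun x : H01 => l * u x - kolm A F u x) := by
  intro u hu l hl
  obtain ⟨-, -, hQ, -, hL⟩ := hF2a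
  obtain ⟨hm, bound⟩ := hL κ hκ q hq
  exact proposition6p1_general hA hF2c (hQ hq) hκ₁ hm bound hF hu hl
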